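/- All graphs are finite undirected multigraphs $G=(V,E)$ without self loops, with $n=|V|$ and $m=|E|$. For $S\subseteq V$ let $vol(S)=\sum_{v\in S}\deg(v)$, let $\delta(S)$ be the number of edges with exactly one end in $S$, and let $\phi(S)=\delta(S)/\min\{vol(S),vol(V-S)\}$. A cut $S$ is \emph{$\alpha$-sparse} if $\min\{vol(S),vol(V-S)\}>0$ and $\phi(S)<\alpha$. For $A\subseteq V$ it is \emph{$(A,\sigma)$-overlapping} if $vol(S\cap A)/vol(S)\ge\sigma$. Let $\mathrm{OPT}(G,\alpha,A,\sigma)$ be the largest volume of an $\alpha$-sparse $(A,\sigma)$-overlapping cut $S$ with $vol(S)\le vol(V-S)$, or $0$ if there is none. For $c_{size},c_{con}\ge 1$, a \emph{$(c_{size},c_{con},G,\alpha,A,\sigma)$-LBS cut} is an $\alpha$-sparse cut $S$ with $vol(S)\le vol(V-S)$ and $c_{size}\cdot vol(S)\ge\mathrm{OPT}(G,\alpha/c_{con},A,\sigma)$. \textbf{Theorem.} There are functions $c_{size},c_{con}:(0,1]\to[1,\infty)$ with $c_{size}(\sigma)=O(1/\sigma^2)$ and $c_{con}(\sigma)=O(1/\sigma^2)$,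 and a deterministic algorithm, such that the following holds for every graph $G$, every $A\subseteq V$ and all real $\alpha,\sigma\in(0,1]$ with (i) $2\,vol(A)\le vol(V-A)$ and (ii) $\sigma\ge\frac{2\,vol(A)}{vol(V-A)}$ (read as $\sigma\geq 0$ if $vol(V-A)=0$). On input $(G,A,\sigma,\alpha)$ the algorithm either 1. outputs (as a list of nodes) a $(c_{size}(\sigma),c_{con}(\sigma),G,\alpha,A,\sigma)$-LBS cut $S$, or 2. reports, correctly, that there is no $(\alpha/c_{con}(\sigma))$-sparse $(A,\sigma)$-overlapping cut, so that $\mathrm{OPT}(G,\alpha/c_{con}(\sigma),A,\sigma)=0$, and it runs in time $\tilde O\!\left(1+\frac{vol(A)}{\alpha\sigma^2}\right)$, where $\tilde O$ hides a constant factor and a factor polylogarithmic in $n+m$. Here the algorithm is one fixed program for a word RAM whose integers have absolute value at most $\left(\frac{n+m+2}{\alpha\sigma}\right)^{O(1)}$ and whose elementary operations take unit time. It accesses the input as follows, each access taking unit time: the head of, and the successor of an edge in, the adjacency list (list of incident edges) of a node; the two ends of an edge; the entries of a list of all nodes of degree at least $1$ and of a list of the nodes of $A$ of degree at least $1$; and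 comparisons $p\le q\alpha$ and $p\le q\sigma$ for integers $p,q$. -/

import Mathlib

/-! ## Cuts in finite multigraphs -/

namespace LBS

section Cuts

variable {V E : Type*}

/-- The degree of `v`: the number of edges incident to `v` (the graphs below have no self loops). -/
noncomputable def deg (G : Graph V E) (v : V) : ℕ :=
  {e | G.Inc e v}.ncard

/-- The volume of `S`: the sum of the degrees of its nodes. -/
noncomputable def vol (G : Graph V E) (S : Finset V) : ℕ :=
  ∑ v ∈ S, deg G v

/-- The cut size of `S`: the number of edges with one end in `S` and the other end outside. -/
noncomputable def cutSize (G : Graph V E) (S : Finset V) : ℕ :=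
  {e | ∃ x ∈ S, ∃ y ∉ S, G.IsLink e x y}.ncard

variable [Fintype V] [DecidableEq V]

/-- The conductance of `S`; meaningful only if both sides of the cut have positive volume. -/
noncomputable def conductance (G : Graph V E) (S : Finset V) : ℝ :=
  (cutSize G S : ℝ) / (min (vol G S) (vol G Sᶜ) : ℕ)

/-- `S` is `α`-sparse: its conductance is defined and less than `α`. -/
def IsSparse (G : Graph V E) (α : ℝ) (S : Finset V) : Prop :=
  0 < min (vol G S) (vol G Sᶜ) ∧ conductance G S < α

/-- `S` is `(A, σ)`-overlapping. -/
def IsOverlapping (G : Graph V E) (A : Finset V) (σ : ℝ) (S : Finset V) : Prop :=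
  σ ≤ (vol G (S ∩ A) : ℝ) / vol G S

open Classical in
/-- The largest volume of an `α`-sparse `(A, σ)`-overlapping cut `S` with `vol S ≤ vol (V - S)`,
and `0` if there is no such cut. -/
noncomputable def opt (G : Graph V E) (α : ℝ) (A : Finset V) (σ : ℝ) : ℕ :=
  (Finset.univ.filter fun S : Finset V =>
    IsSparse G α S ∧ IsOverlapping G A σ S ∧ vol G S ≤ vol G Sᶜ).sup (vol G)

/-- `S` is a `(csize, ccon, G, α, A, σ)`-LBS cut. -/
def IsLBSCut (csize ccon : ℝ) (G : Graph V E) (α : ℝ) (A : Finset V) (σ : ℝ)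
    (S : Finset V) : Prop :=
  vol G S ≤ vol G Sᶜ ∧ IsSparse G α S ∧ (opt G (α / ccon) A σ : ℝ) ≤ csize * vol G S

end Cuts

/-! ## Inputs -/

/-- An input of the LBS cut problem, as it is presented to an algorithm: a loopless multigraph with
nodes `0, …, n - 1` and edges `0, …, m - 1`, given by adjacency lists; a set `A` of nodes; an
overlapping parameter `σ` and a conductance parameter `α`. Isolated nodes appear in no list. -/
structure Input (n m : ℕ) where
  /-- the graph -/
  G : Graph (Fin n) (Fin m)
  vertexSet_eq : G.vertexSet = Set.univ
  loopless : G.Loopless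
  /-- the two ends of every edge, in some order -/
  src : Fin m → Fin n
  tgt : Fin m → Fin n
  isLink : ∀ e, G.IsLink e (src e) (tgt e)
  /-- for every node, a list of the edges that are incident to it, in some order -/
  adj : Fin n → List (Fin m)
  adj_nodup : ∀ v, (adj v).Nodup
  mem_adj : ∀ v e, e ∈ adj v ↔ G.Inc e v
  /-- a list of the nodes of degree at least one -/
  nodes : List (Fin n)
  nodes_nodup : nodes.Nodup
  mem_nodes : ∀ v, v ∈ nodes ↔ 1 ≤ deg G v
  /-- the set `A`, and a list of its nodes of degree at least one -/
  A : Finset (Fin n)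
  listA : List (Fin n)
  listA_nodup : listA.Nodup
  mem_listA : ∀ v, v ∈ listA ↔ v ∈ A ∧ 1 ≤ deg G v
  /-- the overlapping parameter -/
  σ : ℝ
  σ_nonneg : 0 ≤ σ
  σ_le_one : σ ≤ 1
  /-- the conductance parameter -/
  α : ℝ
  α_nonneg : 0 ≤ α
  α_le_one : α ≤ 1

/-! ## The machine: structured programs for a word RAM with read access to the input -/

/-- Expressions of the programming language; values are integers. -/
inductive Expr where
  /-- an integer constant -/
  | const (k : ℤ)
  /-- the value of register `x` -/
  | var (x : ℕ)
  /-- the entry of array `a` at a computed index -/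
  | get (a : ℕ) (i : Expr)
  | add (p q : Expr)
  | sub (p q : Expr)
  | mul (p q : Expr)
  | div (p q : Expr)
  /-- comparison of two integers: `1` if `p ≤ q`, else `0` -/
  | le (p q : Expr)
  /-- comparison with the real input `α`: `1` if `p ≤ q * α`, else `0` -/
  | leAlpha (p q : Expr)
  /-- comparison with the real input `σ`: `1` if `p ≤ q * σ`, else `0` -/
  | leSigma (p q : Expr)
  /-- the `i`-th entry of the list of nodes of positive degree, `-1` if there is none -/
  | node (i : Expr)
  /-- the `i`-th entry of the list of nodes of `A`, `-1` if there is none -/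
  | nodeA (i : Expr)
  /-- the head of the adjacency list of node `v`, `-1` if the list is empty -/
  | firstEdge (v : Expr)
  /-- the successor of edge `e` in the adjacency list of node `v`, `-1` if there is none -/
  | nextEdge (v e : Expr)
  /-- the first end of edge `e` -/
  | src (e : Expr)
  /-- the second end of edge `e` -/
  | tgt (e : Expr)

/-- Programs. -/
inductive Program where
  | skip
  /-- store a value in register `x` -/
  | assign (x : ℕ) (p : Expr)
  /-- store the value of `p` in array `a` at index `i` -/
  | put (a : ℕ) (i p : Expr)
  | seq (c d : Program)
  /-- run `c` if the value of `b` is not `0`, else run `d` -/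
  | ite (b : Expr) (c d : Program)
  /-- repeat `c` as long as the value of `b` is not `0` -/
  | loop (b : Expr) (c : Program)

/-- A memory state: the contents of the registers and of the arrays. -/
structure State where
  reg : ℕ → ℤ
  arr : ℕ → ℤ → ℤ

/-- The memory at the start of a run. -/
def State.zero : State := ⟨fun _ => 0, fun _ _ => 0⟩

/-- The integer that names a node or an edge, and `-1` for none. -/
def encode {k : ℕ} : Option (Fin k) → ℤ
  | some i => (i : ℕ)
  | none => -1

/-- The node or edge named by an integer, if there is one. -/
def decode (k : ℕ) (z : ℤ) : Option (Fin k) :=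
  if h : 0 ≤ z ∧ z.toNat < k then some ⟨z.toNat, h.2⟩ else none

/-- The list entry at an integer index, if there is one. -/
def entry {X : Type*} (l : List X) (z : ℤ) : Option X :=
  if 0 ≤ z then l[z.toNat]? else none

variable {n m : ℕ}

/-- The value of an expression. -/
noncomputable def Expr.val (I : Input n m) (s : State) : Expr → ℤ
  | const k => k
  | var x => s.reg x
  | get a i => s.arr a (i.val I s)
  | add p q => p.val I s + q.val I s
  | sub p q => p.val I s - q.val I s
  | mul p q => p.val I s * q.val I s
  | div p q => p.val I s / q.val I s
  | le p q => if p.val I s ≤ q.val I s then 1 else 0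
  | leAlpha p q => open Classical in
      if (p.val I s : ℝ) ≤ (q.val I s : ℝ) * I.α then 1 else 0
  | leSigma p q => open Classical in
      if (p.val I s : ℝ) ≤ (q.val I s : ℝ) * I.σ then 1 else 0
  | node i => encode (entry I.nodes (i.val I s))
  | nodeA i => encode (entry I.listA (i.val I s))
  | firstEdge v => encode ((decode n (v.val I s)).bind fun v => (I.adj v).head?)
  | nextEdge v e => encode ((decode n (v.val I s)).bind fun v =>
      (decode m (e.val I s)).bind fun e => (I.adj v)[(I.adj v).idxOf e + 1]?)
  | src e => encode ((decode m (e.val I s)).map I.src)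
  | tgt e => encode ((decode m (e.val I s)).map I.tgt)

/-- The number of operations in an expression; every operation takes one time step. -/
def Expr.size : Expr → ℕ
  | const _ => 1
  | var _ => 1
  | get _ i => i.size + 1
  | add p q => p.size + q.size + 1
  | sub p q => p.size + q.size + 1
  | mul p q => p.size + q.size + 1
  | div p q => p.size + q.size + 1
  | le p q => p.size + q.size + 1
  | leAlpha p q => p.size + q.size + 1
  | leSigma p q => p.size + q.size + 1
  | node i => i.size + 1
  | nodeA i => i.size + 1
  | firstEdge v => v.size + 1
  | nextEdge v e => v.size + e.size + 1
  | src e => e.size + 1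
  | tgt e => e.size + 1

/-- All values that occur in the evaluation of an expression have absolute value at most `W`. -/
def Expr.Fits (W : ℝ) (I : Input n m) (s : State) (p : Expr) : Prop :=
  |(p.val I s : ℝ)| ≤ W ∧
    match p with
    | const _ => True
    | var _ => True
    | get _ i => i.Fits W I s
    | add p q => p.Fits W I s ∧ q.Fits W I s
    | sub p q => p.Fits W I s ∧ q.Fits W I s
    | mul p q => p.Fits W I s ∧ q.Fits W I s
    | div p q => p.Fits W I s ∧ q.Fits W I s
    | le p q => p.Fits W I s ∧ q.Fits W I s
    | leAlpha p q => p.Fits W I s ∧ q.Fits W I s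
    | leSigma p q => p.Fits W I s ∧ q.Fits W I s
    | node i => i.Fits W I s
    | nodeA i => i.Fits W I s
    | firstEdge v => v.Fits W I s
    | nextEdge v e => v.Fits W I s ∧ e.Fits W I s
    | src e => e.Fits W I s
    | tgt e => e.Fits W I s

/-- The state after `z` has been stored in register `x`. -/
def State.setReg (s : State) (x : ℕ) (z : ℤ) : State :=
  { s with reg := Function.update s.reg x z }

/-- The state after `z` has been stored in array `a` at index `i`. -/
def State.setArr (s : State) (a : ℕ) (i z : ℤ) : State :=
  { s with arr := Function.update s.arr a (Function.update (s.arr a) i z) }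

/-- `Exec W I c s s' t`: on input `I`, program `c` takes state `s` to state `s'`, halts after
exactly `t` steps, and all integers that it handles on the way have absolute value at most `W`
(a run that produces a larger integer gets stuck, so that it has no final state). -/
inductive Exec (W : ℝ) (I : Input n m) : Program → State → State → ℕ → Prop where
  | skip (s : State) : Exec W I .skip s s 1
  | assign {x : ℕ} {p : Expr} {s : State} (hp : p.Fits W I s) :
      Exec W I (.assign x p) s (s.setReg x (p.val I s)) (p.size + 1)
  | put {a : ℕ} {i p : Expr} {s : State} (hi : i.Fits W I s) (hp : p.Fits W I s) :
      Exec W I (.put a i p) s (s.setArr a (i.val I s) (p.val I s)) (i.size + p.size + 1)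
  | seq {c d : Program} {s s' s'' : State} {t t' : ℕ}
      (hc : Exec W I c s s' t) (hd : Exec W I d s' s'' t') :
      Exec W I (.seq c d) s s'' (t + t')
  | ite_true {b : Expr} {c d : Program} {s s' : State} {t : ℕ}
      (hb : b.Fits W I s) (h : b.val I s ≠ 0) (hc : Exec W I c s s' t) :
      Exec W I (.ite b c d) s s' (b.size + 1 + t)
  | ite_false {b : Expr} {c d : Program} {s s' : State} {t : ℕ}
      (hb : b.Fits W I s) (h : b.val I s = 0) (hd : Exec W I d s s' t) :
      Exec W I (.ite b c d) s s' (b.size + 1 + t)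
  | loop_true {b : Expr} {c : Program} {s s' s'' : State} {t t' : ℕ}
      (hb : b.Fits W I s) (h : b.val I s ≠ 0) (hc : Exec W I c s s' t)
      (hl : Exec W I (.loop b c) s' s'' t') :
      Exec W I (.loop b c) s s'' (b.size + 1 + t + t')
  | loop_false {b : Expr} {c : Program} {s : State}
      (hb : b.Fits W I s) (h : b.val I s = 0) :
      Exec W I (.loop b c) s s (b.size + 1)

/-! ## LBS cut algorithms -/

/-- In the final state `s` the program reports that there is no cut: register `0` holds `0`. -/
def ReportsNone (s : State) : Prop := s.reg 0 = 0

/-- In the final state `s` the program outputs the set `S`: register `0` holds `1`, and the nodes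
of `S` are the first entries of array `0`, as many as register `1` says. -/
def Outputs (s : State) (S : Finset (Fin n)) : Prop :=
  s.reg 0 = 1 ∧
    ∃ l : List (Fin n), l.Nodup ∧ l.toFinset = S ∧ s.reg 1 = l.length ∧
      ∀ (i : ℕ) (hi : i < l.length), s.arr 0 i = ((l[i] : Fin n) : ℕ)

/-- The answer in the final state `s` is correct for a `(csize, ccon)`-approximate LBS cut
algorithm: an LBS cut, or a correct report that no `(α / ccon)`-sparse `(A, σ)`-overlapping cut
exists. -/
def CorrectAnswer (csize ccon : ℝ) (I : Input n m) (s : State) : Prop :=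
  (∃ S, Outputs s S ∧ IsLBSCut csize ccon I.G I.α I.A I.σ S) ∨
    (ReportsNone s ∧ opt I.G (I.α / ccon) I.A I.σ = 0 ∧
      ¬ ∃ S, IsSparse I.G (I.α / ccon) S ∧ IsOverlapping I.G I.A I.σ S)

/-- Program `P` is a `(csize σ, ccon σ)`-approximate LBS cut algorithm on the class `𝒞` of inputs,
where every integer in a run on `I` has absolute value at most `word I`, with running time
`time I`. -/
def IsApproxLBSCutAlgorithm (P : Program) (csize ccon : ℝ → ℝ)
    (𝒞 : ∀ {n m : ℕ}, Input n m → Prop) (word time : ∀ {n m : ℕ}, Input n m → ℝ) : Prop :=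
  ∀ (n m : ℕ) (I : Input n m), 𝒞 I →
    ∃ (s : State) (t : ℕ), Exec (word I) I P State.zero s t ∧ (t : ℝ) ≤ time I ∧
      CorrectAnswer (csize I.σ) (ccon I.σ) I s

/-- The inputs with positive parameters, `2 vol(A) ≤ vol(V - A)` and
`2 vol(A) / vol(V - A) ≤ σ`. -/
def IsSpecial (I : Input n m) : Prop :=
  0 < I.α ∧ 0 < I.σ ∧ 2 * vol I.G I.A ≤ vol I.G I.Aᶜ ∧
    2 * (vol I.G I.A : ℝ) / vol I.G I.Aᶜ ≤ I.σ

end LBS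

/-! The algorithm is a local push-relabel flow of bounded height. Put `K` tokens on every incidence
of `A`, let every node absorb `Kp` tokens per incidence, give every edge capacity `U = K * b`, and
send the tokens one at a time; a token at a node of the top label `h = b * L + 1` is stuck. Here `K`
is of order `1/σ²`, `Kp` is about `K * σ - 1`, `b` is of order `1/α`, and `2 ^ L` exceeds the number
of tokens.

Few stuck tokens exclude large cuts. An overlapping cut `S` starts with at least `K * σ * vol S`
tokens, absorbs at most `(K * σ - 1) * vol S`, and, if it is `α/ccon`-sparse, exports at most `vol S
/ 2`. Hence `vol S` is at most twice the number of stuck tokens (`Good.vol_le_ex`); if none is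
stuck, there is no such cut.

Stuck tokens yield a cut. Edges that drop by two or more labels are saturated. If no level set `{v |
i ≤ lab v}` with `1 ≤ i ≤ h` had cut size at most `3/b` times its volume, many edges would drop by
exactly one label, so the volume of the levels would grow by the factor `1 + 1/b` per label going
down, and by more than the number of tokens in total (`Good.exists_level`). A level found this way
is `α`-sparse, has at most half of the volume because its nodes are saturated
(`Good.vol_level_le_compl`), and the number of stuck tokens is at most `4 * K` times its volume
(`Good.isLBSCut`). This compares its volume with OPT.

Time is local: cursor movement at a node is charged to the tokens absorbed there (`Good.work_le`),
and a push lowers the label of the token. Altogether `O(h * K * vol A)` steps suffice. Condition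
(ii) makes `1/σ` polynomial in the input size, so `L` is logarithmic (`Input.L_le`).

The remaining lemmas verify a concrete program by a weakest-precondition calculus that also tracks
time and word size; `Rep` links memory to the abstract snapshots `Cfg`, whose invariant is `Good`.
-/

namespace LBS

/-! ### Volumes and cut sizes as sums over edges -/

section Incidences

variable {n m : ℕ} (I : Input n m)

lemma Input.src_ne_tgt (e : Fin m) : I.src e ≠ I.tgt e := by
  have := I.loopless
  exact (I.isLink e).ne

lemma Input.mem_adj_iff {v : Fin n} {e : Fin m} : e ∈ I.adj v ↔ v = I.src e ∨ v = I.tgt e := by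
  rw [I.mem_adj]
  constructor
  · intro h
    exact h.eq_or_eq_of_isLink (I.isLink e)
  · rintro (rfl | rfl)
    · exact (I.isLink e).inc_left
    · exact (I.isLink e).inc_right

lemma Input.deg_eq (v : Fin n) : deg I.G v = (I.adj v).length := by
  have : {e | I.G.Inc e v} = ((I.adj v).toFinset : Set (Fin m)) := by
    ext e; simp [I.mem_adj]
  rw [deg, this, Set.ncard_coe_finset, List.toFinset_card_of_nodup (I.adj_nodup v)]

lemma Input.deg_le (v : Fin n) : deg I.G v ≤ m := by
  rw [I.deg_eq]
  simpa using (I.adj_nodup v).length_le_card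

lemma Input.vol_le (S : Finset (Fin n)) : vol I.G S ≤ n * m := by
  calc vol I.G S ≤ ∑ _v ∈ S, m := Finset.sum_le_sum fun v _ => I.deg_le v
    _ = S.card * m := by simp
    _ ≤ n * m := by gcongr; simpa using S.card_le_univ

lemma Input.vol_add_vol_compl (S : Finset (Fin n)) :
    vol I.G S + vol I.G Sᶜ = vol I.G Finset.univ :=
  Finset.sum_add_sum_compl S _

/-- The end of `e` that is not `v`. -/
def Input.other (v : Fin n) (e : Fin m) : Fin n := if I.src e = v then I.tgt e else I.src e

/-- Double counting: without loops, every edge lies in exactly the adjacency lists of its two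
distinct ends. Later inequalities between volumes and cut sizes can then be checked edge by edge. -/
lemma Input.sum_adj {M : Type*} [AddCommMonoid M] (S : Finset (Fin n)) (g : Fin n → Fin m → M) :
    ∑ v ∈ S, ((I.adj v).map (g v)).sum =
      ∑ e, ((if I.src e ∈ S then g (I.src e) e else 0) +
        (if I.tgt e ∈ S then g (I.tgt e) e else 0)) := by
  have h1 : ∀ v, ((I.adj v).map (g v)).sum =
      ∑ e, ((if I.src e = v then g (I.src e) e else 0) +
        (if I.tgt e = v then g (I.tgt e) e else 0)) := by
    intro v
    rw [← List.sum_toFinset _ (I.adj_nodup v), ← Finset.sum_subset (Finset.subset_univ _)]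
    · refine Finset.sum_congr rfl fun e he => ?_
      rw [List.mem_toFinset, I.mem_adj_iff] at he
      have := I.src_ne_tgt e
      rcases he with rfl | rfl
      · simp [this.symm]
      · simp [this]
    · intro e _ he
      rw [List.mem_toFinset, I.mem_adj_iff] at he
      push Not at he
      simp [he.1.symm, he.2.symm]
  simp_rw [h1]
  rw [Finset.sum_comm]
  refine Finset.sum_congr rfl fun e _ => ?_
  rw [Finset.sum_add_distrib, Finset.sum_ite_eq, Finset.sum_ite_eq]

lemma Input.vol_eq_sum (S : Finset (Fin n)) :
    vol I.G S = ∑ e, ((if I.src e ∈ S then 1 else 0) + (if I.tgt e ∈ S then 1 else 0)) := by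
  rw [← I.sum_adj S fun _ _ => 1]
  simp [vol, I.deg_eq]

lemma Input.cutSize_eq_sum (S : Finset (Fin n)) :
    cutSize I.G S = ∑ e, ((if I.src e ∈ S ∧ I.tgt e ∉ S then 1 else 0) +
      (if I.tgt e ∈ S ∧ I.src e ∉ S then 1 else 0)) := by
  have : {e | ∃ x ∈ S, ∃ y ∉ S, I.G.IsLink e x y} = ((Finset.univ.filter fun e =>
      (I.src e ∈ S ∧ I.tgt e ∉ S) ∨ (I.tgt e ∈ S ∧ I.src e ∉ S)) : Set (Fin m)) := by
    ext e
    simp only [Set.mem_ofPred_eq, Finset.coe_filter, Finset.mem_univ, true_and]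
    constructor
    · rintro ⟨x, hx, y, hy, h⟩
      rcases h.eq_and_eq_or_eq_and_eq (I.isLink e) with ⟨rfl, rfl⟩ | ⟨rfl, rfl⟩
      · exact Or.inl ⟨hx, hy⟩
      · exact Or.inr ⟨hx, hy⟩
    · rintro (⟨hx, hy⟩ | ⟨hx, hy⟩)
      · exact ⟨_, hx, _, hy, I.isLink e⟩
      · exact ⟨_, hx, _, hy, (I.isLink e).symm⟩
  rw [cutSize, this, Set.ncard_coe_finset, Finset.card_filter]
  refine Finset.sum_congr rfl fun e _ => ?_
  by_cases h1 : I.src e ∈ S <;> by_cases h2 : I.tgt e ∈ S <;> simp [h1, h2]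

/-- This is the form in which the program counts the cut: by walking through the adjacency lists of
the nodes of `S`. -/
lemma Input.cutSize_eq_sum_adj (S : Finset (Fin n)) :
    cutSize I.G S =
      ∑ v ∈ S, ((I.adj v).map fun e => if I.other v e ∈ S then 0 else 1).sum := by
  rw [I.sum_adj, I.cutSize_eq_sum]
  refine Finset.sum_congr rfl fun e _ => ?_
  have := I.src_ne_tgt e
  simp only [other, this, if_true, if_false]
  by_cases h1 : I.src e ∈ S <;> by_cases h2 : I.tgt e ∈ S <;> simp [h1, h2]

end Incidences

/-! ## Token flows of bounded height -/

/-- A snapshot of the push-relabel computation: labels, positions of the cursors in the adjacency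
lists, numbers of tokens absorbed at the current incidences, numbers of tokens stuck at the top
label, flows along the edges (from `src` to `tgt`), and the nodes of positive label. -/
structure Cfg (n m : ℕ) where
  lab : Fin n → ℕ
  pos : Fin n → ℕ
  cnt : Fin n → ℕ
  ex : Fin n → ℕ
  flow : Fin m → ℤ
  touched : List (Fin n)

/-- The snapshot at the start. -/
def Cfg.zero (n m : ℕ) : Cfg n m :=
  ⟨fun _ => 0, fun _ => 0, fun _ => 0, fun _ => 0, fun _ => 0, []⟩

section Flow

variable {n m : ℕ} (I : Input n m) (Kp h U : ℕ)

/-- The flow along `e` out of its end `v`. -/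
def along (f : Fin m → ℤ) (v : Fin n) (e : Fin m) : ℤ := if I.src e = v then f e else -f e

/-- The net flow out of `v`. -/
def netOut (f : Fin m → ℤ) (v : Fin n) : ℤ :=
  ∑ e, ((if I.src e = v then f e else 0) - (if I.tgt e = v then f e else 0))

/-- The number of tokens absorbed at `v`. -/
def absorbed (c : Cfg n m) (v : Fin n) : ℕ :=
  if c.lab v = 0 then Kp * c.pos v + c.cnt v else Kp * (I.adj v).length

/-- The invariant of the computation after `s v` tokens have been inserted at every node `v`, with
a token at the node `cur` if there is one. -/
structure Good (c : Cfg n m) (s : Fin n → ℕ) (cur : Option (Fin n)) : Prop where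
  lab_le : ∀ v, c.lab v ≤ h
  flow_ge : ∀ e, -(U : ℤ) ≤ c.flow e
  flow_le : ∀ e, c.flow e ≤ U
  valid : ∀ v, ∀ e ∈ I.adj v, along I c.flow v e < U → c.lab v ≤ c.lab (I.other v e) + 1
  passed : ∀ v, c.lab v ≠ 0 → ∀ e ∈ (I.adj v).take (c.pos v), along I c.flow v e < U →
    c.lab v ≤ c.lab (I.other v e)
  pos_le : ∀ v, c.pos v ≤ (I.adj v).length
  cnt_le : ∀ v, c.cnt v ≤ Kp
  cnt_end : ∀ v, c.lab v = 0 → c.pos v = (I.adj v).length → c.cnt v = 0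
  ex_lab : ∀ v, c.ex v ≠ 0 → c.lab v = h
  adj_lab : ∀ v, c.lab v ≠ 0 → I.adj v ≠ []
  adj_cur : ∀ v, cur = some v → I.adj v ≠ []
  conserve : ∀ v, (s v : ℤ) =
    netOut I c.flow v + absorbed I Kp c v + c.ex v + (if cur = some v then 1 else 0)
  touched_nodup : c.touched.Nodup
  mem_touched : ∀ v, v ∈ c.touched ↔ c.lab v ≠ 0

/-- The token at `v` gets stuck. -/
def Cfg.die (c : Cfg n m) (v : Fin n) : Cfg n m :=
  { c with ex := Function.update c.ex v (c.ex v + 1) }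

/-- The token at `v` is absorbed. -/
def Cfg.absorb (c : Cfg n m) (v : Fin n) : Cfg n m :=
  { c with cnt := Function.update c.cnt v (c.cnt v + 1) }

/-- The cursor of `v` advances at label zero. -/
def Cfg.fill (c : Cfg n m) (v : Fin n) : Cfg n m :=
  { c with cnt := Function.update c.cnt v 0, pos := Function.update c.pos v (c.pos v + 1) }

/-- The cursor of `v` advances. -/
def Cfg.advance (c : Cfg n m) (v : Fin n) : Cfg n m :=
  { c with pos := Function.update c.pos v (c.pos v + 1) }

/-- The token at `v` moves along `e`. -/
def Cfg.push (c : Cfg n m) (v : Fin n) (e : Fin m) : Cfg n m :=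
  { c with flow := Function.update c.flow e (c.flow e + if I.src e = v then 1 else -1) }

/-- The label of `v` increases. -/
def Cfg.relabel (c : Cfg n m) (v : Fin n) : Cfg n m :=
  { c with
    lab := Function.update c.lab v (c.lab v + 1)
    pos := Function.update c.pos v 0
    touched := if c.lab v = 0 then c.touched ++ [v] else c.touched }

variable {I Kp h U} {c : Cfg n m} {s : Fin n → ℕ}

lemma Good.zero : Good I Kp h U (Cfg.zero n m) (fun _ => 0) none := by
  constructor <;> simp [Cfg.zero, netOut, absorbed]

/-- Requiring an edge at `v` ensures that only nodes of positive degree are ever relabelled, which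
the bound on the work needs. -/
lemma Good.insert (hc : Good I Kp h U c s none) {v : Fin n} (hv : I.adj v ≠ []) :
    Good I Kp h U c (Function.update s v (s v + 1)) (some v) := by
  refine { hc with adj_cur := ?_, conserve := ?_ }
  · rintro _ ⟨⟩; exact hv
  · intro w
    have := hc.conserve w
    by_cases hw : w = v
    · subst hw; simp at this ⊢; omega
    · have hw' : ¬ v = w := fun h => hw h.symm
      simpa [Function.update_apply, hw, hw'] using this

lemma Good.die {v : Fin n} (hc : Good I Kp h U c s (some v)) (hv : c.lab v = h) :
    Good I Kp h U (c.die v) s none := by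
  refine { hc with adj_cur := by simp, ex_lab := ?_, conserve := ?_ }
  · intro w
    by_cases hw : w = v
    · subst hw; simp [Cfg.die, hv]
    · simpa [Cfg.die, Function.update_apply, hw] using hc.ex_lab w
  · intro w
    have := hc.conserve w
    by_cases hw : w = v
    · subst hw; simp_all [Cfg.die, absorbed]; ring
    · have hw' : ¬ v = w := fun h => hw h.symm
      simp_all only [Cfg.die, absorbed, Option.some.injEq, if_false, reduceCtorEq]
      simp only [Function.update_of_ne hw, add_zero]
      rfl

lemma Good.absorb {v : Fin n} (hc : Good I Kp h U c s (some v)) (hv : c.lab v = 0)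
    (hp : c.pos v < (I.adj v).length) (hk : c.cnt v + 1 ≤ Kp) :
    Good I Kp h U (c.absorb v) s none := by
  refine { hc with adj_cur := by simp, cnt_le := ?_, cnt_end := ?_, conserve := ?_ }
  · intro w
    by_cases hw : w = v
    · subst hw; simpa [Cfg.absorb] using hk
    · simpa [Cfg.absorb, Function.update_apply, hw] using hc.cnt_le w
  · intro w
    by_cases hw : w = v
    · subst hw; simp [Cfg.absorb]; omega
    · simpa [Cfg.absorb, Function.update_apply, hw] using hc.cnt_end w
  · intro w
    have := hc.conserve w
    by_cases hw : w = v
    · subst hw; simp_all [Cfg.absorb, absorbed]; ring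
    · have hw' : ¬ v = w := fun h => hw h.symm
      simp_all [Cfg.absorb, absorbed]

lemma Good.fill {v : Fin n} (hc : Good I Kp h U c s (some v)) (hv : c.lab v = 0)
    (hp : c.pos v < (I.adj v).length) (hk : ¬ c.cnt v + 1 ≤ Kp) :
    Good I Kp h U (c.fill v) s (some v) := by
  -- A full incidence at the cursor counts the same as an empty one at the next position, so
  -- `absorbed` does not change.
  have hk' : c.cnt v = Kp := le_antisymm (hc.cnt_le v) (by omega)
  refine { hc with cnt_le := ?_, cnt_end := ?_, conserve := ?_, pos_le := ?_, passed := ?_ }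
  · intro w hw
    have hwv : w ≠ v := by rintro rfl; exact hw hv
    simpa [Cfg.fill, Function.update_apply, hwv] using hc.passed w hw
  · intro w
    by_cases hw : w = v
    · subst hw; simp [Cfg.fill]; omega
    · simpa [Cfg.fill, Function.update_apply, hw] using hc.pos_le w
  · intro w
    by_cases hw : w = v
    · subst hw; simp [Cfg.fill]
    · simpa [Cfg.fill, Function.update_apply, hw] using hc.cnt_le w
  · intro w
    by_cases hw : w = v
    · subst hw; simp [Cfg.fill]
    · simpa [Cfg.fill, Function.update_apply, hw] using hc.cnt_end w
  · intro w
    have := hc.conserve w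
    by_cases hw : w = v
    · subst hw; simp_all [Cfg.fill, absorbed]; ring
    · have hw' : ¬ v = w := fun h => hw h.symm
      simp_all [Cfg.fill, absorbed]

lemma Good.advance {v : Fin n} (hc : Good I Kp h U c s (some v)) (hv : c.lab v ≠ 0)
    (hp : c.pos v < (I.adj v).length)
    (ha : along I c.flow v (I.adj v)[c.pos v] < U →
      c.lab v ≤ c.lab (I.other v (I.adj v)[c.pos v])) :
    Good I Kp h U (c.advance v) s (some v) := by
  refine { hc with cnt_end := ?_, conserve := ?_, pos_le := ?_, passed := ?_ }
  · intro w hw e he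
    by_cases hwv : w = v
    · subst hwv
      simp only [Cfg.advance, Function.update_self, List.take_add_one, List.mem_append] at he
      rcases he with he | he
      · exact hc.passed w hw e he
      · simp only [List.getElem?_eq_getElem hp, Option.toList_some, List.mem_singleton] at he
        subst he
        exact ha
    · simp only [Cfg.advance, Function.update_of_ne hwv] at he
      exact hc.passed w hw e he
  · intro w
    by_cases hw : w = v
    · subst hw; simp [Cfg.advance]; omega
    · simpa [Cfg.advance, Function.update_apply, hw] using hc.pos_le w
  · intro w hw
    have hwv : w ≠ v := by rintro rfl; exact hv hw
    simpa [Cfg.advance, Function.update_apply, hwv] using hc.cnt_end w hw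
  · intro w
    have := hc.conserve w
    by_cases hw : w = v
    · subst hw; simp_all [Cfg.advance, absorbed]
    · have hw' : ¬ v = w := fun h => hw h.symm
      simp_all [Cfg.advance, absorbed]

/-- With the cursor at the end of a list at positive label, `passed` covers all incident edges:
residual ones lead to labels at least `lab v`, so one more unit is allowed. The two formulas for
`absorbed` agree when label `0` is left, since `cnt_end` gives count `0` at the end of the list. -/
lemma Good.relabel {v : Fin n} (hc : Good I Kp h U c s (some v)) (hv : c.lab v < h)
    (hp : c.pos v = (I.adj v).length) :
    Good I Kp h U (c.relabel v) s (some v) := by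
  have hmono : ∀ w, c.lab w ≤ (c.relabel v).lab w := by
    intro w
    by_cases hw : w = v
    · subst hw; simp [Cfg.relabel]
    · simp [Cfg.relabel, hw]
  have hne : ∀ w, w ≠ v → (c.relabel v).lab w = c.lab w := by
    intro w hw; simp [Cfg.relabel, hw]
  have hsame : (c.relabel v).lab v = c.lab v + 1 := by simp [Cfg.relabel]
  refine { hc with lab_le := ?_, valid := ?_, passed := ?_, pos_le := ?_, cnt_end := ?_,
                   ex_lab := ?_, adj_lab := ?_, conserve := ?_, touched_nodup := ?_,
                   mem_touched := ?_ }
  · intro w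
    by_cases hw : w = v
    · subst hw; omega
    · rw [hne w hw]; exact hc.lab_le w
  · intro w e he hf
    by_cases hw : w = v
    · subst hw
      have h1 := hmono (I.other w e)
      rw [hsame]
      -- From label `0` the new label is `1`, which validity always permits; `passed` says nothing
      -- there.
      by_cases h0 : c.lab w = 0
      · omega
      · have := hc.passed w h0 e (by rw [hp, List.take_length]; exact he) hf
        omega
    · rw [hne w hw]
      exact (hc.valid w e he hf).trans (by gcongr; exact hmono _)
  · intro w hw e he hf
    by_cases hwv : w = v
    · subst hwv; simp [Cfg.relabel] at he
    · rw [hne w hwv] at hw ⊢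
      simp only [Cfg.relabel, Function.update_of_ne hwv] at he
      exact (hc.passed w hw e he hf).trans (hmono _)
  · intro w
    by_cases hw : w = v
    · subst hw; simp [Cfg.relabel]
    · simpa [Cfg.relabel, Function.update_apply, hw] using hc.pos_le w
  · intro w hw
    have hwv : w ≠ v := by rintro rfl; omega
    rw [hne w hwv] at hw
    simpa [Cfg.relabel, Function.update_apply, hwv] using hc.cnt_end w hw
  · intro w hw
    have hwv : w ≠ v := by
      rintro rfl
      have := hc.ex_lab w hw
      omega
    rw [hne w hwv]; exact hc.ex_lab w hw
  · intro w hw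
    by_cases hwv : w = v
    · exact hwv ▸ hc.adj_cur v rfl
    · rw [hne w hwv] at hw; exact hc.adj_lab w hw
  · intro w
    have := hc.conserve w
    have h2 := hc.cnt_end w
    by_cases hw : w = v
    · subst hw
      by_cases h0 : c.lab w = 0
      · simp_all [Cfg.relabel, absorbed]
      · simp_all [Cfg.relabel, absorbed]
    · have hw' : ¬ v = w := fun h => hw h.symm
      simp_all [Cfg.relabel, absorbed, Function.update_apply]
  · simp only [Cfg.relabel]
    split_ifs with h0
    · refine List.Nodup.append hc.touched_nodup (List.nodup_singleton v) ?_
      simp [hc.mem_touched, h0]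
    · exact hc.touched_nodup
  · intro w
    simp only [Cfg.relabel]
    by_cases hw : w = v
    · subst hw
      split_ifs with h0 <;> simp [hc.mem_touched, h0]
    · split_ifs with h0 <;> simp [hc.mem_touched, hw]

/-- A push can create only one residual arc, the reverse one. It starts at the end of strictly
smaller label, so neither `valid` nor `passed` can fail for it. -/
lemma Good.push {v : Fin n} (hc : Good I Kp h U c s (some v)) {e : Fin m} (he : e ∈ I.adj v)
    (ha : along I c.flow v e < U) (hl : c.lab (I.other v e) + 1 ≤ c.lab v) :
    Good I Kp h U (c.push I v e) s (some (I.other v e)) := by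
  have hst := I.src_ne_tgt e
  rw [I.mem_adj_iff] at he
  have key : ∀ w e', e' ∈ I.adj w → along I (c.push I v e).flow w e' < U →
      along I c.flow w e' < U ∨ (w = I.other v e ∧ I.other w e' = v) := by
    intro w e' he' hf
    by_cases hee : e' = e
    · subst hee
      rw [I.mem_adj_iff] at he'
      rcases he with rfl | rfl <;> rcases he' with rfl | rfl
      · left; exact ha
      · right; simp [Input.other, hst]
      · right; simp [Input.other, hst]
      · left; exact ha
    · left
      simpa [along, Cfg.push, Function.update_apply, hee] using hf
  refine { hc with flow_ge := ?_, flow_le := ?_, valid := ?_, passed := ?_, adj_cur := ?_,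
                   conserve := ?_ }
  · intro e'
    have h1 := hc.flow_ge e'
    by_cases hee : e' = e
    · subst hee
      simp only [along] at ha
      simp only [Cfg.push, Function.update_self]
      split_ifs at ha ⊢ <;> omega
    · simpa [Cfg.push, Function.update_apply, hee] using h1
  · intro e'
    have h1 := hc.flow_le e'
    by_cases hee : e' = e
    · subst hee
      simp only [along] at ha
      simp only [Cfg.push, Function.update_self]
      split_ifs at ha ⊢ <;> omega
    · simpa [Cfg.push, Function.update_apply, hee] using h1
  · intro w e' he' hf
    rcases key w e' he' hf with h1 | ⟨h1, h2⟩
    · exact hc.valid w e' he' h1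
    · rw [h2, h1]; simp only [Cfg.push]; omega
  · intro w hw e' he' hf
    rcases key w e' (List.mem_of_mem_take he') hf with h1 | ⟨h1, h2⟩
    · exact hc.passed w hw e' he' h1
    · rw [h2, h1]; simp only [Cfg.push]; omega
  · rintro w hw
    obtain rfl : I.other v e = w := by simpa using hw
    refine List.ne_nil_of_mem (a := e) ?_
    rw [I.mem_adj_iff, Input.other]
    split_ifs <;> simp
  · intro w
    have h1 := hc.conserve w
    have h2 : netOut I (c.push I v e).flow w = netOut I c.flow w +
        ((if v = w then 1 else 0) - (if I.other v e = w then 1 else 0)) := by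
      simp only [netOut]
      rw [← Finset.add_sum_erase _ _ (Finset.mem_univ e),
        ← Finset.add_sum_erase (a := e) Finset.univ
          (fun e => (if I.src e = w then c.flow e else 0) - (if I.tgt e = w then c.flow e else 0))
          (Finset.mem_univ e)]
      have h3 : ∑ x ∈ Finset.univ.erase e, ((if I.src x = w then (c.push I v e).flow x else 0) -
          (if I.tgt x = w then (c.push I v e).flow x else 0)) =
          ∑ x ∈ Finset.univ.erase e, ((if I.src x = w then c.flow x else 0) -
          (if I.tgt x = w then c.flow x else 0)) := by
        refine Finset.sum_congr rfl fun x hx => ?_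
        have hxe : x ≠ e := Finset.ne_of_mem_erase hx
        simp [Cfg.push, hxe]
      rw [h3]
      simp only [Cfg.push, Function.update_self, Input.other]
      rcases he with rfl | rfl
      · simp only [if_true]
        split_ifs <;> ring
      · simp only [hst, if_false]
        split_ifs <;> ring
    have h3 : absorbed I Kp (c.push I v e) w = absorbed I Kp c w := rfl
    rw [h2, h3]
    simp only [Option.some.injEq] at h1 ⊢
    rw [h1]
    simp only [Cfg.push]
    ring

end Flow
end LBS

namespace LBS

/-! ### Cut inequalities, sparse levels, and the amount of work -/

section Flow

variable {n m : ℕ} {I : Input n m} {Kp h U : ℕ} {c : Cfg n m} {s : Fin n → ℕ}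
  {cur : Option (Fin n)}

/-- Edges inside `S` cancel in this form, so conservation summed over `S` only sees the boundary. -/
lemma sum_netOut (f : Fin m → ℤ) (S : Finset (Fin n)) : ∑ v ∈ S, netOut I f v =
    ∑ e, ((if I.src e ∈ S then f e else 0) - (if I.tgt e ∈ S then f e else 0)) := by
  simp only [netOut]
  rw [Finset.sum_comm]
  refine Finset.sum_congr rfl fun e _ => ?_
  rw [Finset.sum_sub_distrib, Finset.sum_ite_eq, Finset.sum_ite_eq]

lemma Good.sum_netOut_le (hc : Good I Kp h U c s cur) (S : Finset (Fin n)) :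
    ∑ v ∈ S, netOut I c.flow v ≤ U * cutSize I.G S := by
  rw [sum_netOut, I.cutSize_eq_sum]
  push_cast
  rw [Finset.mul_sum]
  refine Finset.sum_le_sum fun e _ => ?_
  have h1 := hc.flow_ge e
  have h2 := hc.flow_le e
  by_cases hs : I.src e ∈ S <;> by_cases ht : I.tgt e ∈ S <;> simp [hs, ht] <;> omega

lemma Good.le_sum_netOut (hc : Good I Kp h U c s cur) (S : Finset (Fin n)) :
    -(U * cutSize I.G S : ℤ) ≤ ∑ v ∈ S, netOut I c.flow v := by
  rw [sum_netOut, I.cutSize_eq_sum, neg_le_iff_add_nonneg]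
  push_cast
  rw [Finset.mul_sum, ← Finset.sum_add_distrib]
  refine Finset.sum_nonneg fun e _ => ?_
  have h1 := hc.flow_ge e
  have h2 := hc.flow_le e
  by_cases hs : I.src e ∈ S <;> by_cases ht : I.tgt e ∈ S <;> simp [hs, ht] <;> omega

lemma Good.sum_conserve (hc : Good I Kp h U c s none) (S : Finset (Fin n)) :
    ((∑ v ∈ S, s v : ℕ) : ℤ) = ∑ v ∈ S, netOut I c.flow v +
      (∑ v ∈ S, absorbed I Kp c v : ℕ) + (∑ v ∈ S, c.ex v : ℕ) := by
  push_cast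
  rw [← Finset.sum_add_distrib, ← Finset.sum_add_distrib]
  refine Finset.sum_congr rfl fun v _ => ?_
  simpa using hc.conserve v

lemma Good.absorbed_le (hc : Good I Kp h U c s cur) (v : Fin n) :
    absorbed I Kp c v ≤ Kp * deg I.G v := by
  rw [absorbed, I.deg_eq]
  split_ifs with h0
  · have h1 := hc.pos_le v
    -- At the end of the list no incidence is left to hold a partial count; there `cnt_end` is
    -- essential.
    rcases h1.eq_or_lt with h2 | h2
    · rw [hc.cnt_end v h0 h2, h2]; simp
    · calc Kp * c.pos v + c.cnt v ≤ Kp * c.pos v + Kp := by gcongr; exact hc.cnt_le v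
        _ = Kp * (c.pos v + 1) := by ring
        _ ≤ _ := by gcongr; omega
  · exact le_rfl

/-- Every cut that leaves behind many tokens has many stuck tokens or large cut size. -/
lemma Good.sum_source_le (hc : Good I Kp h U c s none) (S : Finset (Fin n)) :
    ∑ v ∈ S, s v ≤ Kp * vol I.G S + U * cutSize I.G S + ∑ v, c.ex v := by
  have h1 := hc.sum_conserve S
  have h2 := hc.sum_netOut_le S
  have h3 : ∑ v ∈ S, absorbed I Kp c v ≤ Kp * vol I.G S := by
    rw [vol, Finset.mul_sum]
    exact Finset.sum_le_sum fun v _ => hc.absorbed_le v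
  have h4 : ∑ v ∈ S, c.ex v ≤ ∑ v, c.ex v :=
    Finset.sum_le_sum_of_subset (Finset.subset_univ S)
  zify at h3 h4 h1 ⊢
  linarith

/-- The nodes of label at least `i`. -/
def Cfg.level (c : Cfg n m) (i : ℕ) : Finset (Fin n) := Finset.univ.filter fun v => i ≤ c.lab v

lemma Cfg.mem_level {i : ℕ} {v : Fin n} : v ∈ c.level i ↔ i ≤ c.lab v := by simp [Cfg.level]

/-- A node leaves label `0` only when all its incidences are full, so positive levels are saturated.
-/
lemma Good.absorbed_level (I : Input n m) (c : Cfg n m) {i : ℕ} (hi : 1 ≤ i) :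
    ∑ v ∈ c.level i, absorbed I Kp c v = Kp * vol I.G (c.level i) := by
  rw [vol, Finset.mul_sum]
  refine Finset.sum_congr rfl fun v hv => ?_
  rw [Cfg.mem_level] at hv
  rw [absorbed, if_neg (by omega), I.deg_eq]

lemma Good.ex_level (hc : Good I Kp h U c s cur) {i : ℕ} (hi : i ≤ h) :
    ∑ v ∈ c.level i, c.ex v = ∑ v, c.ex v := by
  refine Finset.sum_subset (Finset.subset_univ _) fun v _ hv => ?_
  by_contra h0
  exact hv (Cfg.mem_level.2 (hi.trans (hc.ex_lab v h0).ge))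

/-- All stuck tokens sit at label `h`, hence inside the level, and they started there or entered
through its boundary. For a sparse level this bounds their number by its volume. -/
lemma Good.vol_level_add_ex_le (hc : Good I Kp h U c s none) {i : ℕ} (hi : 1 ≤ i) (hih : i ≤ h) :
    Kp * vol I.G (c.level i) + ∑ v, c.ex v ≤
      ∑ v ∈ c.level i, s v + U * cutSize I.G (c.level i) := by
  have h1 := hc.sum_conserve (c.level i)
  have h2 := hc.le_sum_netOut (c.level i)
  rw [absorbed_level I c hi, hc.ex_level hih] at h1
  zify at h1 ⊢
  linarith

lemma Good.sum_netOut_univ (I : Input n m) (f : Fin m → ℤ) : ∑ v, netOut I f v = 0 := by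
  rw [sum_netOut]; simp

/-- Saturation pays for volume with tokens. This is the source of locality: the touched part of the
graph is no larger than the number of tokens. -/
lemma Good.vol_level_le (hc : Good I Kp h U c s none) {i : ℕ} (hi : 1 ≤ i) :
    Kp * vol I.G (c.level i) ≤ ∑ v, s v := by
  have h1 := hc.sum_conserve Finset.univ
  rw [sum_netOut_univ] at h1
  have h2 : ∑ v ∈ c.level i, absorbed I Kp c v ≤ ∑ v, absorbed I Kp c v :=
    Finset.sum_le_sum_of_subset (Finset.subset_univ _)
  rw [absorbed_level I c hi] at h2
  zify at h1 h2 ⊢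
  have h3 : (0 : ℤ) ≤ ∑ v, (c.ex v : ℤ) := Finset.sum_nonneg fun _ _ => by positivity
  linarith

variable (I) in
/-- The number of edges from label `i` to label `i - 1`. -/
def stepCount (c : Cfg n m) (i : ℕ) : ℕ :=
  ∑ e, ((if c.lab (I.src e) = i ∧ c.lab (I.tgt e) + 1 = i then 1 else 0) +
    (if c.lab (I.tgt e) = i ∧ c.lab (I.src e) + 1 = i then 1 else 0))

/-- Each boundary edge carries `U` out of the level, unless it joins label `i` to label `i - 1`.
Such an edge may carry up to `U` inwards, an error of at most `2 * U`. -/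
lemma Good.vol_level_add_cut_le (hc : Good I Kp h U c s none) {i : ℕ} (hi : 1 ≤ i) :
    Kp * vol I.G (c.level i) + U * cutSize I.G (c.level i) ≤
      ∑ v ∈ c.level i, s v + 2 * U * stepCount I c i := by
  have h1 := hc.sum_conserve (c.level i)
  rw [absorbed_level I c hi] at h1
  have h2 : (U * cutSize I.G (c.level i) : ℤ) ≤
      ∑ v ∈ c.level i, netOut I c.flow v + 2 * U * stepCount I c i := by
    rw [sum_netOut, I.cutSize_eq_sum, stepCount]
    push_cast
    rw [Finset.mul_sum, Finset.mul_sum, ← Finset.sum_add_distrib]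
    refine Finset.sum_le_sum fun e _ => ?_
    have hst := I.src_ne_tgt e
    have h1 := hc.flow_ge e
    have h2 := hc.flow_le e
    have h3 := hc.valid (I.src e) e (I.mem_adj_iff.2 (Or.inl rfl))
    have h4 := hc.valid (I.tgt e) e (I.mem_adj_iff.2 (Or.inr rfl))
    simp only [along, Input.other, hst, if_true, if_false] at h3 h4
    simp only [Cfg.mem_level]
    by_cases hs : i ≤ c.lab (I.src e) <;> by_cases ht : i ≤ c.lab (I.tgt e)
    · have : ¬ c.lab (I.src e) + 1 = i := by omega
      have : ¬ c.lab (I.tgt e) + 1 = i := by omega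
      simp [*]
    · by_cases hi : c.lab (I.src e) = i ∧ c.lab (I.tgt e) + 1 = i
      · simp only [hi]; simp; split_ifs <;> omega
      -- A drop of two or more labels along a residual arc would contradict `valid`.
      · have : c.flow e = U := by
          by_contra h5
          have := h3 (by omega)
          omega
        simp only [hi, hs, ht]; simp; split_ifs <;> omega
    · by_cases hi : c.lab (I.tgt e) = i ∧ c.lab (I.src e) + 1 = i
      · simp only [hi]; simp; split_ifs <;> omega
      · have : -c.flow e = U := by
          by_contra h5
          have := h4 (by omega)
          omega
        simp only [hi, hs, ht]; simp; split_ifs <;> omega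
    · have : ¬ c.lab (I.src e) = i := by omega
      have : ¬ c.lab (I.tgt e) = i := by omega
      simp [*]
  have h3 : (0 : ℤ) ≤ ∑ v ∈ c.level i, (c.ex v : ℤ) :=
    Finset.sum_nonneg fun _ _ => by positivity
  zify at h1 ⊢
  linarith

/-- The lower end of an edge from label `i + 1` to label `i` is an incidence of the larger level
that the smaller level lacks. -/
lemma vol_level_add_stepCount_le (I : Input n m) (c : Cfg n m) (i : ℕ) :
    vol I.G (c.level (i + 1)) + stepCount I c (i + 1) ≤ vol I.G (c.level i) := by
  rw [I.vol_eq_sum, I.vol_eq_sum, stepCount, ← Finset.sum_add_distrib]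
  refine Finset.sum_le_sum fun e _ => ?_
  simp only [Cfg.mem_level]
  split_ifs <;> omega

/-- This is `(1 + 1/b) ^ b ≥ 2`, raised to the power `L`. The inner claim is Bernoulli's inequality
without denominators, used for `k = b`. -/
lemma two_pow_mul_le (b L : ℕ) (hb : 1 ≤ b) : 2 ^ L * b ^ (b * L) ≤ (b + 1) ^ (b * L) := by
  rw [pow_mul, pow_mul, ← mul_pow]
  gcongr
  have key : ∀ k, (b + k) * b ^ k ≤ b * (b + 1) ^ k := by
    intro k
    induction k with
    | zero => simp
    | succ k ih =>
      calc (b + (k + 1)) * b ^ (k + 1) = (b * (b + k + 1)) * b ^ k := by ring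
        _ ≤ ((b + 1) * (b + k)) * b ^ k := Nat.mul_le_mul_right _ (by nlinarith)
        _ = (b + 1) * ((b + k) * b ^ k) := by ring
        _ ≤ (b + 1) * (b * (b + 1) ^ k) := by gcongr
        _ = _ := by ring
  refine Nat.le_of_mul_le_mul_left ?_ hb
  calc b * (2 * b ^ b) = (b + b) * b ^ b := by ring
    _ ≤ _ := key b

/-- If some tokens are stuck and the labels go up high enough, then some level is a sparse cut. -/
lemma Good.exists_level {A : Finset (Fin n)} {K b L : ℕ}
    (hc : Good I Kp (b * L + 1) (K * b) c s none)
    (hs : ∀ v, s v = if v ∈ A then K * deg I.G v else 0) (hK : 1 ≤ K) (hKp : 1 ≤ Kp) (hb : 1 ≤ b)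
    (hL : K * vol I.G A < 2 ^ L) (hex : 1 ≤ vol I.G (c.level (b * L + 1))) :
    ∃ i, 1 ≤ i ∧ i ≤ b * L + 1 ∧ b * cutSize I.G (c.level i) ≤ 3 * vol I.G (c.level i) := by
  by_contra! hno
  have hsum : ∀ S : Finset (Fin n), ∑ v ∈ S, s v ≤ K * vol I.G S := by
    intro S
    rw [vol, Finset.mul_sum]
    refine Finset.sum_le_sum fun v _ => ?_
    rw [hs]; split_ifs <;> simp
  -- If level `i + 2` violates the bound, `b * cut > 3 * vol`, while the flow gives `b * cut ≤ vol +
  -- 2 * b * step`. So `b * step > vol`, and the step edges enlarge the next lower level by more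
  -- than the fraction `1/b`.
  have hstep : ∀ i, i + 1 ≤ b * L → (b + 1) * vol I.G (c.level (i + 2)) ≤
      b * vol I.G (c.level (i + 1)) := by
    intro i hi
    have h1 := hno (i + 2) (by omega) (by omega)
    have h2 := hc.vol_level_add_cut_le (i := i + 2) (by omega)
    have h3 := vol_level_add_stepCount_le I c (i + 1)
    have h4 := hsum (c.level (i + 2))
    have h5 : b * cutSize I.G (c.level (i + 2)) ≤
        vol I.G (c.level (i + 2)) + 2 * (b * stepCount I c (i + 2)) := by
      refine Nat.le_of_mul_le_mul_left ?_ hK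
      nlinarith
    nlinarith
  have hind : ∀ j, j ≤ b * L → (b + 1) ^ j * vol I.G (c.level (b * L + 1)) ≤
      b ^ j * vol I.G (c.level (b * L + 1 - j)) := by
    intro j
    induction j with
    | zero => simp
    | succ j ih =>
      intro hj
      have h1 := ih (by omega)
      have h2 := hstep (b * L - j - 1) (by omega)
      rw [show b * L - j - 1 + 2 = b * L + 1 - j by omega,
        show b * L - j - 1 + 1 = b * L + 1 - (j + 1) by omega] at h2
      calc (b + 1) ^ (j + 1) * vol I.G (c.level (b * L + 1))
          = (b + 1) * ((b + 1) ^ j * vol I.G (c.level (b * L + 1))) := by ring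
        _ ≤ (b + 1) * (b ^ j * vol I.G (c.level (b * L + 1 - j))) := by gcongr
        _ = b ^ j * ((b + 1) * vol I.G (c.level (b * L + 1 - j))) := by ring
        _ ≤ b ^ j * (b * vol I.G (c.level (b * L + 1 - (j + 1)))) := by gcongr
        _ = _ := by ring
  have h1 := hind (b * L) le_rfl
  rw [show b * L + 1 - b * L = 1 by omega] at h1
  have h2 := hc.vol_level_le (i := 1) le_rfl
  have h3 : ∑ v, s v = K * vol I.G A := by
    simp only [hs, vol, Finset.mul_sum, Finset.sum_ite_mem, Finset.univ_inter]
  have h4 := two_pow_mul_le b L hb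
  have h5 : 0 < b ^ (b * L) := by positivity
  -- From the top level to level `1` there are exactly `b * L` steps, and the top level has volume
  -- at least `1`. The outcome exceeds the number of tokens, against `vol_level_le`.
  have h6 : 2 ^ L ≤ vol I.G (c.level 1) := by
    refine Nat.le_of_mul_le_mul_left ?_ h5
    calc b ^ (b * L) * 2 ^ L = 2 ^ L * b ^ (b * L) := by ring
      _ ≤ (b + 1) ^ (b * L) * 1 := by simpa using h4
      _ ≤ (b + 1) ^ (b * L) * vol I.G (c.level (b * L + 1)) := by gcongr
      _ ≤ _ := h1
  nlinarith

/-- At an isolated node there is neither a source nor flow, so conservation leaves nothing to be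
stuck. This makes the volume of the top level positive. -/
lemma Good.deg_pos_of_ex {K : ℕ} (hc : Good I Kp h U c s none) (hs : ∀ v, s v ≤ K * deg I.G v)
    {v : Fin n} (hv : c.ex v ≠ 0) : 1 ≤ deg I.G v := by
  by_contra h0
  have h0 : deg I.G v = 0 := by omega
  have h1 : netOut I c.flow v = 0 := by
    have hnil : I.adj v = [] := List.length_eq_zero_iff.1 (by rw [← I.deg_eq, h0])
    refine Finset.sum_eq_zero fun e _ => ?_
    have h2 : ¬ (v = I.src e ∨ v = I.tgt e) := by rw [← I.mem_adj_iff, hnil]; simp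
    push Not at h2
    rw [if_neg h2.1.symm, if_neg h2.2.symm, sub_zero]
  have h2 := hs v
  have h3 := hc.conserve v
  rw [h1] at h3
  rw [h0] at h2
  simp only [reduceCtorEq, if_false] at h3
  omega

/-- The progress of the cursor of `v`. -/
def Cfg.prog (I : Input n m) (c : Cfg n m) (v : Fin n) : ℕ :=
  c.lab v * ((I.adj v).length + 1) + c.pos v

/-- The total progress of all cursors. -/
def Cfg.work (I : Input n m) (c : Cfg n m) : ℕ := ∑ v, c.prog I v

/-- The cursor crosses an incidence at label `0` only after it has taken `Kp ≥ 1` tokens, and then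
at most once per later label. A relabelled node has degree `d ≥ 1`, so `d + 1 ≤ 2 * d` pays for the
relabelling itself. -/
lemma Good.prog_le (hc : Good I Kp h U c s cur) (hKp : 1 ≤ Kp) (v : Fin n) :
    c.prog I v ≤ (2 * h + 1) * absorbed I Kp c v := by
  rw [Cfg.prog, absorbed]
  have h1 := hc.pos_le v
  split_ifs with h0
  · rw [h0]
    nlinarith [Nat.zero_le (c.cnt v), Nat.zero_le (h * (Kp * c.pos v + c.cnt v)),
      Nat.mul_le_mul_right (c.pos v) hKp]
  · have h2 : 1 ≤ (I.adj v).length := List.length_pos_iff.2 (hc.adj_lab v h0)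
    calc _ ≤ h * (2 * (I.adj v).length) + (I.adj v).length := by
            gcongr
            · exact hc.lab_le v
            · omega
      _ = (2 * h + 1) * (1 * (I.adj v).length) := by ring
      _ ≤ _ := by gcongr

lemma Good.work_le (hc : Good I Kp h U c s cur) (hKp : 1 ≤ Kp) :
    c.work I ≤ (2 * h + 1) * ∑ v, s v := by
  have h1 : ((∑ v, s v : ℕ) : ℤ) = ∑ v, netOut I c.flow v + (∑ v, absorbed I Kp c v : ℕ) +
      (∑ v, c.ex v : ℕ) + ∑ v, if cur = some v then 1 else 0 := by
    push_cast
    rw [← Finset.sum_add_distrib, ← Finset.sum_add_distrib, ← Finset.sum_add_distrib]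
    exact Finset.sum_congr rfl fun v _ => hc.conserve v
  rw [sum_netOut_univ] at h1
  have h2 : (0 : ℤ) ≤ ∑ v : Fin n, if cur = some v then 1 else 0 :=
    Finset.sum_nonneg fun v _ => by split_ifs <;> simp
  have h3 : ∑ v, absorbed I Kp c v ≤ ∑ v, s v := by
    zify at h1 ⊢
    have : (0 : ℤ) ≤ ∑ v, (c.ex v : ℤ) := Finset.sum_nonneg fun _ _ => by positivity
    linarith
  calc c.work I ≤ ∑ v, (2 * h + 1) * absorbed I Kp c v :=
        Finset.sum_le_sum fun v _ => hc.prog_le hKp v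
    _ = (2 * h + 1) * ∑ v, absorbed I Kp c v := by rw [Finset.mul_sum]
    _ ≤ _ := by gcongr

lemma Cfg.work_eq_add_one {c c' : Cfg n m} {v : Fin n} (h1 : c'.prog I v = c.prog I v + 1)
    (h2 : ∀ w, w ≠ v → c'.prog I w = c.prog I w) : c'.work I = c.work I + 1 := by
  rw [work, work, ← Finset.add_sum_erase _ _ (Finset.mem_univ v),
    ← Finset.add_sum_erase _ _ (Finset.mem_univ v), h1,
    Finset.sum_congr rfl fun w hw => h2 w (Finset.ne_of_mem_erase hw)]
  ring

lemma Cfg.work_fill (c : Cfg n m) (v : Fin n) : (c.fill v).work I = c.work I + 1 :=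
  work_eq_add_one (v := v) (by simp [prog, fill]; ring) fun w hw => by simp [prog, fill, hw]

lemma Cfg.work_advance (c : Cfg n m) (v : Fin n) : (c.advance v).work I = c.work I + 1 :=
  work_eq_add_one (v := v) (by simp [prog, advance]; ring) fun w hw => by simp [prog, advance, hw]

/-- The weight `deg + 1` of a label in `prog` is chosen so that going from the last cursor position
to the first one of the next label counts as one unit. -/
lemma Cfg.work_relabel {c : Cfg n m} {v : Fin n} (hv : c.pos v = (I.adj v).length) :
    (c.relabel v).work I = c.work I + 1 :=
  work_eq_add_one (v := v) (by simp [prog, relabel, hv]; ring)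
    fun w hw => by simp [prog, relabel, hw]

end Flow
end LBS

namespace LBS

/-! ## Verification of programs -/

section Verification

variable {n m : ℕ}

/-- A sufficient condition for all values that occur in the evaluation of an expression to lie
between `-Z` and `Z`. -/
def Expr.FitsInt (Z : ℤ) (I : Input n m) (s : State) : Expr → Prop
  | const k => -Z ≤ k ∧ k ≤ Z
  | var x => -Z ≤ s.reg x ∧ s.reg x ≤ Z
  | get a i => i.FitsInt Z I s ∧ -Z ≤ s.arr a (i.val I s) ∧ s.arr a (i.val I s) ≤ Z
  | add p q => p.FitsInt Z I s ∧ q.FitsInt Z I s ∧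
      -Z ≤ p.val I s + q.val I s ∧ p.val I s + q.val I s ≤ Z
  | sub p q => p.FitsInt Z I s ∧ q.FitsInt Z I s ∧
      -Z ≤ p.val I s - q.val I s ∧ p.val I s - q.val I s ≤ Z
  | mul p q => p.FitsInt Z I s ∧ q.FitsInt Z I s ∧
      -Z ≤ p.val I s * q.val I s ∧ p.val I s * q.val I s ≤ Z
  | div p q => p.FitsInt Z I s ∧ q.FitsInt Z I s ∧
      -Z ≤ p.val I s / q.val I s ∧ p.val I s / q.val I s ≤ Z
  | le p q => p.FitsInt Z I s ∧ q.FitsInt Z I s ∧ 1 ≤ Z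
  | leAlpha p q => p.FitsInt Z I s ∧ q.FitsInt Z I s ∧ 1 ≤ Z
  | leSigma p q => p.FitsInt Z I s ∧ q.FitsInt Z I s ∧ 1 ≤ Z
  | node i => i.FitsInt Z I s ∧ n ≤ Z ∧ 1 ≤ Z
  | nodeA i => i.FitsInt Z I s ∧ n ≤ Z ∧ 1 ≤ Z
  | firstEdge v => v.FitsInt Z I s ∧ m ≤ Z ∧ 1 ≤ Z
  | nextEdge v e => v.FitsInt Z I s ∧ e.FitsInt Z I s ∧ m ≤ Z ∧ 1 ≤ Z
  | src e => e.FitsInt Z I s ∧ n ≤ Z ∧ 1 ≤ Z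
  | tgt e => e.FitsInt Z I s ∧ n ≤ Z ∧ 1 ≤ Z

lemma encode_bounds {k : ℕ} (o : Option (Fin k)) : -1 ≤ encode o ∧ encode o < k := by
  cases o <;> simp only [encode] <;> omega

lemma Expr.FitsInt.fits {Z : ℤ} {I : Input n m} {s : State} {p : Expr} (hp : p.FitsInt Z I s) :
    p.Fits Z I s := by
  have habs : ∀ z : ℤ, -Z ≤ z → z ≤ Z → |(z : ℝ)| ≤ Z := fun z h1 h2 => by
    rw [abs_le]; exact ⟨by exact_mod_cast h1, by exact_mod_cast h2⟩
  have henc : ∀ (k : ℕ) (o : Option (Fin k)), k ≤ Z → 1 ≤ Z → |(encode o : ℝ)| ≤ Z :=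
    fun k o h1 h2 => by
      have := encode_bounds o
      exact habs _ (by omega) (by omega)
  induction p <;> rw [Expr.FitsInt] at hp <;> rw [Expr.Fits]
  case const => exact ⟨habs _ hp.1 hp.2, trivial⟩
  case var => exact ⟨habs _ hp.1 hp.2, trivial⟩
  case get ih => exact ⟨habs _ hp.2.1 hp.2.2, ih hp.1⟩
  case add ih1 ih2 => exact ⟨habs _ hp.2.2.1 hp.2.2.2, ih1 hp.1, ih2 hp.2.1⟩
  case sub ih1 ih2 => exact ⟨habs _ hp.2.2.1 hp.2.2.2, ih1 hp.1, ih2 hp.2.1⟩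
  case mul ih1 ih2 => exact ⟨habs _ hp.2.2.1 hp.2.2.2, ih1 hp.1, ih2 hp.2.1⟩
  case div ih1 ih2 => exact ⟨habs _ hp.2.2.1 hp.2.2.2, ih1 hp.1, ih2 hp.2.1⟩
  case le ih1 ih2 =>
    exact ⟨habs _ (by rw [val]; split_ifs <;> omega) (by rw [val]; split_ifs <;> omega),
      ih1 hp.1, ih2 hp.2.1⟩
  case leAlpha ih1 ih2 =>
    exact ⟨habs _ (by rw [val]; split_ifs <;> omega) (by rw [val]; split_ifs <;> omega),
      ih1 hp.1, ih2 hp.2.1⟩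
  case leSigma ih1 ih2 =>
    exact ⟨habs _ (by rw [val]; split_ifs <;> omega) (by rw [val]; split_ifs <;> omega),
      ih1 hp.1, ih2 hp.2.1⟩
  case node ih => exact ⟨henc _ _ hp.2.1 hp.2.2, ih hp.1⟩
  case nodeA ih => exact ⟨henc _ _ hp.2.1 hp.2.2, ih hp.1⟩
  case firstEdge ih => exact ⟨henc _ _ hp.2.1 hp.2.2, ih hp.1⟩
  case nextEdge ih1 ih2 => exact ⟨henc _ _ hp.2.2.1 hp.2.2.2, ih1 hp.1, ih2 hp.2.1⟩
  case src ih => exact ⟨henc _ _ hp.2.1 hp.2.2, ih hp.1⟩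
  case tgt ih => exact ⟨henc _ _ hp.2.1 hp.2.2, ih hp.1⟩

lemma Expr.Fits.mono {W W' : ℝ} (hW : W ≤ W') {I : Input n m} {s : State} {p : Expr}
    (hp : p.Fits W I s) : p.Fits W' I s := by
  induction p <;> rw [Expr.Fits] at hp ⊢ <;> refine ⟨hp.1.trans hW, ?_⟩ <;> simp_all

/-- Verification uses an integer bound on words; this transfers the run to the real bound of the
theorem. -/
lemma Exec.mono {W W' : ℝ} (hW : W ≤ W') {I : Input n m} {P : Program} {s s' : State} {t : ℕ}
    (hP : Exec W I P s s' t) : Exec W' I P s s' t := by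
  induction hP with
  | skip s => exact .skip s
  | assign hp => exact .assign (hp.mono hW)
  | put hi hp => exact .put (hi.mono hW) (hp.mono hW)
  | seq _ _ hc hd => exact .seq hc hd
  | ite_true hb h _ hc => exact .ite_true (hb.mono hW) h hc
  | ite_false hb h _ hc => exact .ite_false (hb.mono hW) h hc
  | loop_true hb h _ _ hc hl => exact .loop_true (hb.mono hW) h hc hl
  | loop_false hb h => exact .loop_false (hb.mono hW) h

/-- Program `P` halts from `s`, and its final state and its time satisfy `Q`. -/
def WP (Z : ℤ) (I : Input n m) (P : Program) (s : State) (Q : State → ℕ → Prop) : Prop :=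
  ∃ s' t, Exec (Z : ℝ) I P s s' t ∧ Q s' t

variable {Z : ℤ} {I : Input n m} {s : State} {Q : State → ℕ → Prop}

lemma WP.mono {P : Program} {Q' : State → ℕ → Prop} (hP : WP Z I P s Q')
    (h : ∀ s' t, Q' s' t → Q s' t) : WP Z I P s Q := by
  obtain ⟨s', t, h1, h2⟩ := hP
  exact ⟨s', t, h1, h _ _ h2⟩

lemma WP.skip (h : Q s 1) : WP Z I .skip s Q := ⟨_, _, .skip s, h⟩

lemma WP.assign {x : ℕ} {p : Expr} (hp : p.FitsInt Z I s)
    (h : Q (s.setReg x (p.val I s)) (p.size + 1)) : WP Z I (.assign x p) s Q :=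
  ⟨_, _, .assign hp.fits, h⟩

lemma WP.put {a : ℕ} {i p : Expr} (hi : i.FitsInt Z I s) (hp : p.FitsInt Z I s)
    (h : Q (s.setArr a (i.val I s) (p.val I s)) (i.size + p.size + 1)) : WP Z I (.put a i p) s Q :=
  ⟨_, _, .put hi.fits hp.fits, h⟩

lemma WP.seq {c d : Program} (h : WP Z I c s fun s' t => WP Z I d s' fun s'' t' => Q s'' (t + t')) :
    WP Z I (.seq c d) s Q := by
  obtain ⟨s', t, h1, s'', t', h2, h3⟩ := h
  exact ⟨_, _, .seq h1 h2, h3⟩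

lemma WP.ite {b : Expr} {c d : Program} (hb : b.FitsInt Z I s)
    (h1 : b.val I s ≠ 0 → WP Z I c s fun s' t => Q s' (b.size + 1 + t))
    (h2 : b.val I s = 0 → WP Z I d s fun s' t => Q s' (b.size + 1 + t)) :
    WP Z I (.ite b c d) s Q := by
  by_cases h : b.val I s = 0
  · obtain ⟨s', t, h3, h4⟩ := h2 h
    exact ⟨_, _, .ite_false hb.fits h h3, h4⟩
  · obtain ⟨s', t, h3, h4⟩ := h1 h
    exact ⟨_, _, .ite_true hb.fits h h3, h4⟩

/-- The loop rule, with an invariant that may mention ghost data `g` and a potential that pays for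
the running time. -/
lemma WP.loop {γ : Type*} (Inv : γ → State → Prop) (pot : γ → ℕ) {b : Expr} {c : Program} (g : γ)
    (h0 : Inv g s) (hb : ∀ g s, Inv g s → b.FitsInt Z I s)
    (hc : ∀ g s, Inv g s → b.val I s ≠ 0 →
      WP Z I c s fun s' t => ∃ g', Inv g' s' ∧ b.size + 1 + t + pot g' ≤ pot g)
    (hQ : ∀ g' s' t, Inv g' s' → b.val I s' = 0 → t + pot g' ≤ pot g + b.size + 1 → Q s' t) :
    WP Z I (.loop b c) s Q := by
  -- Evaluating the test costs time, so each iteration lowers the potential strictly. Induction on a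
  -- bound for the potential therefore proves termination as well.
  have key : ∀ k g s, pot g ≤ k → Inv g s → ∃ g' s' t, Exec (Z : ℝ) I (.loop b c) s s' t ∧
      Inv g' s' ∧ b.val I s' = 0 ∧ t + pot g' ≤ pot g + b.size + 1 := by
    intro k
    induction k with
    | zero =>
      intro g s hk hI
      by_cases h : b.val I s = 0
      · exact ⟨g, s, _, .loop_false (hb g s hI).fits h, hI, h, by omega⟩
      · obtain ⟨s', t, _, g', _, h3⟩ := hc g s hI h
        omega
    | succ k ih =>
      intro g s hk hI
      by_cases h : b.val I s = 0
      · exact ⟨g, s, _, .loop_false (hb g s hI).fits h, hI, h, by omega⟩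
      · obtain ⟨s', t, h1, g', h2, h3⟩ := hc g s hI h
        obtain ⟨g'', s'', t', h4, h5, h6, h7⟩ := ih g' s' (by omega) h2
        exact ⟨g'', s'', _, .loop_true (hb g s hI).fits h h1 h4, h5, h6, by omega⟩
  obtain ⟨g', s', t, h1, h2, h3, h4⟩ := key _ g s le_rfl h0
  exact ⟨s', t, h1, hQ g' s' t h2 h3 h4⟩

lemma State.setReg_reg (s : State) (x y : ℕ) (z : ℤ) :
    (s.setReg x z).reg y = if y = x then z else s.reg y := by
  simp [setReg, Function.update_apply]

lemma State.setReg_arr (s : State) (x : ℕ) (z : ℤ) : (s.setReg x z).arr = s.arr := rfl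

lemma State.setArr_reg (s : State) (a : ℕ) (i z : ℤ) : (s.setArr a i z).reg = s.reg := rfl

lemma State.setArr_arr (s : State) (a b : ℕ) (i j z : ℤ) :
    (s.setArr a i z).arr b j = if b = a ∧ j = i then z else s.arr b j := by
  by_cases h : b = a
  · subst h; simp [setArr, Function.update_apply]
  · simp [setArr, h]

lemma encode_some {k : ℕ} (i : Fin k) : encode (some i) = (i : ℕ) := rfl

lemma encode_none {k : ℕ} : encode (none : Option (Fin k)) = -1 := rfl

lemma decode_coe {k : ℕ} (i : Fin k) : decode k ((i : ℕ) : ℤ) = some i := by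
  simp [decode]

lemma entry_coe {X : Type*} (l : List X) (i : ℕ) : entry l (i : ℤ) = l[i]? := by simp [entry]

lemma val_firstEdge {v : Expr} {w : Fin n} (hv : v.val I s = (w : ℕ)) :
    (Expr.firstEdge v).val I s = encode (I.adj w)[0]? := by
  simp [Expr.val, hv, decode_coe, List.head?_eq_getElem?]

lemma val_nextEdge {v e : Expr} {w : Fin n} {i : ℕ} (hv : v.val I s = (w : ℕ))
    (hi : i < (I.adj w).length) (he : e.val I s = ((I.adj w)[i] : ℕ)) :
    (Expr.nextEdge v e).val I s = encode (I.adj w)[i + 1]? := by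
  simp [Expr.val, hv, he, decode_coe, (I.adj_nodup w).idxOf_getElem]

/-- Run `body` for every edge at the node in register `v`, with the edge in register `e`. -/
def forEdges (v e : ℕ) (body : Program) : Program :=
  .seq (.assign e (.firstEdge (.var v))) (.loop (.le (.const 0) (.var e))
    (.seq body (.assign e (.nextEdge (.var v) (.var e)))))

/-- Here `T` bounds the time of one execution of the body. The invariant counts the edges handled
and has to be independent of the edge register, which the iteration overwrites. -/
lemma WP.forEdges {v e T : ℕ} {body : Program} (w : Fin n) (Inv : ℕ → State → Prop)
    (hve : v ≠ e) (hn : (n : ℤ) ≤ Z) (hm : (m : ℤ) ≤ Z) (h1 : 1 ≤ Z) (hv : s.reg v = (w : ℕ))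
    (h0 : Inv 0 s) (hInv : ∀ t s z, Inv t s → Inv t (s.setReg e z))
    (hbody : ∀ t (ht : t < (I.adj w).length) s, Inv t s → s.reg v = (w : ℕ) →
      s.reg e = ((I.adj w)[t] : ℕ) → WP Z I body s fun s' τ => Inv (t + 1) s' ∧
        s'.reg v = (w : ℕ) ∧ s'.reg e = ((I.adj w)[t] : ℕ) ∧ τ ≤ T)
    (hQ : ∀ s' τ, Inv (I.adj w).length s' → s'.reg v = (w : ℕ) →
      τ ≤ (T + 8) * ((I.adj w).length + 1) → Q s' τ) :
    WP Z I (LBS.forEdges v e body) s Q := by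
  have hwn := w.2
  refine .seq (.assign ?_ ?_)
  · simp only [Expr.FitsInt, hv]; omega
  rw [val_firstEdge (w := w) (by simpa [Expr.val] using hv)]
  refine .loop (fun t s => t ≤ (I.adj w).length ∧ Inv t s ∧ s.reg v = (w : ℕ) ∧
    s.reg e = encode (I.adj w)[t]?) (fun t => (T + 8) * ((I.adj w).length - t)) 0 ?_ ?_ ?_ ?_
  · refine ⟨Nat.zero_le _, hInv _ _ _ h0, ?_, ?_⟩ <;> simp [State.setReg_reg, hve, hv]
  · rintro t s ⟨_, _, hv, he⟩
    have := encode_bounds (I.adj w)[t]?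
    simp only [Expr.FitsInt, he]; omega
  · rintro t s ⟨ht, hi, hv, he⟩ hb
    have ht : t < (I.adj w).length := by
      by_contra h
      rw [List.getElem?_eq_none (by omega), encode_none] at he
      simp [Expr.val, he] at hb
    rw [List.getElem?_eq_getElem ht, encode_some] at he
    refine .seq ((hbody t ht s hi hv he).mono ?_)
    rintro s' τ ⟨hi', hv', he', hτ⟩
    have hem := (I.adj w)[t].2
    refine .assign ?_ ⟨t + 1, ⟨ht, hInv _ _ _ hi', ?_, ?_⟩, ?_⟩
    · simp only [Expr.FitsInt, hv', he']; omega
    · simp [State.setReg_reg, hve, hv']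
    · rw [val_nextEdge (w := w) (i := t) (by simpa [Expr.val] using hv') ht
        (by simpa [Expr.val] using he')]
      simp [State.setReg_reg]
    · simp only [Expr.size]
      have : (I.adj w).length - t = (I.adj w).length - (t + 1) + 1 := by omega
      rw [this, mul_add]
      omega
  · rintro t s' τ ⟨ht, hi, hv, he⟩ hb hτ
    have ht' : t = (I.adj w).length := by
      by_contra h
      rw [List.getElem?_eq_getElem (by omega), encode_some] at he
      simp [Expr.val, he] at hb
    subst ht'
    refine hQ _ _ hi hv ?_
    simp only [Expr.size] at hτ ⊢
    rw [mul_add]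
    simp at hτ
    omega

end Verification
end LBS

namespace LBS

/-! ## Moving one token

Registers: `7` top label, `5` tokens absorbed per incidence, `9` edge capacity, `14` node of the
token, `15` whether there is a token, `16` edge at the cursor, `17` other end or sign, `18` number
of touched nodes, `19` whether a token is stuck. Arrays: `1` labels, `2` flows, `3` last edge passed
by the cursor plus one, `4` tokens absorbed at the cursor, `5` touched nodes. -/

section Token

open LBS.Expr

def dieProgram : Program := .seq (.assign 19 (.const 1)) (.assign 15 (.const 0))

/-- Adjacency lists offer only a head and successors, so a cursor is stored as the last edge passed.
The shift by one lets blank memory mean that none has been passed. -/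
def cursorProgram : Program :=
  .ite (.le (.get 3 (.var 14)) (.const 0)) (.assign 16 (.firstEdge (.var 14)))
    (.assign 16 (.nextEdge (.var 14) (.sub (.get 3 (.var 14)) (.const 1))))

/-- A node enters the list of touched nodes only on leaving label `0`, so it is listed once. -/
def relabelProgram : Program :=
  .seq (.ite (.le (.const 1) (.get 1 (.var 14))) .skip
    (.seq (.put 5 (.var 18) (.var 14)) (.assign 18 (.add (.var 18) (.const 1)))))
  (.seq (.put 3 (.var 14) (.const 0)) (.put 1 (.var 14) (.add (.get 1 (.var 14)) (.const 1))))

def advanceProgram : Program := .put 3 (.var 14) (.add (.var 16) (.const 1))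

def fillProgram : Program :=
  .ite (.le (.add (.get 4 (.var 14)) (.const 1)) (.var 5))
    (.seq (.put 4 (.var 14) (.add (.get 4 (.var 14)) (.const 1))) (.assign 15 (.const 0)))
    (.seq (.put 4 (.var 14) (.const 0)) advanceProgram)

/-- Two opposite comparisons multiply to an equality test, which gives the sign of the edge as seen
from the node. The other end is the sum of both ends minus the node; a product of tests is their
conjunction. -/
def moveProgram : Program :=
  .seq (.assign 17 (.sub (.mul (.const 2) (.mul (.le (.src (.var 16)) (.var 14))
    (.le (.var 14) (.src (.var 16))))) (.const 1)))
  (.seq (.assign 25 (.sub (.add (.src (.var 16)) (.tgt (.var 16))) (.var 14)))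
  (.ite (.mul (.le (.add (.get 1 (.var 25)) (.const 1)) (.get 1 (.var 14)))
      (.le (.add (.mul (.var 17) (.get 2 (.var 16))) (.const 1)) (.var 9)))
    (.seq (.put 2 (.var 16) (.add (.get 2 (.var 16)) (.var 17))) (.assign 14 (.var 25)))
    advanceProgram))

def tokenProgram : Program :=
  .ite (.le (.var 7) (.get 1 (.var 14))) dieProgram
    (.seq cursorProgram
      (.ite (.le (.const 0) (.var 16))
        (.ite (.le (.const 1) (.get 1 (.var 14))) moveProgram fillProgram)
        relabelProgram))

variable {n m : ℕ}

/-- The snapshot `c` is stored in memory. -/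
structure Rep (I : Input n m) (c : Cfg n m) (s : State) : Prop where
  lab : ∀ v : Fin n, s.arr 1 (v : ℕ) = c.lab v
  flow : ∀ e : Fin m, s.arr 2 (e : ℕ) = c.flow e
  pos : ∀ v : Fin n, s.arr 3 (v : ℕ) =
    if c.pos v = 0 then 0 else encode ((I.adj v)[c.pos v - 1]?) + 1
  cnt : ∀ v : Fin n, s.arr 4 (v : ℕ) = c.cnt v
  len : s.reg 18 = c.touched.length
  touched : ∀ k : ℕ, ∀ hk : k < c.touched.length, s.arr 5 k = (c.touched[k] : ℕ)
  dead : (s.reg 19 = 0 ∧ ∀ v, c.ex v = 0) ∨ (s.reg 19 = 1 ∧ ∃ v, c.ex v ≠ 0)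

/-- The parameters of the computation: tokens per incidence of `A`, tokens absorbed per incidence,
inverse sparsity, number of doublings, and the nodes of `A` repeated as often as their degrees. -/
structure Par (n : ℕ) where
  K : ℕ
  Kp : ℕ
  b : ℕ
  L : ℕ
  inc : List (Fin n)

/-- The top label. -/
def Par.h (P : Par n) : ℕ := P.b * P.L + 1

/-- The edge capacity. -/
def Par.U (P : Par n) : ℕ := P.K * P.b

/-- The parameters are stored in memory. -/
structure Stored (P : Par n) (s : State) : Prop where
  b : s.reg 3 = P.b
  K : s.reg 4 = P.K
  Kp : s.reg 5 = P.Kp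
  V : s.reg 6 = P.inc.length
  h : s.reg 7 = P.h
  U : s.reg 9 = P.U
  inc : ∀ k : ℕ, ∀ hk : k < P.inc.length, s.arr 6 k = (P.inc[k] : ℕ)

/-- The integer `Z` is large enough for the computation. -/
structure Large (P : Par n) (m : ℕ) (Z : ℤ) : Prop where
  size : (2 * n + m + P.h + P.U + P.Kp + P.K + P.b + 10 : ℤ) ≤ Z
  tokens : (P.K * P.inc.length : ℤ) + 1 ≤ Z
  scan : (P.b + 3) * (P.K * P.inc.length : ℤ) ≤ Z

variable {I : Input n m} {P : Par n} {Z : ℤ} {c : Cfg n m} {s : State}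

/-- The place of the token. -/
def TokenAt (cur : Option (Fin n)) (s : State) : Prop :=
  match cur with
  | none => s.reg 15 = 0
  | some v => s.reg 15 = 1 ∧ s.reg 14 = (v : ℕ)

/-- The potential energy of the token. -/
def energy (c : Cfg n m) : Option (Fin n) → ℕ
  | none => 0
  | some v => c.lab v + 1

/-- The outcome of a step of the token computation. -/
def StepPost (I : Input n m) (P : Par n) (src : Fin n → ℕ) (c : Cfg n m) (v : Fin n) (q : ℤ)
    (T : ℕ) (s' : State) (t : ℕ) : Prop :=
  ∃ c' cur', Good I P.Kp P.h P.U c' src cur' ∧ Rep I c' s' ∧ Stored P s' ∧ TokenAt cur' s' ∧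
    s'.reg 10 = q ∧ t ≤ T ∧
    2 * c.work I + energy c' cur' + 1 ≤ 2 * c'.work I + (c.lab v + 1) ∧ c.work I ≤ c'.work I

lemma coe_fin_inj {k : ℕ} {v w : Fin k} : ((v : ℕ) : ℤ) = ((w : ℕ) : ℤ) ↔ v = w := by
  rw [Nat.cast_inj, Fin.val_inj]

variable {src : Fin n → ℕ} {v : Fin n} {q : ℤ}

lemma dieProgram_wp (hZ : Large P m Z) (hc : Good I P.Kp P.h P.U c src (some v)) (hr : Rep I c s)
    (hs : Stored P s) (hq : s.reg 10 = q) (hl : P.h ≤ c.lab v) :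
    WP Z I dieProgram s (StepPost I P src c v q 10) := by
  have hz := hZ.size
  refine .seq (.assign ?_ (.assign ?_ ⟨c.die v, none, hc.die (le_antisymm (hc.lab_le v) hl),
    ?_, ?_, ?_, ?_, ?_, ?_, ?_⟩))
  · simp only [FitsInt]; omega
  · simp only [FitsInt]; omega
  · refine ⟨hr.lab, hr.flow, hr.pos, hr.cnt, ?_, hr.touched, Or.inr ⟨?_, v, ?_⟩⟩
    · simpa [State.setReg_reg, Cfg.die] using hr.len
    · simp [State.setReg_reg, val]
    · simp [Cfg.die]
  · exact ⟨hs.b, hs.K, hs.Kp, hs.V, hs.h, hs.U, hs.inc⟩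
  · simp [TokenAt, State.setReg_reg, val]
  · simpa [State.setReg_reg] using hq
  · simp [size]
  · have : (c.die v).work I = c.work I := rfl
    simp only [energy]; omega
  · exact le_rfl

lemma cursorProgram_wp {Q : State → ℕ → Prop} (hZ : Large P m Z)
    (hc : Good I P.Kp P.h P.U c src (some v)) (hr : Rep I c s) (hv : s.reg 14 = (v : ℕ))
    (hQ : ∀ t, t ≤ 15 → Q (s.setReg 16 (encode (I.adj v)[c.pos v]?)) t) :
    WP Z I cursorProgram s Q := by
  have hz := hZ.size
  have hvn := v.2
  have hpv := hr.pos v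
  have hb := encode_bounds (I.adj v)[c.pos v - 1]?
  by_cases h0 : c.pos v = 0
  · rw [if_pos h0] at hpv
    refine .ite ?_ (fun _ => .assign ?_ ?_) (fun h => ?_)
    · simp only [FitsInt, val, hv, hpv]; omega
    · simp only [FitsInt, hv]; omega
    · rw [val_firstEdge (w := v) (by simpa [val] using hv), ← h0]
      exact hQ _ (by simp [size])
    · simp [val, hv, hpv] at h
  · rw [if_neg h0] at hpv
    have hlt : c.pos v - 1 < (I.adj v).length := by have := hc.pos_le v; omega
    rw [List.getElem?_eq_getElem hlt, encode_some] at hpv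
    have hme := ((I.adj v)[c.pos v - 1]).2
    refine .ite ?_ (fun h => ?_) (fun _ => .assign ?_ ?_)
    · simp only [FitsInt, val, hv, hpv]; omega
    · simp only [val, hv, hpv] at h
      rw [if_neg (by omega)] at h
      exact absurd rfl h
    · simp only [FitsInt, val, hv, hpv]; omega
    · rw [val_nextEdge (w := v) (i := c.pos v - 1) (by simpa [val] using hv) hlt
        (by simp [val, hv, hpv]), Nat.sub_add_cancel (by omega)]
      exact hQ _ (by simp [size])

lemma Rep.setReg (hr : Rep I c s) {x : ℕ} {z : ℤ} (hx : x ≠ 18) (hx' : x ≠ 19) :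
    Rep I c (s.setReg x z) :=
  ⟨hr.lab, hr.flow, hr.pos, hr.cnt, by simpa [State.setReg_reg, hx.symm] using hr.len, hr.touched,
    by simpa [State.setReg_reg, hx'.symm] using hr.dead⟩

lemma Stored.setReg (hs : Stored P s) {x : ℕ} {z : ℤ} (hx : x < 3 ∨ 9 < x) :
    Stored P (s.setReg x z) := by
  constructor
  case inc => exact hs.inc
  all_goals
    simp only [State.setReg_reg]
    rw [if_neg (by omega)]
  exacts [hs.b, hs.K, hs.Kp, hs.V, hs.h, hs.U]

lemma Stored.setArr (hs : Stored P s) {a : ℕ} {i z : ℤ} (ha : a ≠ 6) :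
    Stored P (s.setArr a i z) := by
  refine ⟨hs.b, hs.K, hs.Kp, hs.V, hs.h, hs.U, fun k hk => ?_⟩
  simp only [State.setArr_arr, ha.symm, false_and, if_false]
  exact hs.inc k hk

lemma relabelProgram_wp (hZ : Large P m Z) (hc : Good I P.Kp P.h P.U c src (some v))
    (hr : Rep I c s) (hs : Stored P s) (hq : s.reg 10 = q) (h15 : s.reg 15 = 1)
    (hv : s.reg 14 = (v : ℕ)) (hl : c.lab v < P.h) (hp : c.pos v = (I.adj v).length) :
    WP Z I relabelProgram s (StepPost I P src c v q 40) := by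
  have hz := hZ.size
  have hvn := v.2
  have hlv := hr.lab v
  have hlen := hr.len
  have htn : c.touched.length ≤ n := by simpa using hc.touched_nodup.length_le_card
  have hwork := Cfg.work_relabel (I := I) (c := c) hp
  have hg := hc.relabel hl hp
  -- The two final writes are common to both branches; only the update of the touched list depends
  -- on whether the old label is `0`.
  have main : ∀ s' t, t ≤ 20 → Stored P s' → s'.reg 10 = q → s'.reg 15 = 1 →
      s'.reg 14 = (v : ℕ) → s'.arr 1 = s.arr 1 → s'.arr 2 = s.arr 2 → s'.arr 3 = s.arr 3 →
      s'.arr 4 = s.arr 4 → s'.reg 19 = s.reg 19 →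
      s'.reg 18 = (c.relabel v).touched.length →
      (∀ k : ℕ, ∀ hk : k < (c.relabel v).touched.length,
        s'.arr 5 k = ((c.relabel v).touched[k] : ℕ)) →
      WP Z I (.seq (.put 3 (.var 14) (.const 0))
        (.put 1 (.var 14) (.add (.get 1 (.var 14)) (.const 1)))) s'
        fun s' t' => StepPost I P src c v q 40 s' (t + t') := by
    intro s' t ht hs' hq' h15' hv' h1 h2 h3 h4 h19 h18 h5
    refine .seq (.put ?_ ?_ (.put ?_ ?_ ⟨c.relabel v, some v, hg, ?_, ?_, ?_, ?_, ?_, ?_, ?_⟩))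
    · simp only [FitsInt, hv']; omega
    · simp only [FitsInt]; omega
    · simp only [FitsInt, State.setArr_reg, hv']; omega
    · simp only [FitsInt, State.setArr_reg, State.setArr_arr, val, hv', h1, hlv]; simp; omega
    · refine ⟨fun w => ?_, fun e => ?_, fun w => ?_, fun w => ?_, ?_, fun k hk => ?_, ?_⟩
      · simp only [State.setArr_arr, State.setArr_reg, val, hv', h1, hr.lab, coe_fin_inj]
        by_cases hw : w = v <;> simp [Cfg.relabel, hw]
      · simpa [State.setArr_arr, h2, Cfg.relabel] using hr.flow e
      · simp only [State.setArr_arr, State.setArr_reg, val, hv', h3, hr.pos, coe_fin_inj]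
        by_cases hw : w = v <;> simp [Cfg.relabel, hw]
      · simpa [State.setArr_arr, h4, Cfg.relabel] using hr.cnt w
      · exact h18
      · simpa [State.setArr_arr] using h5 k hk
      · simp only [State.setArr_reg, h19]; exact hr.dead
    · exact (hs'.setArr (by decide)).setArr (by decide)
    · exact ⟨h15', hv'⟩
    · exact hq'
    · simp only [size]; omega
    · simp only [energy, Cfg.relabel, Function.update_self] at hwork ⊢
      omega
    · omega
  refine .seq (.ite ?_ (fun h => .skip ?_) (fun h => .seq (.put ?_ ?_ (.assign ?_ ?_))))
  · simp only [FitsInt, hv, val, hlv]; omega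
  · have h0 : c.lab v ≠ 0 := by
      rintro h0
      simp [val, hv, hlv, h0] at h
    refine main s _ (by simp [size]) hs hq h15 hv rfl rfl rfl rfl rfl ?_ ?_
    · simpa [Cfg.relabel, h0] using hlen
    · simpa [Cfg.relabel, h0] using hr.touched
  · simp only [FitsInt, hlen]; omega
  · simp only [FitsInt, hv]; omega
  · simp only [FitsInt, State.setArr_reg, val, hlen]; omega
  · have h0 : c.lab v = 0 := by
      simpa [val, hv, hlv, Nat.pos_iff_ne_zero] using h
    refine main _ _ (by simp [size]) ((hs.setArr (by decide)).setReg (by decide)) ?_ ?_ ?_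
      ?_ ?_ ?_ ?_ ?_ ?_ ?_
    · simpa [State.setReg_reg, State.setArr_reg] using hq
    · simpa [State.setReg_reg, State.setArr_reg] using h15
    · simpa [State.setReg_reg, State.setArr_reg] using hv
    · ext; simp [State.setReg_arr, State.setArr_arr]
    · ext; simp [State.setReg_arr, State.setArr_arr]
    · ext; simp [State.setReg_arr, State.setArr_arr]
    · ext; simp [State.setReg_arr, State.setArr_arr]
    · simp [State.setReg_reg, State.setArr_reg]
    · simp [State.setReg_reg, State.setArr_reg, val, Cfg.relabel, h0, hlen]
    · intro k hk
      simp only [State.setReg_arr, State.setArr_arr, val, hlen, hv]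
      simp only [Cfg.relabel, h0, if_true, List.length_append, List.length_singleton] at hk ⊢
      by_cases hk' : k < c.touched.length
      · rw [if_neg (by omega), List.getElem_append_left hk', hr.touched k hk']
      · obtain rfl : k = c.touched.length := by omega
        simp

lemma pos_repr {w : Fin n} {e : Fin m} (hp : c.pos v < (I.adj v).length)
    (he : (I.adj v)[c.pos v] = e) (hr : ∀ v : Fin n, s.arr 3 (v : ℕ) =
      if c.pos v = 0 then 0 else encode ((I.adj v)[c.pos v - 1]?) + 1) :
    (s.setArr 3 (v : ℕ) ((e : ℕ) + 1)).arr 3 (w : ℕ) =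
      if Function.update c.pos v (c.pos v + 1) w = 0 then 0
      else encode ((I.adj w)[Function.update c.pos v (c.pos v + 1) w - 1]?) + 1 := by
  by_cases hw : w = v
  · subst hw
    simp [State.setArr_arr, List.getElem?_eq_getElem hp, he, encode_some]
  · simp only [State.setArr_arr, coe_fin_inj, hw, and_false, if_false, hr w,
      Function.update_of_ne hw]

lemma fillProgram_wp (hZ : Large P m Z) (hc : Good I P.Kp P.h P.U c src (some v))
    (hr : Rep I c s) (hs : Stored P s) (hq : s.reg 10 = q) (h15 : s.reg 15 = 1)
    (hv : s.reg 14 = (v : ℕ)) (hl : c.lab v = 0) (hp : c.pos v < (I.adj v).length)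
    (he : s.reg 16 = ((I.adj v)[c.pos v] : ℕ)) :
    WP Z I fillProgram s (StepPost I P src c v q 30) := by
  have hz := hZ.size
  have hvn := v.2
  have hcv := hr.cnt v
  have hcn := hc.cnt_le v
  have hem := ((I.adj v)[c.pos v]).2
  have hKp := hs.Kp
  have hwork := Cfg.work_fill (I := I) c v
  refine .ite ?_ (fun h => .seq (.put ?_ ?_ (.assign ?_ ?_)))
    (fun h => .seq (.put ?_ ?_ (.put ?_ ?_ ?_)))
  · simp only [FitsInt, hv, val, hcv, hKp]; omega
  · simp only [FitsInt, hv]; omega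
  · simp only [FitsInt, hv, val, hcv]; omega
  · simp only [FitsInt]; omega
  · have hk : c.cnt v + 1 ≤ P.Kp := by
      simp only [val, hv, hcv, hKp] at h
      by_contra h'
      rw [if_neg (by omega)] at h
      exact h rfl
    refine ⟨c.absorb v, none, hc.absorb hl hp hk, ?_, ?_, ?_, ?_, ?_, ?_, ?_⟩
    · refine ⟨hr.lab, hr.flow, hr.pos, fun w => ?_, hr.len, hr.touched, hr.dead⟩
      simp only [State.setReg_arr, State.setArr_arr, val, hv, hcv, coe_fin_inj, hr.cnt]
      by_cases hw : w = v <;> simp [Cfg.absorb, hw]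
    · exact (hs.setArr (by decide)).setReg (by decide)
    · simp [TokenAt, State.setReg_reg, val]
    · simpa [State.setReg_reg, State.setArr_reg] using hq
    · simp [size]
    · have : (c.absorb v).work I = c.work I := rfl
      simp only [energy]; omega
    · exact le_rfl
  · simp only [FitsInt, hv]; omega
  · simp only [FitsInt]; omega
  · simp only [FitsInt, State.setArr_reg, hv]; omega
  · simp only [FitsInt, State.setArr_reg, val, he]; omega
  · have hk : ¬ c.cnt v + 1 ≤ P.Kp := by
      simp only [val, hv, hcv, hKp] at h
      intro h'
      rw [if_pos (by omega)] at h
      exact one_ne_zero h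
    refine ⟨c.fill v, some v, hc.fill hl hp hk, ?_, ?_, ?_, ?_, ?_, ?_, ?_⟩
    · refine ⟨?_, ?_, ?_, fun w => ?_, hr.len, ?_, hr.dead⟩
      · simpa [State.setArr_arr, Cfg.fill] using hr.lab
      · simpa [State.setArr_arr, Cfg.fill] using hr.flow
      · intro w
        simp only [val, State.setArr_reg, hv, he]
        exact pos_repr hp rfl (by simpa [State.setArr_arr] using hr.pos)
      · simp only [State.setArr_arr, State.setArr_reg, val, hv, coe_fin_inj, hr.cnt]
        by_cases hw : w = v <;> simp [Cfg.fill, hw]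
      · simpa [State.setArr_arr, Cfg.fill] using hr.touched
    · exact (hs.setArr (by decide)).setArr (by decide)
    · exact ⟨h15, hv⟩
    · exact hq
    · simp [size]
    · have : (c.fill v).lab = c.lab := rfl
      simp only [energy, this]; omega
    · omega

lemma moveProgram_wp (hZ : Large P m Z) (hc : Good I P.Kp P.h P.U c src (some v))
    (hr : Rep I c s) (hs : Stored P s) (hq : s.reg 10 = q) (h15 : s.reg 15 = 1)
    (hv : s.reg 14 = (v : ℕ)) (hl : c.lab v ≠ 0) (hp : c.pos v < (I.adj v).length)
    (he : s.reg 16 = ((I.adj v)[c.pos v] : ℕ)) :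
    WP Z I moveProgram s (StepPost I P src c v q 60) := by
  have hz := hZ.size
  have hvn := v.2
  generalize hed : (I.adj v)[c.pos v] = e at he
  have hadj : e ∈ I.adj v := hed ▸ List.getElem_mem hp
  have hem := e.2
  have hU := hs.U
  have hsrc := (I.src e).2
  have htgt := (I.tgt e).2
  have hst := I.src_ne_tgt e
  have hw := (I.other v e).2
  have hlv := hc.lab_le v
  have hlw := hc.lab_le (I.other v e)
  have hwork := Cfg.work_advance (I := I) c v
  have hf1 := hc.flow_ge e
  have hf2 := hc.flow_le e
  have hval1 : (Expr.sub (.mul (.const 2) (.mul (.le (.src (.var 16)) (.var 14))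
      (.le (.var 14) (.src (.var 16))))) (.const 1)).val I s = if I.src e = v then 1 else -1 := by
    simp only [val, hv, he, decode_coe, Option.map_some, encode_some]
    by_cases h : I.src e = v
    · simp [h]
    · have : (I.src e : ℕ) ≠ v := fun h' => h (Fin.ext h')
      rw [if_neg h]
      rcases lt_or_gt_of_ne this with h1 | h1
      · rw [if_neg (show ¬ ((v : ℕ) : ℤ) ≤ (I.src e : ℕ) by omega)]; ring
      · rw [if_neg (show ¬ ((I.src e : ℕ) : ℤ) ≤ (v : ℕ) by omega)]; ring
  refine .seq (.assign ?_ (.seq (.assign ?_ ?_)))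
  · simp only [FitsInt, val, hv, he, decode_coe, Option.map_some, encode_some]
    split_ifs <;> omega
  · simp only [FitsInt, State.setReg_reg, val, he, decode_coe, Option.map_some, encode_some]
    simp only [hv, decode_coe, Option.map_some, encode_some, reduceIte, Nat.reduceEqDiff]
    omega
  rw [hval1]
  have hval2 : (Expr.sub (.add (.src (.var 16)) (.tgt (.var 16))) (.var 14)).val I
      (s.setReg 17 (if I.src e = v then 1 else -1)) = (I.other v e : ℕ) := by
    simp only [val, State.setReg_reg, Nat.reduceEqDiff, if_false, hv, he,
      decode_coe, Option.map_some, encode_some, Input.other]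
    rw [I.mem_adj_iff] at hadj
    rcases hadj with rfl | rfl
    · simp
    · simp [hst]
  rw [hval2]
  set s' := (s.setReg 17 (if I.src e = v then 1 else -1)).setReg 25 (I.other v e : ℕ) with hs'
  have h17 : s'.reg 17 = if I.src e = v then 1 else -1 := by simp [hs', State.setReg_reg]
  have h25 : s'.reg 25 = (I.other v e : ℕ) := by simp [hs', State.setReg_reg]
  have hr' : Rep I c s' := (hr.setReg (by decide) (by decide)).setReg (by decide) (by decide)
  have hst' : Stored P s' := (hs.setReg (by decide)).setReg (by decide)
  have hq' : s'.reg 10 = q := by simpa [hs', State.setReg_reg] using hq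
  have h15' : s'.reg 15 = 1 := by simpa [hs', State.setReg_reg] using h15
  have hv' : s'.reg 14 = (v : ℕ) := by simpa [hs', State.setReg_reg] using hv
  have he' : s'.reg 16 = (e : ℕ) := by simpa [hs', State.setReg_reg] using he
  have hU' := hst'.U
  have hl1 := hr'.lab v
  have hl2 := hr'.lab (I.other v e)
  have hfe := hr'.flow e
  clear_value s'
  have hal : (if I.src e = v then 1 else -1) * c.flow e = along I c.flow v e := by
    simp only [along]; split_ifs <;> ring
  refine .ite ?_ (fun h => .seq (.put ?_ ?_ (.assign ?_ ?_))) (fun h => .put ?_ ?_ ?_)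
  · have hb : -(P.U : ℤ) ≤ along I c.flow v e ∧ along I c.flow v e ≤ P.U := by
      simp only [along]; split_ifs <;> omega
    simp only [FitsInt, val, hv', h25, h17, he', hl1, hl2, hfe, hU', hal]
    have h1 : ∀ p q : Prop, [Decidable p] → [Decidable q] →
        -Z ≤ (if p then 1 else 0) * (if q then 1 else 0) ∧
        (if p then 1 else 0) * (if q then 1 else 0) ≤ Z := by
      intros; split_ifs <;> omega
    refine ⟨by omega, ⟨⟨⟨?_, by omega, by omega⟩, by omega, by omega⟩, by omega, by omega⟩,
      h1 _ _⟩
    split_ifs <;> omega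
  · simp only [FitsInt, he']; omega
  · simp only [FitsInt, val, h17, he', hfe]; split_ifs <;> omega
  · simp only [FitsInt, State.setArr_reg, h25]; omega
  · simp only [val, hv', h25, h17, he', hl1, hl2, hfe, hU', hal] at h
    have ha : along I c.flow v e < P.U ∧ c.lab (I.other v e) + 1 ≤ c.lab v := by
      by_contra h'
      rw [not_and_or] at h'
      rcases h' with h' | h'
      · rw [if_neg (show ¬ along I c.flow v e + 1 ≤ P.U by omega)] at h; simp at h
      · rw [if_neg (show ¬ (c.lab (I.other v e) : ℤ) + 1 ≤ c.lab v by omega)] at h; simp at h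
    refine ⟨c.push I v e, some (I.other v e), hc.push hadj ha.1 ha.2, ?_, ?_, ?_, ?_, ?_, ?_, ?_⟩
    · refine ⟨?_, fun e' => ?_, ?_, ?_, ?_, ?_, ?_⟩
      · simpa [State.setReg_arr, State.setArr_arr, Cfg.push] using hr'.lab
      · simp only [State.setReg_arr, State.setArr_arr, val, he', hfe, h17, coe_fin_inj, hr'.flow]
        by_cases hw : e' = e <;> simp [Cfg.push, hw]
      · intro w
        simp only [State.setReg_arr, State.setArr_arr]
        rw [if_neg (by simp)]
        exact hr'.pos w
      · simpa [State.setReg_arr, State.setArr_arr, Cfg.push] using hr'.cnt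
      · simpa [State.setReg_reg, State.setArr_reg, Cfg.push] using hr'.len
      · simpa [State.setReg_arr, State.setArr_arr, Cfg.push] using hr'.touched
      · simpa [State.setReg_reg, State.setArr_reg, Cfg.push] using hr'.dead
    · exact (hst'.setArr (by decide)).setReg (by decide)
    · simp [TokenAt, State.setReg_reg, State.setArr_reg, val, h15', h25]
    · simpa [State.setReg_reg, State.setArr_reg] using hq'
    · simp [size]
    · have h1 : (c.push I v e).work I = c.work I := rfl
      have h2 : (c.push I v e).lab = c.lab := rfl
      simp only [energy, h2]; omega
    · exact le_rfl
  · simp only [FitsInt, hv']; omega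
  · simp only [FitsInt, val, he']; omega
  · simp only [val, hv', h25, h17, he', hl1, hl2, hfe, hU', hal] at h
    refine ⟨c.advance v, some v, hc.advance hl hp ?_, ?_, ?_, ?_, ?_, ?_, ?_, ?_⟩
    · rw [hed]
      intro h1
      by_contra h2
      rw [if_pos (show along I c.flow v e + 1 ≤ P.U by omega),
        if_pos (show (c.lab (I.other v e) : ℤ) + 1 ≤ c.lab v by omega)] at h
      simp at h
    · refine ⟨?_, ?_, ?_, ?_, hr'.len, ?_, hr'.dead⟩
      · simpa [State.setArr_arr, Cfg.advance] using hr'.lab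
      · simpa [State.setArr_arr, Cfg.advance] using hr'.flow
      · intro w
        simp only [val, hv', he']
        exact pos_repr hp hed (by simpa [State.setArr_arr] using hr'.pos)
      · simpa [State.setArr_arr, Cfg.advance] using hr'.cnt
      · simpa [State.setArr_arr, Cfg.advance] using hr'.touched
    · exact hst'.setArr (by decide)
    · exact ⟨h15', hv'⟩
    · exact hq'
    · simp [size]
    · have : (c.advance v).lab = c.lab := rfl
      simp only [energy, this]; omega
    · omega

lemma StepPost.mono {T T' : ℕ} {s' : State} {t t' : ℕ}
    (h : StepPost I P src c v q T s' t) (ht : t' ≤ t + T') :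
    StepPost I P src c v q (T + T') s' t' := by
  obtain ⟨c', cur', h1, h2, h3, h4, h5, h6, h7⟩ := h
  exact ⟨c', cur', h1, h2, h3, h4, h5, by omega, h7⟩

lemma tokenProgram_wp (hZ : Large P m Z) (hc : Good I P.Kp P.h P.U c src (some v))
    (hr : Rep I c s) (hs : Stored P s) (hq : s.reg 10 = q) (ht : TokenAt (some v) s) :
    WP Z I tokenProgram s (StepPost I P src c v q 100) := by
  obtain ⟨h15, hv⟩ := ht
  have hz := hZ.size
  have hvn := v.2
  have hlv := hc.lab_le v
  have hh := hs.h
  have hl := hr.lab v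
  refine .ite ?_ (fun h => ?_) (fun h => .seq ?_)
  · simp only [FitsInt, hh, hv, val, hl]; omega
  · simp only [val, hh, hv, hl] at h
    refine (dieProgram_wp hZ hc hr hs hq ?_).mono fun s' t ht => ?_
    · by_contra h'
      rw [if_neg (by omega)] at h
      exact h rfl
    · exact ht.mono (T' := 90) (by simp [size]; omega)
  · simp only [val, hh, hv, hl] at h
    have hlt : c.lab v < P.h := by
      by_contra h'
      rw [if_pos (by omega)] at h
      exact one_ne_zero h
    refine cursorProgram_wp hZ hc hr hv fun t ht => ?_
    have hb := encode_bounds (I.adj v)[c.pos v]?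
    have hr' : Rep I c (s.setReg 16 (encode (I.adj v)[c.pos v]?)) :=
      hr.setReg (by decide) (by decide)
    have hs' : Stored P (s.setReg 16 (encode (I.adj v)[c.pos v]?)) := hs.setReg (by decide)
    have h16 : (s.setReg 16 (encode (I.adj v)[c.pos v]?)).reg 16 = encode (I.adj v)[c.pos v]? := by
      simp [State.setReg_reg]
    have hq' : (s.setReg 16 (encode (I.adj v)[c.pos v]?)).reg 10 = q := by
      simpa [State.setReg_reg] using hq
    have h15' : (s.setReg 16 (encode (I.adj v)[c.pos v]?)).reg 15 = 1 := by
      simpa [State.setReg_reg] using h15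
    have hv' : (s.setReg 16 (encode (I.adj v)[c.pos v]?)).reg 14 = (v : ℕ) := by
      simpa [State.setReg_reg] using hv
    have hl' := hr'.lab v
    generalize s.setReg 16 (encode (I.adj v)[c.pos v]?) = s' at *
    refine .ite ?_ (fun h => .ite ?_ (fun h' => ?_) (fun h' => ?_)) (fun h => ?_)
    · simp only [FitsInt, h16]; omega
    · simp only [FitsInt, val, hv', hl']; omega
    · simp only [val, h16, hv', hl'] at h h'
      have hp : c.pos v < (I.adj v).length := by
        by_contra h'
        rw [List.getElem?_eq_none (by omega), encode_none] at h
        simp at h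
      rw [List.getElem?_eq_getElem hp, encode_some] at h16
      have h0 : c.lab v ≠ 0 := by rintro h0; simp [h0] at h'
      refine (moveProgram_wp hZ hc hr' hs' hq' h15' hv' h0 hp h16).mono fun s' t ht => ?_
      exact ht.mono (T' := 40) (by simp [size]; omega)
    · simp only [val, h16, hv', hl'] at h h'
      have hp : c.pos v < (I.adj v).length := by
        by_contra h'
        rw [List.getElem?_eq_none (by omega), encode_none] at h
        simp at h
      rw [List.getElem?_eq_getElem hp, encode_some] at h16
      have h0 : c.lab v = 0 := by simpa [Nat.pos_iff_ne_zero] using h'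
      refine (fillProgram_wp hZ hc hr' hs' hq' h15' hv' h0 hp h16).mono fun s' t ht => ?_
      exact (ht.mono (T' := 70) (by simp [size]; omega))
    · simp only [val, h16] at h
      have hp : c.pos v = (I.adj v).length := by
        by_contra h'
        have := hc.pos_le v
        rw [List.getElem?_eq_getElem (by omega), encode_some] at h
        simp at h
      refine (relabelProgram_wp hZ hc hr' hs' hq' h15' hv' hlt hp).mono fun s' t ht => ?_
      exact (ht.mono (T' := 60) (by simp [size]; omega))

end Token
end LBS

namespace LBS

/-! ## Sending all tokens -/

section Flow

open LBS.Expr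

def tokenLoop : Program := .loop (.var 15) tokenProgram

def flowProgram : Program :=
  .seq (.assign 10 (.const 0)) (.loop (.le (.add (.var 10) (.const 1)) (.mul (.var 4) (.var 6)))
    (.seq (.assign 14 (.get 6 (.div (.var 10) (.var 4)))) (.seq (.assign 15 (.const 1))
      (.seq tokenLoop (.assign 10 (.add (.var 10) (.const 1)))))))

variable {n m : ℕ} {I : Input n m} {P : Par n} {Z : ℤ} {c : Cfg n m} {s : State}
  {src : Fin n → ℕ} {v : Fin n} {q : ℤ}

/-- The amortization is that each step gains at least one unit in `2 * work - energy`: a push or a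
disappearance lowers the energy, a cursor move gains two units of doubled work, and a relabelling
gives one of these back. A step and its loop test cost at most `102`. -/
lemma tokenLoop_wp (hZ : Large P m Z) (hKp : 1 ≤ P.Kp)
    (hc : Good I P.Kp P.h P.U c src (some v)) (hr : Rep I c s)
    (hs : Stored P s) (hq : s.reg 10 = q) (ht : TokenAt (some v) s) :
    WP Z I tokenLoop s fun s' t => ∃ c', Good I P.Kp P.h P.U c' src none ∧ Rep I c' s' ∧
      Stored P s' ∧ s'.reg 10 = q ∧ t + 204 * c.work I ≤ 204 * c'.work I + 102 * (P.h + 1) + 2 := by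
  have hz := hZ.size
  have hW : ∀ c' cur, Good I P.Kp P.h P.U c' src cur →
    c'.work I ≤ (2 * P.h + 1) * ∑ v, src v := fun c' cur hc' => hc'.work_le hKp
  -- Only the fact that `W` bounds all work matters: it keeps the truncated subtraction in the
  -- potential exact.
  generalize (2 * P.h + 1) * ∑ v, src v = W at hW
  refine .loop (fun (g : Cfg n m × Option (Fin n)) s => Good I P.Kp P.h P.U g.1 src g.2 ∧
      Rep I g.1 s ∧ Stored P s ∧ s.reg 10 = q ∧ TokenAt g.2 s)
    (fun g => 102 * (2 * (W - g.1.work I) + energy g.1 g.2)) (c, some v)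
    ⟨hc, hr, hs, hq, ht⟩ ?_ ?_ ?_
  · rintro ⟨c, cur⟩ s ⟨hc, hr, hs, hq, ht⟩
    cases cur with
    | none => simp only [TokenAt] at ht; simp only [FitsInt, ht]; omega
    | some v => simp only [TokenAt] at ht; simp only [FitsInt, ht.1]; omega
  · rintro ⟨c, cur⟩ s ⟨hc, hr, hs, hq, ht⟩ hb
    cases cur with
    | none => exact absurd ht hb
    | some v =>
      refine (tokenProgram_wp hZ hc hr hs hq ht).mono ?_
      rintro s' t ⟨c', cur', h1, h2, h3, h4, h5, h6, h7, h8⟩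
      refine ⟨(c', cur'), ⟨h1, h2, h3, h5, h4⟩, ?_⟩
      have hw := hW _ _ h1
      simp only [size, energy] at h7 ⊢
      omega
  · rintro ⟨c', cur⟩ s' t ⟨hc', hr, hs, hq, ht⟩ hb hle
    cases cur with
    | none =>
      refine ⟨c', hc', hr, hs, hq, ?_⟩
      have hw := hW _ _ hc'
      have hw' := hW _ _ hc
      have hl := hc.lab_le v
      simp only [energy, size] at hle
      omega
    | some v =>
      have h15 : s'.reg 15 = 0 := hb
      simp only [TokenAt, h15] at ht
      omega

/-- The number of tokens inserted at `v` among the first `q` tokens. -/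
def Par.source (P : Par n) (q : ℕ) (v : Fin n) : ℕ :=
  ∑ t ∈ Finset.range q, if P.inc[t / P.K]? = some v then 1 else 0

/-- Token number `t` is placed at entry `t / K` of the list of incidences, so every entry receives
exactly `K` tokens. -/
lemma sum_range_mul_div (K V : ℕ) (hK : 0 < K) (g : ℕ → ℕ) :
    ∑ t ∈ Finset.range (K * V), g (t / K) = K * ∑ j ∈ Finset.range V, g j := by
  induction V with
  | zero => simp
  | succ V ih =>
    rw [mul_add_one, Finset.sum_range_add, ih, Finset.sum_range_succ, mul_add]
    congr 1
    calc ∑ x ∈ Finset.range K, g ((K * V + x) / K) = ∑ x ∈ Finset.range K, g V := by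
          refine Finset.sum_congr rfl fun x hx => ?_
          rw [Nat.mul_add_div hK, Nat.div_eq_of_lt (Finset.mem_range.1 hx), add_zero]
      _ = _ := by simp

lemma sum_range_getElem?_eq_count (l : List (Fin n)) (v : Fin n) :
    ∑ j ∈ Finset.range l.length, (if l[j]? = some v then 1 else 0) = l.count v := by
  induction l with
  | nil => simp
  | cons a l ih =>
    rw [List.length_cons, Finset.sum_range_succ']
    simp only [List.getElem?_cons_succ, ih, List.getElem?_cons_zero, Option.some.injEq,
      List.count_cons, beq_iff_eq]

lemma Par.source_eq (P : Par n) (hK : 0 < P.K) (v : Fin n) :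
    P.source (P.K * P.inc.length) v = P.K * P.inc.count v := by
  rw [source, sum_range_mul_div _ _ hK fun j => if P.inc[j]? = some v then 1 else 0,
    sum_range_getElem?_eq_count]

lemma Par.sum_source_le (P : Par n) (q : ℕ) : ∑ v, P.source q v ≤ q := by
  simp only [source]
  rw [Finset.sum_comm]
  calc _ ≤ ∑ t ∈ Finset.range q, 1 := by
        refine Finset.sum_le_sum fun t _ => ?_
        cases h : P.inc[t / P.K]? with
        | none => simp
        | some w => simp
    _ = q := by simp

/-- The potential has two parts: `204` per unit of cursor work still possible, and `102 * (h + 1) +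
40` per token not yet sent, for its initial energy and the overhead. -/
lemma flowProgram_wp (hZ : Large P m Z) (hKp : 1 ≤ P.Kp) (hK : 1 ≤ P.K)
    (hinc : ∀ v ∈ P.inc, I.adj v ≠ []) (hr : Rep I (Cfg.zero n m) s) (hs : Stored P s) :
    WP Z I flowProgram s fun s' t => ∃ c,
      Good I P.Kp P.h P.U c (P.source (P.K * P.inc.length)) none ∧ Rep I c s' ∧
      Stored P s' ∧ t ≤ 1000 * (P.h + 1) * (P.K * P.inc.length) + 20 := by
  have hz := hZ.size
  have hz' := hZ.tokens
  have hW : ∀ c' q cur, q ≤ P.K * P.inc.length → Good I P.Kp P.h P.U c' (P.source q) cur →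
      c'.work I ≤ (2 * P.h + 1) * (P.K * P.inc.length) := fun c' q cur hq hc' =>
    (hc'.work_le hKp).trans (by gcongr; exact (P.sum_source_le q).trans hq)
  have hV : (P.inc.length : ℤ) ≤ P.K * P.inc.length := by
    have := Nat.mul_le_mul_right P.inc.length hK
    rw [one_mul] at this
    exact_mod_cast this
  refine .seq (.assign ?_ ?_)
  · simp only [FitsInt]; omega
  refine .loop (fun (g : ℕ × Cfg n m) s => g.1 ≤ P.K * P.inc.length ∧
      Good I P.Kp P.h P.U g.2 (P.source g.1) none ∧ Rep I g.2 s ∧ Stored P s ∧ s.reg 10 = g.1)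
    (fun g => 204 * ((2 * P.h + 1) * (P.K * P.inc.length) - g.2.work I) +
      (102 * (P.h + 1) + 40) * (P.K * P.inc.length - g.1)) (0, Cfg.zero n m) ?_ ?_ ?_ ?_
  · refine ⟨Nat.zero_le _, ?_, hr.setReg (by decide) (by decide), hs.setReg (by decide), ?_⟩
    · exact Good.zero
    · simp [State.setReg_reg, val]
  · rintro ⟨q, c⟩ s ⟨hq, -, -, hs, h10⟩
    dsimp only at hq h10
    zify at hq
    simp only [FitsInt, val, h10, hs.K, hs.V]
    refine ⟨⟨?_, ?_, ?_⟩, ⟨?_, ?_, ?_⟩, ?_⟩ <;> omega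
  · rintro ⟨q, c⟩ s ⟨hq, hc, hr, hs, h10⟩ hb
    dsimp only at hq hc hr h10
    have hq' : q < P.K * P.inc.length := by
      by_contra h
      simp only [val, h10, hs.K, hs.V] at hb
      rw [if_neg (by zify at h; omega)] at hb
      exact hb rfl
    obtain ⟨d, hd⟩ : ∃ d, q / P.K = d := ⟨_, rfl⟩
    have hdiv : d < P.inc.length := hd ▸ Nat.div_lt_of_lt_mul hq'
    have hqK : ((q : ℤ) / P.K) = d := by rw [← hd]; norm_cast
    have hget := hs.inc _ hdiv
    have hlt := (P.inc[d]).2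
    refine .seq (.assign ?_ (.seq (.assign ?_ (.seq ?_))))
    · simp only [FitsInt, val, h10, hs.K, hqK, hget]
      zify at hq' hdiv hlt
      omega
    · simp only [FitsInt]; omega
    have hg := hc.insert (hinc _ (List.getElem_mem hdiv))
    have hsrc : Function.update (P.source q) P.inc[d]
        (P.source q P.inc[d] + 1) = P.source (q + 1) := by
      ext w
      simp only [Par.source, Finset.sum_range_succ, hd, List.getElem?_eq_getElem hdiv,
        Option.some.injEq]
      by_cases hw : w = P.inc[d]
      · subst hw; simp
      · have hw' : ¬ P.inc[d] = w := fun h => hw h.symm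
        simp only [Function.update_of_ne hw, hw', if_false, add_zero, Par.source]
    rw [hsrc] at hg
    refine (tokenLoop_wp (q := q) hZ hKp hg ((hr.setReg (by decide) (by decide)).setReg
      (by decide) (by decide)) ((hs.setReg (by decide)).setReg (by decide)) ?_ ?_).mono ?_
    · simpa [State.setReg_reg] using h10
    · simp [TokenAt, State.setReg_reg, val, h10, hs.K, hqK, hget]
    · rintro s' t ⟨c', hc', hr', hs', h10', ht⟩
      refine .assign ?_ ⟨(q + 1, c'), ⟨hq', hc', hr'.setReg (by decide) (by decide),
        hs'.setReg (by decide), ?_⟩, ?_⟩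
      · simp only [FitsInt, h10', val]
        zify at hq'
        omega
      · simp [State.setReg_reg, val, h10']
      · have h1 := hW _ _ _ hq hc
        have h2 := hW _ _ _ hq' hc'
        have h3 : P.K * P.inc.length - q = P.K * P.inc.length - (q + 1) + 1 := by omega
        simp only [size]
        have h4 : (102 * (P.h + 1) + 40) * (P.K * P.inc.length - (q + 1) + 1) =
            (102 * (P.h + 1) + 40) * (P.K * P.inc.length - (q + 1)) +
              (102 * (P.h + 1) + 40) := by ring
        rw [h3, h4]
        omega
  · rintro ⟨q, c⟩ s' t ⟨hq, hc, hr, hs, h10⟩ hb ht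
    dsimp only at hq hc hr h10 ht
    have hq' : q = P.K * P.inc.length := by
      by_contra h
      have : q + 1 ≤ P.K * P.inc.length := by omega
      simp only [val, h10, hs.K, hs.V] at hb
      rw [if_pos (by zify at this; omega)] at hb
      exact one_ne_zero hb
    subst hq'
    refine ⟨c, hc, hr, hs, ?_⟩
    simp only [size] at ht ⊢
    have h1 : 204 * ((2 * P.h + 1) * (P.K * P.inc.length) - (Cfg.zero n m).work I) ≤
        204 * ((2 * P.h + 1) * (P.K * P.inc.length)) := by gcongr; omega
    have h2 : (102 * (P.h + 1) + 40) * (P.K * P.inc.length - 0) =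
        (102 * (P.h + 1) + 40) * (P.K * P.inc.length) := by simp
    nlinarith [Nat.zero_le (P.h * (P.K * P.inc.length)), Nat.zero_le (P.K * P.inc.length)]

end Flow
end LBS

namespace LBS

/-! ## Finding and printing a sparse level -/

section Scan

open LBS.Expr

/-- Run `body` for every touched node, with the node in register `14`. -/
def forTouched (body : Program) : Program :=
  .seq (.assign 23 (.const 0)) (.loop (.le (.add (.var 23) (.const 1)) (.var 18))
    (.seq (.assign 14 (.get 5 (.var 23))) (.seq body (.assign 23 (.add (.var 23) (.const 1))))))

def countProgram : Program :=
  .ite (.le (.var 20) (.get 1 (.var 14)))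
    (forEdges 14 12 (.seq (.assign 21 (.add (.var 21) (.const 1)))
      (.ite (.le (.var 20) (.get 1 (.sub (.add (.src (.var 12)) (.tgt (.var 12))) (.var 14))))
        .skip (.assign 22 (.add (.var 22) (.const 1))))))
    .skip

def levelProgram : Program :=
  .seq (.assign 20 (.add (.var 7) (.const 1))) (.loop (.le (.var 24) (.const 0))
    (.seq (.assign 20 (.sub (.var 20) (.const 1))) (.seq (.assign 21 (.const 0))
    (.seq (.assign 22 (.const 0)) (.seq (forTouched countProgram)
      (.assign 24 (.le (.mul (.var 3) (.var 22)) (.mul (.const 3) (.var 21)))))))))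

def outputProgram : Program :=
  .seq (forTouched (.ite (.le (.var 20) (.get 1 (.var 14)))
    (.seq (.put 0 (.var 1) (.var 14)) (.assign 1 (.add (.var 1) (.const 1)))) .skip))
    (.assign 0 (.const 1))

variable {n m : ℕ} {I : Input n m} {P : Par n} {Z : ℤ} {c : Cfg n m} {s : State}
  {src : Fin n → ℕ} {v : Fin n} {q : ℤ}

lemma WP.forTouched {Q : State → ℕ → Prop} {body : Program} (T : Fin n → ℕ) (l : List (Fin n))
    (Inv : ℕ → State → Prop) (hn : (n : ℤ) ≤ Z) (hlZ : (l.length : ℤ) + 1 ≤ Z) (h0 : Inv 0 s)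
    (hset : ∀ t s z, Inv t s → Inv t (s.setReg 23 z))
    (hset' : ∀ t s z, Inv t s → Inv t (s.setReg 14 z))
    (hlen : ∀ t s, Inv t s → s.reg 18 = l.length)
    (harr : ∀ t s, Inv t s → ∀ k : ℕ, ∀ hk : k < l.length, s.arr 5 k = (l[k] : ℕ))
    (hbody : ∀ i (hi : i < l.length) s, Inv i s → s.reg 14 = (l[i] : ℕ) →
      WP Z I body s fun s' τ => Inv (i + 1) s' ∧ s'.reg 23 = s.reg 23 ∧ τ ≤ T l[i])
    (hQ : ∀ s' τ, Inv l.length s' → τ ≤ (l.map fun v => T v + 15).sum + 15 → Q s' τ) :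
    WP Z I (LBS.forTouched body) s Q := by
  refine .seq (.assign ?_ ?_)
  · simp only [FitsInt]; omega
  refine .loop (fun i s => i ≤ l.length ∧ Inv i s ∧ s.reg 23 = i)
    (fun i => ((l.drop i).map fun v => T v + 15).sum) 0 ?_ ?_ ?_ ?_
  · exact ⟨Nat.zero_le _, hset _ _ _ h0, by simp [State.setReg_reg, val]⟩
  · rintro i s ⟨hi, hI, h23⟩
    simp only [FitsInt, val, h23, hlen _ _ hI]; omega
  · rintro i s ⟨hi, hI, h23⟩ hb
    have hi' : i < l.length := by
      by_contra h
      simp only [val, h23, hlen _ _ hI] at hb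
      rw [if_neg (by omega)] at hb
      exact hb rfl
    have hget := harr _ _ hI i hi'
    have hlt := (l[i]).2
    refine .seq (.assign ?_ (.seq ?_))
    · simp only [FitsInt, val, h23, hget]; omega
    refine (hbody i hi' _ (hset' _ _ _ hI) ?_).mono ?_
    · simp [State.setReg_reg, val, h23, hget]
    rintro s' τ ⟨hI', h23', hτ⟩
    have h23' : s'.reg 23 = i := by simpa [State.setReg_reg, h23] using h23'
    refine .assign ?_ ⟨i + 1, ⟨hi', hset _ _ _ hI', ?_⟩, ?_⟩
    · simp only [FitsInt, val, h23']; omega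
    · simp [State.setReg_reg, val, h23']
    · rw [List.drop_eq_getElem_cons hi', List.map_cons, List.sum_cons]
      simp only [size]
      omega
  · rintro i s' t ⟨hi, hI, h23⟩ hb ht
    have hi' : i = l.length := by
      by_contra h
      simp only [val, h23, hlen _ _ hI] at hb
      rw [if_pos (by omega)] at hb
      exact one_ne_zero hb
    subst hi'
    refine hQ _ _ hI ?_
    simp only [List.drop_zero, List.drop_length, size] at ht ⊢
    simp only [List.map_nil, List.sum_nil] at ht
    omega

/-- Levels `i ≥ 1` consist of touched nodes, so a scan of the touched list sees them completely. -/
lemma sum_touched {cur : Option (Fin n)} (hc : Good I P.Kp P.h P.U c src cur) {i : ℕ}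
    (hi : 1 ≤ i) (g : Fin n → ℕ) :
    (c.touched.map fun v => if i ≤ c.lab v then g v else 0).sum = ∑ v ∈ c.level i, g v := by
  rw [← List.sum_toFinset _ hc.touched_nodup, ← Finset.sum_filter]
  refine Finset.sum_congr ?_ fun _ _ => rfl
  ext v
  simp only [Finset.mem_filter, List.mem_toFinset, hc.mem_touched, Cfg.mem_level]
  omega

/-- The number of edges from `v` to nodes of label less than `i`. -/
def cutDeg (I : Input n m) (c : Cfg n m) (i : ℕ) (v : Fin n) (t : ℕ) : ℕ :=
  (((I.adj v).take t).map fun e => if I.other v e ∈ c.level i then 0 else 1).sum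

lemma cutDeg_le (I : Input n m) (c : Cfg n m) (i : ℕ) (v : Fin n) (t : ℕ) :
    cutDeg I c i v t ≤ t := by
  calc cutDeg I c i v t ≤ (((I.adj v).take t).map fun _ => 1).sum := by
        refine List.sum_le_sum fun e _ => ?_
        split_ifs <;> simp
    _ ≤ t := by simp

/-- The state of the program in the course of a scan of level `i`. -/
structure Scan (I : Input n m) (P : Par n) (c : Cfg n m) (i : ℕ) (k : ℤ) (v x : ℕ) (s : State) :
    Prop where
  rep : Rep I c s
  stored : Stored P s
  level : s.reg 20 = i
  idx : s.reg 23 = k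
  vol : s.reg 21 = v
  cut : s.reg 22 = x
  out : s.reg 1 = 0

lemma Scan.setReg {i v x : ℕ} {k : ℤ} (h : Scan I P c i k v x s) {r : ℕ} {z : ℤ} (hr : 9 < r)
    (h1 : r ≠ 18) (h2 : r ≠ 19) (h3 : r ≠ 20) (h4 : r ≠ 21) (h5 : r ≠ 22) (h6 : r ≠ 23) :
    Scan I P c i k v x (s.setReg r z) := by
  refine ⟨h.rep.setReg h1 h2, h.stored.setReg (Or.inr hr), ?_, ?_, ?_, ?_, ?_⟩ <;>
    simp only [State.setReg_reg] <;> rw [if_neg (by omega)]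
  exacts [h.level, h.idx, h.vol, h.cut, h.out]

lemma countProgram_wp {i v x : ℕ} {k : ℤ} {w : Fin n} {cur : Option (Fin n)} (hZ : Large P m Z)
    (hc : Good I P.Kp P.h P.U c src cur) (hi : i ≤ P.h) (h : Scan I P c i k v x s)
    (hw : s.reg 14 = (w : ℕ)) (hv : (v : ℤ) + (I.adj w).length ≤ Z ∨ ¬ i ≤ c.lab w)
    (hx : x ≤ v) :
    WP Z I countProgram s fun s' t =>
      Scan I P c i k (v + if i ≤ c.lab w then (I.adj w).length else 0)
        (x + if i ≤ c.lab w then cutDeg I c i w (I.adj w).length else 0) s' ∧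
      t ≤ 40 * ((I.adj w).length + 1) + 10 := by
  have hz := hZ.size
  have hlw := hc.lab_le w
  have hl := h.rep.lab w
  have hwn := w.2
  have hlev := h.level
  refine .ite ?_ (fun hb => ?_) (fun hb => .skip ?_)
  · simp only [FitsInt, val, hw, h.level, hl]; omega
  · have hle : i ≤ c.lab w := by
      by_contra h'
      simp only [val, hw, hlev, hl] at hb
      rw [if_neg (by omega)] at hb
      exact hb rfl
    replace hv : (v : ℤ) + (I.adj w).length ≤ Z := by
      rcases hv with hv | hv
      · exact hv
      · exact absurd hle hv
    rw [if_pos hle, if_pos hle]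
    refine .forEdges (T := 30) w (fun t s => Scan I P c i k (v + t) (x + cutDeg I c i w t) s)
      (by decide) (by omega) (by omega) (by omega) hw (by simpa [cutDeg] using h) ?_ ?_ ?_
    · intro t s z h
      exact h.setReg (by decide) (by decide) (by decide) (by decide) (by decide) (by decide)
        (by decide)
    · intro t ht s h hw he
      generalize hed : (I.adj w)[t] = e at he
      have hem := e.2
      have hadj : e ∈ I.adj w := hed ▸ List.getElem_mem ht
      have hsrc := (I.src e).2
      have htgt := (I.tgt e).2
      have hcd := cutDeg_le I c i w t
      have hcd' : cutDeg I c i w (t + 1) =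
          cutDeg I c i w t + if I.other w e ∈ c.level i then 0 else 1 := by
        rw [cutDeg, cutDeg, List.take_add_one, List.getElem?_eq_getElem ht, hed]
        simp
      have hoth : ((I.src e : ℕ) : ℤ) + (I.tgt e : ℕ) - (w : ℕ) = (I.other w e : ℕ) := by
        rw [I.mem_adj_iff] at hadj
        have hst := I.src_ne_tgt e
        rw [Input.other]
        rcases hadj with rfl | rfl
        · simp
        · simp [hst]
      refine .seq (.assign ?_ ?_)
      · simp only [FitsInt, val, h.vol]; push_cast; omega
      have h' : Scan I P c i k (v + (t + 1)) (x + cutDeg I c i w t)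
          (s.setReg 21 (val I s (.add (.var 21) (.const 1)))) := by
        refine ⟨h.rep.setReg (by decide) (by decide), h.stored.setReg (by decide), ?_, ?_, ?_, ?_,
          ?_⟩
        · simpa [State.setReg_reg] using h.level
        · simpa [State.setReg_reg] using h.idx
        · simp [State.setReg_reg, val, h.vol]; ring
        · simpa [State.setReg_reg] using h.cut
        · simpa [State.setReg_reg] using h.out
      have hw' : (s.setReg 21 (val I s (.add (.var 21) (.const 1)))).reg 14 = (w : ℕ) := by
        simpa [State.setReg_reg] using hw
      have he' : (s.setReg 21 (val I s (.add (.var 21) (.const 1)))).reg 12 = (e : ℕ) := by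
        simpa [State.setReg_reg] using he
      generalize s.setReg 21 (val I s (.add (.var 21) (.const 1))) = s at h' hw' he'
      have hlo := h'.rep.lab (I.other w e)
      have hlo' := hc.lab_le (I.other w e)
      have ho := (I.other w e).2
      refine .ite ?_ (fun hb => .skip ⟨?_, hw', he', ?_⟩)
        (fun hb => .assign ?_ ⟨?_, ?_, ?_, ?_⟩)
      · simp only [FitsInt, val, h'.level, hw', he', decode_coe, Option.map_some, encode_some,
          hoth, hlo]
        omega
      · have hmem : I.other w e ∈ c.level i := by
          rw [Cfg.mem_level]
          by_contra h''
          simp only [val, h'.level, hw', he', decode_coe, Option.map_some, encode_some,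
            hoth, hlo] at hb
          rw [if_neg (by omega)] at hb
          exact hb rfl
        rw [hcd', if_pos hmem]
        exact h'
      · simp [size]
      · simp only [FitsInt, val, h'.cut]; push_cast; omega
      · have hmem : I.other w e ∉ c.level i := by
          rw [Cfg.mem_level]
          intro h''
          simp only [val, h'.level, hw', he', decode_coe, Option.map_some, encode_some,
            hoth, hlo] at hb
          rw [if_pos (by omega)] at hb
          exact one_ne_zero hb
        rw [hcd', if_neg hmem]
        refine ⟨h'.rep.setReg (by decide) (by decide), h'.stored.setReg (by decide), ?_, ?_, ?_,
          ?_, ?_⟩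
        · simpa [State.setReg_reg] using h'.level
        · simpa [State.setReg_reg] using h'.idx
        · simpa [State.setReg_reg] using h'.vol
        · simp [State.setReg_reg, val, h'.cut]; ring
        · simpa [State.setReg_reg] using h'.out
      · simpa [State.setReg_reg] using hw'
      · simpa [State.setReg_reg] using he'
      · simp [size]
    · intro s' τ h' _ hτ
      refine ⟨h', ?_⟩
      simp only [size]
      omega
  · have hle : ¬ i ≤ c.lab w := by
      intro h'
      simp only [val, hw, hlev, hl] at hb
      rw [if_pos (by omega)] at hb
      exact one_ne_zero hb
    simp only [if_neg hle, add_zero]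
    refine ⟨h, ?_⟩
    simp only [size]
    omega

lemma sum_map_take_le (l : List (Fin n)) (g : Fin n → ℕ) (i : ℕ) :
    ((l.take i).map g).sum ≤ (l.map g).sum := by
  conv_rhs => rw [← List.take_append_drop i l, List.map_append, List.sum_append]
  omega

lemma sum_map_take_succ (l : List (Fin n)) (g : Fin n → ℕ) {i : ℕ} (hi : i < l.length) :
    ((l.take (i + 1)).map g).sum = ((l.take i).map g).sum + g l[i] := by
  rw [List.take_add_one, List.getElem?_eq_getElem hi, List.map_append, List.sum_append]
  simp

/-- Touched nodes have positive degree and are saturated, so both per-edge and per-node costs of a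
scan are paid by the number `M` of tokens. -/
lemma sum_map_add_const_le (hc : Good I P.Kp P.h P.U c src none) (hKp : 1 ≤ P.Kp) (a b : ℕ)
    {M : ℕ} (hM : ∑ v, src v ≤ M) :
    (c.touched.map fun v => a * ((I.adj v).length + 1) + b).sum ≤ (2 * a + b) * M := by
  have h1 : (c.touched.map fun v => a * ((I.adj v).length + 1) + b).sum =
      ∑ v ∈ c.level 1, (a * ((I.adj v).length + 1) + b) := by
    rw [← sum_touched hc le_rfl]
    congr 1
    refine List.map_congr_left fun v hv => ?_
    rw [hc.mem_touched] at hv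
    rw [if_pos (by omega)]
  have h2 := hc.vol_level_le (i := 1) le_rfl
  calc _ = ∑ v ∈ c.level 1, (a * ((I.adj v).length + 1) + b) := h1
    _ ≤ ∑ v ∈ c.level 1, (2 * a + b) * deg I.G v := by
        refine Finset.sum_le_sum fun v hv => ?_
        rw [Cfg.mem_level] at hv
        have h3 : 1 ≤ (I.adj v).length := List.length_pos_iff.2 (hc.adj_lab v (by omega))
        rw [I.deg_eq]
        nlinarith
    _ = (2 * a + b) * vol I.G (c.level 1) := by rw [vol, Finset.mul_sum]
    _ ≤ (2 * a + b) * M := by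
        gcongr
        nlinarith

lemma vol_level_le_of_le (hc : Good I P.Kp P.h P.U c src none) (hKp : 1 ≤ P.Kp) {M i : ℕ}
    (hM : ∑ v, src v ≤ M) (hi : 1 ≤ i) : vol I.G (c.level i) ≤ M := by
  have := hc.vol_level_le hi
  nlinarith

lemma scan_wp {i : ℕ} (hZ : Large P m Z) (hKp : 1 ≤ P.Kp)
    (hc : Good I P.Kp P.h P.U c src none) (hsrc : ∑ v, src v ≤ P.K * P.inc.length)
    (hi : 1 ≤ i) (hih : i ≤ P.h) (h : Scan I P c i (s.reg 23) 0 0 s) :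
    WP Z I (forTouched countProgram) s fun s' t =>
      (∃ k, Scan I P c i k (vol I.G (c.level i)) (cutSize I.G (c.level i)) s') ∧
      t ≤ 200 * (P.K * P.inc.length) + 15 := by
  have hz := hZ.size
  have hz' := hZ.tokens
  have htn : c.touched.length ≤ n := by simpa using hc.touched_nodup.length_le_card
  set g : Fin n → ℕ := fun v => if i ≤ c.lab v then (I.adj v).length else 0 with hg
  set g' : Fin n → ℕ := fun v => if i ≤ c.lab v then cutDeg I c i v (I.adj v).length else 0
    with hg'
  have hvol : (c.touched.map g).sum = vol I.G (c.level i) := by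
    rw [hg, sum_touched hc hi, vol]
    exact Finset.sum_congr rfl fun v _ => (I.deg_eq v).symm
  have hcut : (c.touched.map g').sum = cutSize I.G (c.level i) := by
    rw [hg', sum_touched hc hi, I.cutSize_eq_sum_adj]
    refine Finset.sum_congr rfl fun v _ => ?_
    rw [cutDeg, List.take_length]
  have hvM := vol_level_le_of_le hc hKp hsrc hi
  refine .forTouched (fun v => 40 * ((I.adj v).length + 1) + 10) c.touched
    (fun t s => ∃ k, Scan I P c i k ((c.touched.take t).map g).sum ((c.touched.take t).map g').sum s)
    (by omega) (by omega) ⟨_, by simpa using h⟩ ?_ ?_ ?_ ?_ ?_ ?_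
  · rintro t s z ⟨k, h⟩
    refine ⟨z, h.rep.setReg (by decide) (by decide), h.stored.setReg (by decide), ?_, ?_, ?_, ?_,
      ?_⟩
    · simpa [State.setReg_reg] using h.level
    · simp [State.setReg_reg]
    · simpa [State.setReg_reg] using h.vol
    · simpa [State.setReg_reg] using h.cut
    · simpa [State.setReg_reg] using h.out
  · rintro t s z ⟨k, h⟩
    exact ⟨k, h.setReg (by decide) (by decide) (by decide) (by decide) (by decide) (by decide)
      (by decide)⟩
  · rintro t s ⟨k, h⟩
    exact h.rep.len
  · rintro t s ⟨k, h⟩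
    exact h.rep.touched
  · rintro t ht s ⟨k, h⟩ hw
    have h1 := sum_map_take_succ c.touched g ht
    have h2 := sum_map_take_succ c.touched g' ht
    have h3 := sum_map_take_le c.touched g (t + 1)
    refine (countProgram_wp hZ hc hih h hw ?_ ?_).mono ?_
    · by_cases hle : i ≤ c.lab c.touched[t]
      · left
        have h4 : g c.touched[t] = (I.adj c.touched[t]).length := if_pos hle
        rw [h4] at h1
        omega
      · exact Or.inr hle
    · refine List.sum_le_sum fun v _ => ?_
      simp only [hg, hg']
      split_ifs
      · exact cutDeg_le _ _ _ _ _
      · exact le_rfl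
    · rintro s' τ ⟨h', hτ⟩
      refine ⟨⟨k, ?_⟩, h'.idx.trans h.idx.symm, hτ⟩
      rw [h1, h2]
      exact h'
  · rintro s' τ ⟨k, h'⟩ hτ
    rw [List.take_length, hvol, hcut] at h'
    refine ⟨⟨k, h'⟩, ?_⟩
    have := sum_map_add_const_le hc hKp 40 (10 + 15) hsrc
    simp only [← add_assoc] at this
    omega

lemma levelProgram_wp (hZ : Large P m Z) (hKp : 1 ≤ P.Kp)
    (hc : Good I P.Kp P.h P.U c src none) (hsrc : ∑ v, src v ≤ P.K * P.inc.length)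
    (hr : Rep I c s) (hs : Stored P s) (h1 : s.reg 1 = 0) (h24 : s.reg 24 = 0)
    (hex : ∃ i, 1 ≤ i ∧ i ≤ P.h ∧ P.b * cutSize I.G (c.level i) ≤ 3 * vol I.G (c.level i)) :
    WP Z I levelProgram s fun s' t => ∃ i, 1 ≤ i ∧ i ≤ P.h ∧
      P.b * cutSize I.G (c.level i) ≤ 3 * vol I.G (c.level i) ∧ Rep I c s' ∧ Stored P s' ∧
      s'.reg 20 = i ∧ s'.reg 1 = 0 ∧ t ≤ (200 * (P.K * P.inc.length) + 60) * (P.h + 2) := by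
  obtain ⟨i₀, hi₀, hi₀h, hi₀s⟩ := hex
  have hz := hZ.size
  have hh := hs.h
  refine .seq (.assign ?_ ?_)
  · simp only [FitsInt, val, hh]; omega
  -- The ghost flag says whether a sparse level has been found. Until then the downward search is
  -- still above the known sparse level `i₀`, so it cannot reach label `0`.
  refine .loop (fun (g : ℕ × Bool) s => 1 ≤ g.1 ∧ g.1 ≤ P.h + 1 ∧ Rep I c s ∧ Stored P s ∧
      s.reg 20 = g.1 ∧ s.reg 1 = 0 ∧ s.reg 24 = (if g.2 then 1 else 0) ∧ (g.2 = false → i₀ < g.1) ∧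
      (g.2 = true → g.1 ≤ P.h ∧
        P.b * cutSize I.G (c.level g.1) ≤ 3 * vol I.G (c.level g.1)))
    (fun g => (200 * (P.K * P.inc.length) + 60) * g.1) (P.h + 1, false) ?_ ?_ ?_ ?_
  · refine ⟨by simp, le_rfl, hr.setReg (by decide) (by decide), hs.setReg (by decide), ?_, ?_, ?_,
      ?_, by simp⟩
    · simp [State.setReg_reg, val, hh]
    · simpa [State.setReg_reg] using h1
    · simpa [State.setReg_reg] using h24
    · intro _; dsimp only; omega
  · rintro ⟨i, f⟩ s ⟨_, _, _, _, _, _, h24, _⟩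
    dsimp only at h24
    simp only [FitsInt, h24]
    split_ifs <;> omega
  · rintro ⟨i, f⟩ s ⟨hi1, hih, hr, hs, h20, h1, h24, hf, -⟩ hb
    dsimp only at hi1 hih h20 h24 hf
    have hf0 : f = false := by
      cases f with
      | false => rfl
      | true => simp [val, h24] at hb
    have hi2 := hf hf0
    refine .seq (.assign ?_ (.seq (.assign ?_ (.seq (.assign ?_ (.seq ?_))))))
    · simp only [FitsInt, val, h20]; omega
    · simp only [FitsInt]; omega
    · simp only [FitsInt]; omega
    refine (scan_wp (i := i - 1) hZ hKp hc hsrc (by omega) (by omega)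
      ⟨((hr.setReg (by decide) (by decide)).setReg (by decide) (by decide)).setReg
        (by decide) (by decide), ((hs.setReg (by decide)).setReg (by decide)).setReg (by decide),
        ?_, rfl, ?_, ?_, ?_⟩).mono ?_
    · simp [State.setReg_reg, val, h20, Nat.cast_sub hi1]
    · simp [State.setReg_reg, val]
    · simp [State.setReg_reg, val]
    · simpa [State.setReg_reg] using h1
    rintro s' t ⟨⟨k, h⟩, ht⟩
    have hvM := vol_level_le_of_le hc hKp hsrc (i := i - 1) (by omega)
    -- This is needed only to see that the product of `b` and the cut size fits into a word.
    have hcv : cutSize I.G (c.level (i - 1)) ≤ vol I.G (c.level (i - 1)) := by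
      rw [I.cutSize_eq_sum, I.vol_eq_sum]
      refine Finset.sum_le_sum fun e _ => ?_
      split_ifs <;> simp_all
    have hscan : ∀ x y : ℕ, x ≤ P.K * P.inc.length → y ≤ P.K * P.inc.length →
        (P.b * x : ℤ) ≤ Z ∧ (3 * y : ℤ) ≤ Z := by
      intro x y hx hy
      have h0 := hZ.scan
      have hx' : P.b * x ≤ P.b * (P.K * P.inc.length) := Nat.mul_le_mul_left _ hx
      zify at hx' hy
      have h2 : (0 : ℤ) ≤ P.b * (P.K * P.inc.length) := by positivity
      constructor <;> nlinarith
    obtain ⟨hs1, hs2⟩ := hscan _ _ (hcv.trans hvM) hvM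
    have hz' := hZ.tokens
    have hval : (Expr.le (.mul (.var 3) (.var 22)) (.mul (.const 3) (.var 21))).val I s' =
        if decide (P.b * cutSize I.G (c.level (i - 1)) ≤ 3 * vol I.G (c.level (i - 1))) then 1
        else 0 := by
      simp only [val, h.stored.b, h.cut, h.vol, decide_eq_true_eq]
      congr 1
      exact propext (by exact_mod_cast Iff.rfl)
    refine .assign ?_ ⟨(i - 1, decide (P.b * cutSize I.G (c.level (i - 1)) ≤
      3 * vol I.G (c.level (i - 1)))), ⟨by dsimp only; omega, by dsimp only; omega,
        h.rep.setReg (by decide) (by decide), h.stored.setReg (by decide), ?_, ?_, ?_, ?_, ?_⟩, ?_⟩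
    · have hb := h.stored.b
      simp only [FitsInt, val, hb, h.cut, h.vol]
      have h0 : (0 : ℤ) ≤ P.b * cutSize I.G (c.level (i - 1)) := by positivity
      refine ⟨⟨?_, ?_, ?_⟩, ⟨?_, ?_, ?_⟩, ?_⟩ <;> omega
    · simpa [State.setReg_reg] using h.level
    · simpa [State.setReg_reg] using h.out
    · rw [hval]; simp [State.setReg_reg]
    · intro hd
      dsimp only at hd ⊢
      simp only [decide_eq_false_iff_not] at hd
      have : i₀ ≠ i - 1 := by rintro rfl; exact hd hi₀s
      omega
    · intro hd
      dsimp only at hd ⊢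
      exact ⟨by omega, by simpa using hd⟩
    · simp only [size]
      have h3 : i = i - 1 + 1 := by omega
      rw [h3, Nat.mul_add _ (i - 1) 1, Nat.add_sub_cancel]
      omega
  · rintro ⟨i, f⟩ s' t ⟨hi1, hih, hr, hs, h20, h1, h24, -, hf⟩ hb ht
    dsimp only at hi1 hih h20 h24 hf ht
    have hf1 : f = true := by
      cases f with
      | true => rfl
      | false => simp [val, h24] at hb
    obtain ⟨h2, h3⟩ := hf hf1
    refine ⟨i, hi1, h2, h3, hr, hs, h20, h1, ?_⟩
    simp only [size] at ht ⊢
    have h4 : (200 * (P.K * P.inc.length) + 60) * (P.h + 2) =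
      (200 * (P.K * P.inc.length) + 60) * (P.h + 1) + (200 * (P.K * P.inc.length) + 60) := by ring
    omega

lemma Rep.setArr_zero (hr : Rep I c s) (i z : ℤ) : Rep I c (s.setArr 0 i z) := by
  refine ⟨fun v => ?_, fun e => ?_, fun v => ?_, fun v => ?_, hr.len, fun k hk => ?_, hr.dead⟩ <;>
    simp only [State.setArr_arr] <;> rw [if_neg (by simp)]
  exacts [hr.lab v, hr.flow e, hr.pos v, hr.cnt v, hr.touched k hk]

lemma outputProgram_wp (hZ : Large P m Z) (hKp : 1 ≤ P.Kp)
    (hc : Good I P.Kp P.h P.U c src none) (hsrc : ∑ v, src v ≤ P.K * P.inc.length)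
    (hr : Rep I c s) {i : ℕ} (h20 : s.reg 20 = i) (h1 : s.reg 1 = 0) (hi : 1 ≤ i) (hih : i ≤ P.h) :
    WP Z I outputProgram s fun s' t => Outputs s' (c.level i) ∧
      t ≤ 100 * (P.K * P.inc.length) + 30 := by
  have hz := hZ.size
  have htn : c.touched.length ≤ n := by simpa using hc.touched_nodup.length_le_card
  refine .seq (.forTouched (fun _ => 20) c.touched
    (fun t s => Rep I c s ∧ s.reg 20 = i ∧
      s.reg 1 = ((c.touched.take t).filter (i ≤ c.lab ·)).length ∧
      ∀ k : ℕ, ∀ hk : k < ((c.touched.take t).filter (i ≤ c.lab ·)).length,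
        s.arr 0 k = (((c.touched.take t).filter (i ≤ c.lab ·))[k] : ℕ))
    (by omega) (by omega) ⟨hr, h20, by simpa using h1, by simp⟩ ?_ ?_ ?_ ?_ ?_ ?_)
  · rintro t s z ⟨h1, h2, h3, h4⟩
    refine ⟨h1.setReg (by decide) (by decide), ?_, ?_, h4⟩
    · simpa [State.setReg_reg] using h2
    · simpa [State.setReg_reg] using h3
  · rintro t s z ⟨h1, h2, h3, h4⟩
    refine ⟨h1.setReg (by decide) (by decide), ?_, ?_, h4⟩
    · simpa [State.setReg_reg] using h2
    · simpa [State.setReg_reg] using h3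
  · rintro t s h
    exact h.1.len
  · rintro t s h
    exact h.1.touched
  · rintro t ht s ⟨hr, h20, h1, h0⟩ hw
    have hl := hr.lab c.touched[t]
    have hlw := hc.lab_le c.touched[t]
    have hwn := (c.touched[t]).2
    have hlen : ((c.touched.take t).filter (i ≤ c.lab ·)).length ≤ n :=
      (List.length_filter_le _ _).trans ((List.length_take_le _ _).trans (by omega))
    have hsucc : (c.touched.take (t + 1)).filter (i ≤ c.lab ·) =
        (c.touched.take t).filter (i ≤ c.lab ·) ++
          if i ≤ c.lab c.touched[t] then [c.touched[t]] else [] := by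
      rw [List.take_add_one, List.getElem?_eq_getElem ht, List.filter_append]
      congr 1
      simp [List.filter_cons]
    rw [hsucc]
    generalize (c.touched.take t).filter (i ≤ c.lab ·) = l at *
    generalize c.touched[t] = w at *
    refine .ite ?_ (fun hb => .seq (.put ?_ ?_ (.assign ?_ ?_))) (fun hb => .skip ?_)
    · simp only [FitsInt, val, hw, h20, hl]; omega
    · simp only [FitsInt, h1]; omega
    · simp only [FitsInt, hw]; omega
    · simp only [FitsInt, State.setArr_reg, val, h1]; omega
    · have hle : i ≤ c.lab w := by
        by_contra h'
        simp only [val, hw, h20, hl] at hb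
        rw [if_neg (by omega)] at hb
        exact hb rfl
      simp only [if_pos hle]
      refine ⟨⟨(hr.setArr_zero _ _).setReg (by decide) (by decide), ?_, ?_, ?_⟩, ?_, ?_⟩
      · simpa [State.setReg_reg, State.setArr_reg] using h20
      · simp [State.setReg_reg, State.setArr_reg, val, h1]
      · intro k hk
        simp only [State.setReg_arr, State.setArr_arr, val, h1, hw]
        by_cases hk' : k < l.length
        · rw [if_neg (by omega), List.getElem_append_left hk', h0 k hk']
        · obtain rfl : k = l.length := by simp at hk; omega
          simp
      · simp [State.setReg_reg, State.setArr_reg]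
      · simp [size]
    · have hle : ¬ i ≤ c.lab w := by
        intro h'
        simp only [val, hw, h20, hl] at hb
        rw [if_pos (by omega)] at hb
        exact one_ne_zero hb
      simp only [if_neg hle, List.append_nil]
      exact ⟨⟨hr, h20, h1, h0⟩, trivial, by simp [size]⟩
  · rintro s' τ ⟨hr, h20, h1, h0⟩ hτ
    refine .assign ?_ ⟨⟨?_, (c.touched.filter (i ≤ c.lab ·)), ?_, ?_, ?_, ?_⟩, ?_⟩
    · simp only [FitsInt]; omega
    · simp [State.setReg_reg, val]
    · exact hc.touched_nodup.filter _
    · ext v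
      simp only [List.mem_toFinset, List.mem_filter, hc.mem_touched, Cfg.mem_level,
        decide_eq_true_eq]
      omega
    · rw [List.take_length] at h1
      simpa [State.setReg_reg] using h1
    · intro k hk
      have := h0 k (by rw [List.take_length]; exact hk)
      simpa [State.setReg_arr] using this
    · have := sum_map_add_const_le (a := 0) (b := 35) hc hKp hsrc
      simp only [zero_mul, zero_add, mul_zero] at this
      simp only [Nat.reduceAdd] at hτ
      simp only [size]
      omega

end Scan
end LBS

namespace LBS

/-! ## Parameters -/

section Parameters

open LBS.Expr

def scaleProgram : Program :=
  .seq (.seq (.assign 2 (.const 1))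
    (.loop (.sub (.const 1) (.leSigma (.const 1) (.var 2))) (.assign 2 (.add (.var 2) (.const 1)))))
  (.seq (.seq (.assign 3 (.const 1))
    (.loop (.sub (.const 1) (.leAlpha (.const 1) (.var 3))) (.assign 3 (.add (.var 3) (.const 1)))))
  (.seq (.assign 3 (.mul (.const 4) (.var 3)))
  (.seq (.assign 4 (.mul (.const 6) (.mul (.var 2) (.var 2))))
  (.seq (.seq (.assign 5 (.const 0))
    (.loop (.leSigma (.add (.var 5) (.const 1)) (.var 4)) (.assign 5 (.add (.var 5) (.const 1)))))
  (.assign 5 (.sub (.var 5) (.const 1)))))))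

def collectProgram : Program :=
  .loop (.le (.const 0) (.nodeA (.var 10))) (.seq (.assign 11 (.nodeA (.var 10)))
    (.seq (forEdges 11 12 (.seq (.put 6 (.var 6) (.var 11))
      (.assign 6 (.add (.var 6) (.const 1)))))
    (.assign 10 (.add (.var 10) (.const 1)))))

/-- Each doubling of register `8` adds `b` to the top label, which produces `b * L + 1` without
computing a logarithm. -/
def heightProgram : Program :=
  .seq (.assign 7 (.const 1)) (.seq (.assign 8 (.const 1))
    (.seq (.loop (.le (.var 8) (.mul (.var 4) (.var 6)))
      (.seq (.assign 8 (.mul (.const 2) (.var 8))) (.assign 7 (.add (.var 7) (.var 3)))))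
    (.assign 9 (.mul (.var 4) (.var 3)))))

variable {n m : ℕ} {I : Input n m} {Z : ℤ} {s : State}

lemma State.setReg_setReg (s : State) (x : ℕ) (z z' : ℤ) :
    (s.setReg x z).setReg x z' = s.setReg x z' := by simp [State.setReg]

lemma WP.countUp {x : ℕ} {b : Expr} {k N : ℕ} {Q : State → ℕ → Prop} (hkN : k ≤ N)
    (hNZ : (N : ℤ) + 1 ≤ Z) (hb : ∀ j : ℕ, k ≤ j → j ≤ N → b.FitsInt Z I (s.setReg x j))
    (hval : ∀ j : ℕ, k ≤ j → j ≤ N → (b.val I (s.setReg x j) ≠ 0 ↔ j < N))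
    (hQ : ∀ t, t ≤ (b.size + 10) * (N + 1) → Q (s.setReg x N) t) :
    WP Z I (.seq (.assign x (.const k)) (.loop b (.assign x (.add (.var x) (.const 1))))) s Q := by
  refine .seq (.assign ?_ ?_)
  · simp only [FitsInt]; omega
  refine .loop (fun j s' => k ≤ j ∧ j ≤ N ∧ s' = s.setReg x j)
    (fun j => (b.size + 5) * (N - j)) k ⟨le_rfl, hkN, rfl⟩ ?_ ?_ ?_
  · rintro j _ ⟨h1, h2, rfl⟩
    exact hb j h1 h2
  · rintro j _ ⟨h1, h2, rfl⟩ h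
    have h3 := (hval j h1 h2).1 h
    refine .assign ?_ ⟨j + 1, ⟨by omega, h3, ?_⟩, ?_⟩
    · simp only [FitsInt, val, State.setReg_reg, if_true]; omega
    · simp [val, State.setReg_setReg, State.setReg_reg]
    · have : N - j = N - (j + 1) + 1 := by omega
      rw [this, Nat.mul_add _ (N - (j + 1)) 1]
      simp only [size]
      omega
  · rintro j _ t ⟨h1, h2, rfl⟩ h ht
    have h3 : j = N := by
      by_contra h4
      exact (hval j h1 h2).2 (by omega) h
    subst h3
    refine hQ _ ?_
    have h4 : (b.size + 5) * (j - k) ≤ (b.size + 5) * j := Nat.mul_le_mul_left _ (Nat.sub_le _ _)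
    simp only [size]
    nlinarith

lemma sub_leSigma_ne_zero_iff {p q : Expr} : (Expr.sub (.const 1) (.leSigma p q)).val I s ≠ 0 ↔
    (q.val I s : ℝ) * I.σ < p.val I s := by
  simp only [val]
  split_ifs with h
  · simpa using h
  · simpa using h

lemma sub_leAlpha_ne_zero_iff {p q : Expr} : (Expr.sub (.const 1) (.leAlpha p q)).val I s ≠ 0 ↔
    (q.val I s : ℝ) * I.α < p.val I s := by
  simp only [val]
  split_ifs with h
  · simpa using h
  · simpa using h

lemma leSigma_ne_zero_iff {p q : Expr} : (Expr.leSigma p q).val I s ≠ 0 ↔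
    (p.val I s : ℝ) ≤ q.val I s * I.σ := by
  simp only [val]
  split_ifs with h
  · simpa using h
  · simpa using h

/-- Registers and arrays after the computation of `b`, `K` and `Kp`. -/
structure Scaled (b K Kp : ℕ) (s : State) : Prop where
  b : s.reg 3 = b
  K : s.reg 4 = K
  Kp : s.reg 5 = Kp
  reg : ∀ x, x ≤ 1 ∨ 12 < x → s.reg x = 0
  arr : ∀ a i, a ≠ 6 → s.arr a i = 0

lemma Scaled.setReg {b K Kp x : ℕ} {z : ℤ} (h : Scaled b K Kp s) (h1 : 5 < x) (h2 : x ≤ 12) :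
    Scaled b K Kp (s.setReg x z) := by
  refine ⟨?_, ?_, ?_, fun y hy => ?_, h.arr⟩ <;> rw [State.setReg_reg, if_neg (by omega)]
  exacts [h.b, h.K, h.Kp, h.reg y hy]

lemma Scaled.setArr {b K Kp : ℕ} {i z : ℤ} (h : Scaled b K Kp s) :
    Scaled b K Kp (s.setArr 6 i z) := by
  refine ⟨h.b, h.K, h.Kp, h.reg, fun a j ha => ?_⟩
  rw [State.setArr_arr, if_neg (by simp [ha])]
  exact h.arr a j ha

lemma scaleProgram_wp {N B : ℕ} (hσ : 0 < I.σ) (hα : 0 < I.α) (hN : N = ⌈1 / I.σ⌉₊)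
    (hB : B = ⌈1 / I.α⌉₊) (hZ1 : (4 * B + 1 : ℤ) ≤ Z) (hZ2 : (6 * N ^ 2 + 1 : ℤ) ≤ Z) :
    WP Z I scaleProgram State.zero fun s t =>
      Scaled (4 * B) (6 * N ^ 2) (⌊((6 * N ^ 2 : ℕ) : ℝ) * I.σ⌋₊ - 1) s ∧
      s.reg 6 = 0 ∧ s.reg 10 = 0 ∧ t ≤ 500 * (N ^ 2 + B) := by
  have hN1 : 1 ≤ N := by rw [hN]; exact Nat.one_le_ceil_iff.2 (by positivity)
  have hB1 : 1 ≤ B := by rw [hB]; exact Nat.one_le_ceil_iff.2 (by positivity)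
  have hNN : N ≤ N ^ 2 := Nat.le_self_pow (by norm_num) N
  zify at hNN
  set p := ⌊((6 * N ^ 2 : ℕ) : ℝ) * I.σ⌋₊ with hp
  have hpK : p ≤ 6 * N ^ 2 := by
    rw [hp]
    refine Nat.floor_le_of_le ?_
    have := I.σ_le_one
    exact mul_le_of_le_one_right (by positivity) this
  -- The machine subtracts integers while `Kp` is a truncated difference; the two agree because `p ≥
  -- 1`.
  have hp1 : 1 ≤ p := by
    rw [hp, Nat.one_le_floor_iff]
    have h1 : 1 / I.σ ≤ N := by rw [hN]; exact Nat.le_ceil _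
    rw [div_le_iff₀ hσ] at h1
    have h2 : (1 : ℝ) ≤ N := by exact_mod_cast hN1
    push_cast
    nlinarith [mul_pos hσ (show (0 : ℝ) < N by linarith)]
  refine .seq (.countUp (k := 1) (N := N) hN1 (by omega) ?_ ?_ fun t1 ht1 => ?_)
  · intro j h1 h2
    simp only [FitsInt, val, State.setReg_reg]
    split_ifs <;> omega
  · intro j h1 h2
    rw [sub_leSigma_ne_zero_iff, hN, Nat.lt_ceil, lt_div_iff₀ hσ]
    simp [val, State.setReg_reg]
  refine .seq (.countUp (k := 1) (N := B) hB1 (by omega) ?_ ?_ fun t2 ht2 => ?_)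
  · intro j h1 h2
    simp only [FitsInt, val, State.setReg_reg]
    split_ifs <;> omega
  · intro j h1 h2
    rw [sub_leAlpha_ne_zero_iff, hB, Nat.lt_ceil, lt_div_iff₀ hα]
    simp [val, State.setReg_reg]
  refine .seq (.assign ?_ (.seq (.assign ?_ ?_)))
  · simp [FitsInt, val, State.setReg_reg]; omega
  · simp [FitsInt, val, State.setReg_reg, ← sq]; omega
  refine .seq (.countUp (k := 0) (N := p) (Nat.zero_le _) (by zify at hpK; omega) ?_ ?_
    fun t3 ht3 => ?_)
  · intro j h1 h2
    zify at hpK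
    simp [FitsInt, val, State.setReg_reg, ← sq]
    omega
  · intro j h1 h2
    rw [leSigma_ne_zero_iff, hp, Nat.lt_iff_add_one_le, Nat.le_floor_iff (by positivity)]
    simp [val, State.setReg_reg, ← sq]
  refine .assign ?_ ⟨⟨?_, ?_, ?_, ?_, ?_⟩, ?_, ?_, ?_⟩
  · zify at hpK
    simp [FitsInt, State.setReg_reg, val]
    omega
  · simp [State.setReg_reg, val]
  · simp [State.setReg_reg, val, sq]
  · simp [State.setReg_reg, val, Nat.cast_sub hp1]
  · intro x hx
    simp only [State.setReg_reg]
    simp only [show x ≠ 5 by omega, show x ≠ 4 by omega, show x ≠ 3 by omega,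
      show x ≠ 2 by omega, if_false]
    rfl
  · intro a i _
    rfl
  · simp [State.setReg_reg, State.zero]
  · simp [State.setReg_reg, State.zero]
  · simp only [size] at *
    nlinarith

/-- The nodes of `A`, repeated as often as their degrees. -/
def Input.tokens (I : Input n m) : List (Fin n) :=
  I.listA.flatMap fun a => List.replicate (I.adj a).length a

/-- The list `l` is stored in array `6`. -/
def Listed (l : List (Fin n)) (s : State) : Prop :=
  s.reg 6 = l.length ∧ ∀ k : ℕ, ∀ hk : k < l.length, s.arr 6 k = (l[k] : ℕ)

lemma Listed.setReg {l : List (Fin n)} {x : ℕ} {z : ℤ} (h : Listed l s) (hx : x ≠ 6) :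
    Listed l (s.setReg x z) :=
  ⟨by rw [State.setReg_reg, if_neg hx.symm]; exact h.1, h.2⟩

lemma collectProgram_wp {b K Kp : ℕ} (hs : Scaled b K Kp s) (h6 : s.reg 6 = 0) (h10 : s.reg 10 = 0)
    (hZ1 : (2 * n + m + 10 : ℤ) ≤ Z) (hZ2 : (I.tokens.length : ℤ) + 1 ≤ Z) :
    WP Z I collectProgram s fun s' t => Scaled b K Kp s' ∧ Listed I.tokens s' ∧
      t ≤ 100 * I.tokens.length + 10 := by
  have hA : I.listA.length ≤ n := by simpa using I.listA_nodup.length_le_card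
  set f : Fin n → List (Fin n) := fun a => List.replicate (I.adj a).length a with hf
  refine .loop (fun i s => i ≤ I.listA.length ∧ Scaled b K Kp s ∧ s.reg 10 = i ∧
      Listed ((I.listA.take i).flatMap f) s)
    (fun i => ((I.listA.drop i).map fun a => 100 * (I.adj a).length).sum) 0 ?_ ?_ ?_ ?_
  · exact ⟨Nat.zero_le _, hs, h10, by simpa using h6, by simp⟩
  · rintro i s ⟨hi, hs, h10, hl⟩
    simp only [FitsInt, h10]; omega
  · rintro i s ⟨hi, hs, h10, hl⟩ hb
    have hi' : i < I.listA.length := by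
      by_contra h
      simp [val, h10, entry_coe, List.getElem?_eq_none (not_lt.1 h), encode_none] at hb
    have hsucc : (I.listA.take (i + 1)).flatMap f =
        (I.listA.take i).flatMap f ++ List.replicate (I.adj I.listA[i]).length I.listA[i] := by
      rw [List.take_add_one, List.getElem?_eq_getElem hi', List.flatMap_append]
      simp [hf]
    have htot : ((I.listA.take (i + 1)).flatMap f).length ≤ I.tokens.length := by
      rw [Input.tokens, ← hf]
      conv_rhs => rw [← List.take_append_drop (i + 1) I.listA, List.flatMap_append,
        List.length_append]
      omega
    have hdrop : ((I.listA.drop i).map fun a => 100 * (I.adj a).length).sum =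
        100 * (I.adj I.listA[i]).length +
        ((I.listA.drop (i + 1)).map fun a => 100 * (I.adj a).length).sum := by
      rw [List.drop_eq_getElem_cons hi', List.map_cons, List.sum_cons]
    have hval : (Expr.nodeA (.var 10)).val I s = (I.listA[i] : ℕ) := by
      simp [val, h10, entry_coe, List.getElem?_eq_getElem hi', encode_some]
    -- Positive degree lets the constant overhead per node be charged to its incidences.
    have hdeg : 1 ≤ (I.adj I.listA[i]).length := by
      rw [← I.deg_eq]
      exact ((I.mem_listA _).1 (List.getElem_mem hi')).2
    rw [hsucc] at htot
    generalize (I.listA.take i).flatMap f = pre at *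
    generalize I.listA[i] = a at *
    have han := a.2
    rw [List.length_append, List.length_replicate] at htot
    refine .seq (.assign ?_ (.seq (.forEdges (T := 10) a (fun t s => Scaled b K Kp s ∧
      s.reg 10 = i ∧ Listed (pre ++ List.replicate t a) s) (by decide) (by omega) (by omega)
      (by omega) ?_ ⟨hs.setReg (by decide) (by decide), ?_, ?_⟩ ?_ ?_ ?_)))
    · simp only [FitsInt, h10]; omega
    · simp [State.setReg_reg, hval]
    · simpa [State.setReg_reg] using h10
    · simpa using hl.setReg (by decide)
    · rintro t s z ⟨h1, h2, h3⟩
      refine ⟨h1.setReg (by decide) (by decide), ?_, h3.setReg (by decide)⟩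
      simpa [State.setReg_reg] using h2
    · rintro t ht s ⟨h1, h2, h3, h4⟩ h11 h12
      have hlen : (pre ++ List.replicate t a).length = pre.length + t := by simp
      rw [hlen] at h3
      refine .seq (.put ?_ ?_ (.assign ?_ ⟨⟨?_, ?_, ?_, ?_⟩, ?_, ?_, ?_⟩))
      · simp only [FitsInt, h3]; omega
      · simp only [FitsInt, h11]; omega
      · simp only [FitsInt, State.setArr_reg, val, h3]; omega
      · exact h1.setArr.setReg (by decide) (by decide)
      · simpa [State.setReg_reg, State.setArr_reg] using h2
      · simp [State.setReg_reg, State.setArr_reg, val, h3]; ring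
      · intro k hk
        simp only [State.setReg_arr, State.setArr_arr, val, h3, h11]
        simp only [List.replicate_succ', ← List.append_assoc] at hk ⊢
        rw [List.length_append, hlen, List.length_singleton] at hk
        by_cases hk' : k < pre.length + t
        · rw [if_neg (by omega), List.getElem_append_left (by rw [hlen]; exact hk')]
          exact h4 k (by rw [hlen]; exact hk')
        · obtain rfl : k = pre.length + t := by omega
          rw [if_pos (by simp), List.getElem_append_right (by rw [hlen])]
          simp
      · simpa [State.setReg_reg, State.setArr_reg] using h11
      · simpa [State.setReg_reg, State.setArr_reg] using h12
      · simp [size]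
    · rintro s' τ ⟨h1, h2, h3⟩ h11 hτ
      refine .assign ?_ ⟨i + 1, ⟨hi', h1.setReg (by decide) (by decide), ?_, ?_⟩, ?_⟩
      · simp only [FitsInt, val, h2]; omega
      · simp [State.setReg_reg, val, h2]
      · rw [hsucc]; exact h3.setReg (by decide)
      · rw [hdrop]
        simp only [size]
        omega
  · rintro i s' t ⟨hi, hs, h10, hl⟩ hb ht
    have hi' : i = I.listA.length := by
      by_contra h
      have : i < I.listA.length := by omega
      simp [val, h10, entry_coe, List.getElem?_eq_getElem this, encode_some] at hb
    subst hi'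
    rw [List.take_length] at hl
    refine ⟨hs, hl, ?_⟩
    have hlen : ((I.listA.drop 0).map fun a => 100 * (I.adj a).length).sum =
        100 * I.tokens.length := by
      simp [Input.tokens, List.length_flatMap, List.sum_map_mul_left]
    rw [hlen] at ht
    simp only [size] at ht
    omega

lemma heightProgram_wp {P : Par n} (hs : Scaled P.b P.K P.Kp s) (hl : Listed P.inc s)
    (hZ : Large P m Z) (hL : P.L = Nat.log 2 (P.K * P.inc.length) + 1)
    (hKV : 1 ≤ P.K * P.inc.length) (hb : 1 ≤ P.b) :
    WP Z I heightProgram s fun s' t => Scaled P.b P.K P.Kp s' ∧ Stored P s' ∧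
      t ≤ 50 * (P.L + 1) := by
  have hz := hZ.size
  have hz' := hZ.tokens
  have hz'' : (2 * (P.K * P.inc.length) : ℤ) ≤ Z := by
    have h1 := hZ.scan
    have h2 : (0 : ℤ) ≤ P.b * (P.K * P.inc.length) := by positivity
    have h3 : (0 : ℤ) ≤ P.K * P.inc.length := by positivity
    linarith
  refine .seq (.assign ?_ (.seq (.assign ?_ (.seq ?_))))
  · simp only [FitsInt]; omega
  · simp only [FitsInt]; omega
  have hpow : ∀ l, 2 ^ l ≤ P.K * P.inc.length ↔ l < P.L := by
    intro l
    rw [hL, Nat.lt_succ_iff, Nat.le_log_iff_pow_le (by norm_num) (by omega)]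
  have hpow' : ∀ l, l ≤ P.L → 2 ^ l ≤ 2 * (P.K * P.inc.length) := by
    intro l hl
    cases l with
    | zero => omega
    | succ l =>
      have := (hpow l).2 (by omega)
      rw [pow_succ]; omega
  have hbl : ∀ l, l ≤ P.L → P.b * l + 1 ≤ P.h := fun l hl => by
    rw [Par.h]; gcongr
  refine .loop (fun l s => l ≤ P.L ∧ Scaled P.b P.K P.Kp s ∧ Listed P.inc s ∧
    s.reg 7 = (P.b * l + 1 : ℕ) ∧ s.reg 8 = (2 ^ l : ℕ)) (fun l => 20 * (P.L - l)) 0 ?_ ?_ ?_ ?_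
  · refine ⟨Nat.zero_le _, (hs.setReg (by decide) (by decide)).setReg (by decide) (by decide),
      (hl.setReg (by decide)).setReg (by decide), ?_, ?_⟩ <;> simp [State.setReg_reg, val]
  · rintro l s ⟨hlL, hs, hl, h7, h8⟩
    have h1 := hpow' l hlL
    have hV : P.inc.length ≤ P.K * P.inc.length := by
      have : 1 ≤ P.K := Nat.one_le_iff_ne_zero.2 fun h => by simp [h] at hKV
      nlinarith
    simp only [FitsInt, val, h8, hs.K, hl.1]
    have hp : (0 : ℤ) < 2 ^ l := by positivity
    zify at h1 hV
    push_cast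
    refine ⟨⟨?_, ?_⟩, ⟨⟨?_, ?_⟩, ⟨?_, ?_⟩, ?_, ?_⟩, ?_⟩ <;> omega
  · rintro l s ⟨hlL, hs, hl, h7, h8⟩ hcond
    have hlt : l < P.L := by
      rw [← hpow]
      by_contra h
      simp only [val, h8, hs.K, hl.1] at hcond
      rw [if_neg (by zify at h; push_cast; omega)] at hcond
      exact hcond rfl
    have h1 := hpow' _ hlL
    have h1' := hpow' (l + 1) hlt
    have h2 := hbl (l + 1) hlt
    have hp : (0 : ℤ) < 2 ^ l := by positivity
    have h2' := hbl _ hlL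
    rw [mul_add, mul_one] at h2
    rw [pow_succ] at h1'
    refine .seq (.assign ?_ (.assign ?_ ⟨l + 1, ⟨hlt, ?_, ?_, ?_, ?_⟩, ?_⟩))
    · simp only [FitsInt, val, h8]
      zify at h1 h1'
      push_cast
      refine ⟨⟨?_, ?_⟩, ⟨?_, ?_⟩, ?_, ?_⟩ <;> omega
    · simp [FitsInt, val, State.setReg_reg, h7, hs.b]
      zify at h2 h2'
      refine ⟨⟨?_, ?_⟩, ⟨?_, ?_⟩, ?_, ?_⟩ <;> omega
    · exact (hs.setReg (by decide) (by decide)).setReg (by decide) (by decide)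
    · exact (hl.setReg (by decide)).setReg (by decide)
    · simp [State.setReg_reg, val, h7, hs.b]; ring
    · simp [State.setReg_reg, val, h8]; ring
    · simp only [size]; omega
  · rintro l s' t ⟨hlL, hs, hl, h7, h8⟩ hcond ht
    have hlt : l = P.L := by
      by_contra h
      have h' := (hpow l).2 (by omega)
      simp only [val, h8, hs.K, hl.1] at hcond
      rw [if_pos (by zify at h'; push_cast; omega)] at hcond
      exact one_ne_zero hcond
    subst hlt
    refine .assign ?_ ⟨hs.setReg (by decide) (by decide), ⟨?_, ?_, ?_, ?_, ?_, ?_, hl.2⟩, ?_⟩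
    · have hU : (P.U : ℤ) = P.K * P.b := by simp [Par.U]
      simp only [FitsInt, val, hs.K, hs.b, ← hU]; omega
    · simpa [State.setReg_reg] using hs.b
    · simpa [State.setReg_reg] using hs.K
    · simpa [State.setReg_reg] using hs.Kp
    · simpa [State.setReg_reg] using hl.1
    · simpa [State.setReg_reg, Par.h] using h7
    · simp [State.setReg_reg, val, hs.K, hs.b, Par.U]
    · simp only [size] at ht ⊢
      omega

/-- Blank memory already represents the initial snapshot. No initialization over all nodes or edges
is needed, which a local time bound could not afford. -/
lemma Scaled.rep {b K Kp : ℕ} (hs : Scaled b K Kp s) : Rep I (Cfg.zero n m) s := by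
  refine ⟨fun v => ?_, fun e => ?_, fun v => ?_, fun v => ?_, ?_, ?_, Or.inl ⟨?_, ?_⟩⟩
  · simpa [Cfg.zero] using hs.arr 1 v (by decide)
  · simpa [Cfg.zero] using hs.arr 2 e (by decide)
  · simpa [Cfg.zero] using hs.arr 3 v (by decide)
  · simpa [Cfg.zero] using hs.arr 4 v (by decide)
  · simpa [Cfg.zero] using hs.reg 18 (by decide)
  · simp [Cfg.zero]
  · exact hs.reg 19 (by decide)
  · simp [Cfg.zero]

end Parameters
end LBS

namespace LBS

/-! ### The whole algorithm, its parameters and its correctness -/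

section Main

open LBS.Expr

/-- The local flow algorithm for LBS cuts. -/
def mainProgram : Program :=
  .ite (.le (.const 0) (.nodeA (.const 0)))
    (.seq scaleProgram (.seq collectProgram (.seq heightProgram (.seq flowProgram
      (.ite (.var 19)
        (.seq (.assign 24 (.const 0)) (.seq (.assign 1 (.const 0))
          (.seq levelProgram outputProgram)))
        (.assign 0 (.const 0)))))))
    .skip

variable {n m : ℕ} {I : Input n m} {Z : ℤ}

variable (I) in
/-- The parameters for the input `I`. -/
noncomputable def Input.par : Par n where
  K := 6 * ⌈1 / I.σ⌉₊ ^ 2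
  Kp := ⌊((6 * ⌈1 / I.σ⌉₊ ^ 2 : ℕ) : ℝ) * I.σ⌋₊ - 1
  b := 4 * ⌈1 / I.α⌉₊
  L := Nat.log 2 (6 * ⌈1 / I.σ⌉₊ ^ 2 * I.tokens.length) + 1
  inc := I.tokens

variable (I) in
/-- The relations between the parameters and the input that the analysis needs. -/
structure ParOK (P : Par n) : Prop where
  K_lower : 6 ≤ P.K * I.σ ^ 2
  K_upper : P.K * I.σ ^ 2 ≤ 24
  Kp_lower : P.K * I.σ - 2 < P.Kp
  Kp_upper : P.Kp ≤ P.K * I.σ - 1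
  Kp_pos : 1 ≤ P.Kp
  b_lower : 4 ≤ P.b * I.α
  b_upper : P.b * I.α ≤ 8
  L_spec : P.K * P.inc.length < 2 ^ P.L

lemma ceil_one_div_bounds {x : ℝ} (h0 : 0 < x) (h1 : x ≤ 1) :
    1 ≤ (⌈1 / x⌉₊ : ℝ) * x ∧ (⌈1 / x⌉₊ : ℝ) * x ≤ 2 := by
  constructor
  · rw [← div_le_iff₀ h0]; exact Nat.le_ceil _
  · have h2 : (⌈1 / x⌉₊ : ℝ) < 1 / x + 1 := Nat.ceil_lt_add_one (by positivity)
    have h3 := mul_lt_mul_of_pos_right h2 h0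
    have h4 : (1 / x + 1) * x = 1 + x := by field_simp
    linarith

/-- Rounding up gives `1 ≤ ⌈1/x⌉ * x ≤ 2`. The factors `6` in `K` and `4` in `b` turn this into the
ranges `[6, 24]` and `[4, 8]`. -/
lemma Input.parOK (hσ : 0 < I.σ) (hα : 0 < I.α) : ParOK I I.par := by
  obtain ⟨h1, h2⟩ := ceil_one_div_bounds hσ I.σ_le_one
  obtain ⟨h3, h4⟩ := ceil_one_div_bounds hα I.α_le_one
  have hσ1 := I.σ_le_one
  have h5 : (1 : ℝ) ≤ ⌈1 / I.σ⌉₊ := by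
    exact_mod_cast Nat.one_le_ceil_iff.2 (by positivity : 0 < 1 / I.σ)
  have h6 : (6 : ℝ) ≤ ((6 * ⌈1 / I.σ⌉₊ ^ 2 : ℕ) : ℝ) * I.σ := by
    push_cast
    nlinarith
  have h7 : 6 ≤ ⌊((6 * ⌈1 / I.σ⌉₊ ^ 2 : ℕ) : ℝ) * I.σ⌋₊ := Nat.le_floor (by exact_mod_cast h6)
  have h8 := Nat.floor_le (a := ((6 * ⌈1 / I.σ⌉₊ ^ 2 : ℕ) : ℝ) * I.σ) (by positivity)
  have h9 := Nat.lt_floor_add_one (((6 * ⌈1 / I.σ⌉₊ ^ 2 : ℕ) : ℝ) * I.σ)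
  refine ⟨?_, ?_, ?_, ?_, ?_, ?_, ?_, ?_⟩
  · simp only [Input.par]; push_cast; nlinarith
  · simp only [Input.par]; push_cast; nlinarith
  · simp only [Input.par]
    rw [Nat.cast_sub (by omega)]
    push_cast at h9 ⊢
    linarith
  · simp only [Input.par]
    rw [Nat.cast_sub (by omega)]
    push_cast at h8 ⊢
    linarith
  · simp only [Input.par]; omega
  · simp only [Input.par]; push_cast; linarith
  · simp only [Input.par]; push_cast; linarith
  · simp only [Input.par]
    exact Nat.lt_pow_succ_log_self (by norm_num) _

lemma Input.count_tokens (v : Fin n) :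
    I.tokens.count v = if v ∈ I.A then deg I.G v else 0 := by
  have h1 : I.tokens.count v = ∑ a ∈ I.listA.toFinset, if a = v then deg I.G a else 0 := by
    rw [Input.tokens, List.count_flatMap, List.sum_toFinset _ I.listA_nodup]
    congr 1
    refine List.map_congr_left fun a _ => ?_
    simp [List.count_replicate, I.deg_eq]
  rw [h1, Finset.sum_ite_eq']
  simp only [List.mem_toFinset, I.mem_listA]
  by_cases hv : v ∈ I.A
  · by_cases hd : 1 ≤ deg I.G v
    · simp [hv, hd]
    · have : deg I.G v = 0 := by omega
      simp [this]
  · simp [hv]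

lemma Input.length_tokens : I.tokens.length = vol I.G I.A := by
  have h1 : I.tokens.length = ∑ v, I.tokens.count v := by
    simpa using (Multiset.sum_count_eq_card (s := Finset.univ) (m := (I.tokens : Multiset (Fin n)))
      (by simp)).symm
  rw [h1, vol]
  simp only [I.count_tokens, Finset.sum_ite_mem, Finset.univ_inter]

lemma Input.adj_ne_nil_of_mem_tokens {v : Fin n} (hv : v ∈ I.tokens) : I.adj v ≠ [] := by
  simp only [Input.tokens, List.mem_flatMap, List.mem_replicate] at hv
  obtain ⟨a, _, h, rfl⟩ := hv
  exact fun h' => h (by simp [h'])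

/-! ## Correctness -/

variable {P : Par n} {c : Cfg n m} {src : Fin n → ℕ}

lemma vol_inter_le (G : Graph (Fin n) (Fin m)) (S A : Finset (Fin n)) :
    vol G (S ∩ A) ≤ vol G A := Finset.sum_le_sum_of_subset Finset.inter_subset_right

lemma IsOverlapping.mul_vol_le {G : Graph (Fin n) (Fin m)} {A S : Finset (Fin n)} {σ : ℝ}
    (h : IsOverlapping G A σ S) (hS : 0 < vol G S) : σ * vol G S ≤ vol G (S ∩ A) := by
  rw [IsOverlapping, le_div_iff₀ (by exact_mod_cast hS)] at h
  exact h

lemma IsSpecial.two_mul_vol_le (h : IsSpecial I) :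
    2 * (vol I.G I.A : ℝ) ≤ I.σ * vol I.G I.Aᶜ := by
  obtain ⟨_, _, h3, h4⟩ := h
  rcases (vol I.G I.Aᶜ).eq_zero_or_pos with h0 | h0
  · have : vol I.G I.A = 0 := by omega
    simp [this, h0]
  · rwa [div_le_iff₀ (by exact_mod_cast h0)] at h4

/-- Overlapping cuts have at most half of the volume. -/
lemma IsSpecial.vol_le_of_overlapping (h : IsSpecial I) {S : Finset (Fin n)} (hS : 0 < vol I.G S)
    (ho : IsOverlapping I.G I.A I.σ S) : vol I.G S ≤ vol I.G Sᶜ := by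
  have h1 := ho.mul_vol_le hS
  have h2 := h.two_mul_vol_le
  have h3 := vol_inter_le I.G S I.A
  have h4 := I.vol_add_vol_compl S
  have h5 := I.vol_add_vol_compl I.A
  have hσ := h.2.1
  rify at h3 h4 h5 ⊢
  by_contra h6
  push Not at h6
  -- Otherwise `2 * σ * vol S` would exceed `σ` times the total volume, which is at least `2 * vol
  -- A` by condition (ii), hence at least `2 * σ * vol S` by overlap.
  have h7 : I.σ * (vol I.G Sᶜ : ℝ) < I.σ * vol I.G S := mul_lt_mul_of_pos_left h6 hσ
  have h8 : I.σ * ((vol I.G S : ℝ) + vol I.G Sᶜ) = I.σ * (vol I.G I.A + vol I.G I.Aᶜ) := by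
    rw [h4, h5]
  have h9 : 0 ≤ I.σ * (vol I.G I.A : ℝ) := by positivity
  nlinarith

lemma IsSparse.vol_pos {G : Graph (Fin n) (Fin m)} {α : ℝ} {S : Finset (Fin n)}
    (h : IsSparse G α S) : 0 < vol G S := lt_of_lt_of_le h.1 (min_le_left _ _)

/-- An overlapping sparse cut leaves behind many tokens. -/
lemma Good.vol_le_ex (hI : IsSpecial I) (hP : ParOK I P)
    (hc : Good I P.Kp P.h P.U c src none)
    (hsrc : ∀ v, src v = if v ∈ I.A then P.K * deg I.G v else 0) {S : Finset (Fin n)}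
    (hS : IsSparse I.G (I.α / (384 / I.σ ^ 2)) S) (ho : IsOverlapping I.G I.A I.σ S) :
    (vol I.G S : ℝ) ≤ 2 * ∑ v, c.ex v := by
  have hpos := hS.vol_pos
  have hpos' : (0 : ℝ) < vol I.G S := by exact_mod_cast hpos
  have hle := hI.vol_le_of_overlapping hpos ho
  have hov := ho.mul_vol_le hpos
  have hσ := hI.2.1
  have hα := hI.1
  have h1 := hc.sum_source_le S
  have h2 : ∑ v ∈ S, src v = P.K * vol I.G (S ∩ I.A) := by
    simp only [hsrc, vol, Finset.mul_sum, Finset.sum_ite_mem]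
  rw [h2] at h1
  rify at h1
  have h3 := hS.2
  rw [conductance, min_eq_left hle, div_lt_iff₀ hpos'] at h3
  have hU : (P.U : ℝ) = P.K * P.b := by simp [Par.U]
  -- The constant `384 = 2 * 24 * 8` is chosen here: `24` and `8` bound `K * σ²` and `b * α`, and
  -- the `2` leaves half of `vol S`.
  have h4 : (P.U : ℝ) * cutSize I.G S ≤ vol I.G S / 2 := by
    calc (P.U : ℝ) * cutSize I.G S ≤ P.U * (I.α / (384 / I.σ ^ 2) * vol I.G S) := by gcongr
      _ = (P.K * I.σ ^ 2) * (P.b * I.α) / 384 * vol I.G S := by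
          rw [hU]; field_simp
      _ ≤ 24 * 8 / 384 * vol I.G S := by
          gcongr
          · exact hP.K_upper
          · exact hP.b_upper
      _ = _ := by ring
  have h5 : (P.K : ℝ) * (I.σ * vol I.G S) ≤ P.K * vol I.G (S ∩ I.A) := by gcongr
  have h6 : (P.Kp : ℝ) * vol I.G S ≤ (P.K * I.σ - 1) * vol I.G S := by
    gcongr; exact hP.Kp_upper
  push_cast
  -- The surplus of one token per unit of volume left by `Kp ≤ K * σ - 1` covers this export, and
  -- half of it remains stuck.
  nlinarith

/-- The levels have at most half of the volume. -/
lemma Good.vol_level_le_compl (hI : IsSpecial I) (hP : ParOK I P)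
    (hc : Good I P.Kp P.h P.U c src none)
    (hsrc : ∀ v, src v = if v ∈ I.A then P.K * deg I.G v else 0) {i : ℕ} (hi : 1 ≤ i) :
    vol I.G (c.level i) ≤ vol I.G (c.level i)ᶜ := by
  have hσ := hI.2.1
  have hσ1 := I.σ_le_one
  have h1 := hc.vol_level_le hi
  have h2 : ∑ v, src v = P.K * vol I.G I.A := by
    simp only [hsrc, vol, Finset.mul_sum, Finset.sum_ite_mem, Finset.univ_inter]
  rw [h2] at h1
  have h3 := I.vol_add_vol_compl (c.level i)
  have h4 := I.vol_add_vol_compl I.A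
  have h5 := hI.two_mul_vol_le
  have h6 := hP.Kp_lower
  have h7 := hP.K_lower
  rify at h1 h3 h4 ⊢
  by_contra h8
  push Not at h8
  set v : ℝ := (vol I.G (c.level i) : ℝ)
  set V : ℝ := (vol I.G I.A : ℝ)
  have hV : 0 ≤ V := by positivity
  have hv : 0 < v := lt_of_le_of_lt (by positivity) h8
  have h9 : (P.K : ℝ) * I.σ - 2 ≥ 0 := by nlinarith
  have h10 : (P.K * I.σ - 2) * v < P.K * V := by
    have : (P.K * I.σ - 2) * v < P.Kp * v := by gcongr
    linarith
  have h11 : I.σ * V + 2 * V < 2 * I.σ * v := by nlinarith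
  have h12 : (P.K * I.σ - 2) * (I.σ * V + 2 * V) ≤ (P.K * I.σ - 2) * (2 * I.σ * v) := by gcongr
  have h13 : (P.K * I.σ - 2) * (2 * I.σ * v) < 2 * I.σ * (P.K * V) := by
    have := mul_lt_mul_of_pos_left h10 (show 0 < 2 * I.σ by positivity)
    linarith
  -- Saturation bounds the level by `K * V / (K * σ - 2)`, condition (ii) bounds half of the volume
  -- from below by `(σ + 2) * V / (2 * σ)`. They are compatible once `K * σ² ≥ 2 * σ + 4`, which
  -- explains the lower bound `6`.
  have h14 : V * (P.K * I.σ ^ 2 - 2 * I.σ - 4) < 0 := by nlinarith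
  have h15 : 0 ≤ V * (P.K * I.σ ^ 2 - 2 * I.σ - 4) := mul_nonneg hV (by linarith)
  linarith

lemma opt_eq_zero_of_not_exists {G : Graph (Fin n) (Fin m)} {α σ : ℝ} {A : Finset (Fin n)}
    (h : ¬ ∃ S, IsSparse G α S ∧ IsOverlapping G A σ S) : opt G α A σ = 0 := by
  rw [opt, ← Nat.le_zero]
  refine Finset.sup_le fun S hS => ?_
  simp only [Finset.mem_filter] at hS
  exact absurd ⟨S, hS.2.1, hS.2.2.1⟩ h

lemma Good.not_exists (hI : IsSpecial I) (hP : ParOK I P)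
    (hc : Good I P.Kp P.h P.U c src none)
    (hsrc : ∀ v, src v = if v ∈ I.A then P.K * deg I.G v else 0) (hex : ∀ v, c.ex v = 0) :
    ¬ ∃ S, IsSparse I.G (I.α / (384 / I.σ ^ 2)) S ∧ IsOverlapping I.G I.A I.σ S := by
  rintro ⟨S, hS, ho⟩
  have h1 := hc.vol_le_ex hI hP hsrc hS ho
  have h2 : (0 : ℝ) < vol I.G S := by exact_mod_cast hS.vol_pos
  simp only [hex] at h1
  simp at h1
  have h3 := hS.vol_pos
  omega

/-- The conductance is at most `3/b ≤ 3 * α / 4`. The volume of a competitor is at most twice the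
number of stuck tokens, which is at most `4 * K * vol` of the level: `K` for the sources and `3 * K`
for inflow. With `K ≤ 24/σ²` this gives `192 = 2 * 4 * 24`. -/
lemma Good.isLBSCut (hI : IsSpecial I) (hP : ParOK I P)
    (hc : Good I P.Kp P.h P.U c src none)
    (hsrc : ∀ v, src v = if v ∈ I.A then P.K * deg I.G v else 0)
    (hex : ∃ v, c.ex v ≠ 0) {i : ℕ} (hi : 1 ≤ i) (hih : i ≤ P.h)
    (hcut : P.b * cutSize I.G (c.level i) ≤ 3 * vol I.G (c.level i)) :
    IsLBSCut (192 / I.σ ^ 2) (384 / I.σ ^ 2) I.G I.α I.A I.σ (c.level i) := by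
  have hσ := hI.2.1
  have hα := hI.1
  have hle := hc.vol_level_le_compl hI hP hsrc hi
  have hexle : ∑ v, c.ex v ≤ 4 * P.K * vol I.G (c.level i) := by
    have h1 := hc.vol_level_add_ex_le hi hih
    have h2 : ∑ v ∈ c.level i, src v ≤ P.K * vol I.G (c.level i) := by
      rw [vol, Finset.mul_sum]
      refine Finset.sum_le_sum fun v _ => ?_
      rw [hsrc]; split_ifs <;> simp
    have h3 : P.U * cutSize I.G (c.level i) ≤ P.K * (3 * vol I.G (c.level i)) := by
      rw [Par.U, mul_assoc]; gcongr
    nlinarith [Nat.zero_le (P.Kp * vol I.G (c.level i))]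
  -- The level inequality alone also holds for an empty level; a stuck token rules this out.
  have hpos : 0 < vol I.G (c.level i) := by
    obtain ⟨v, hv⟩ := hex
    have h1 : c.ex v ≤ ∑ v, c.ex v := Finset.single_le_sum (fun _ _ => Nat.zero_le _) (by simp)
    by_contra h0
    have : vol I.G (c.level i) = 0 := by omega
    rw [this] at hexle
    omega
  have hpos' : (0 : ℝ) < vol I.G (c.level i) := by exact_mod_cast hpos
  refine ⟨hle, ⟨by rw [min_eq_left hle]; exact hpos, ?_⟩, ?_⟩
  · rw [conductance, min_eq_left hle, div_lt_iff₀ hpos']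
    have hb := hP.b_lower
    have hb0 : (0 : ℝ) < P.b := by
      by_contra h
      have : (P.b : ℝ) = 0 := le_antisymm (not_lt.1 h) (by positivity)
      rw [this] at hb
      linarith
    rify at hcut
    refine lt_of_mul_lt_mul_left ?_ hb0.le
    nlinarith
  · have h1 : opt I.G (I.α / (384 / I.σ ^ 2)) I.A I.σ ≤
        ⌊192 / I.σ ^ 2 * vol I.G (c.level i)⌋₊ := by
      rw [opt]
      refine Finset.sup_le fun S hS => Nat.le_floor ?_
      simp only [Finset.mem_filter] at hS
      have h1 := hc.vol_le_ex hI hP hsrc hS.2.1 hS.2.2.1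
      have h2 := hP.K_upper
      rw [← le_div_iff₀ (by positivity)] at h2
      rify at hexle
      calc (vol I.G S : ℝ) ≤ 2 * ∑ v, (c.ex v : ℝ) := by exact_mod_cast h1
        _ ≤ 2 * (4 * P.K * vol I.G (c.level i)) := by gcongr
        _ ≤ 2 * (4 * (24 / I.σ ^ 2) * vol I.G (c.level i)) := by gcongr
        _ = _ := by ring
    exact (Nat.cast_le.2 h1).trans (Nat.floor_le (by positivity))

lemma Good.one_le_vol_top {K : ℕ} (hc : Good I P.Kp P.h P.U c src none)
    (hsrc : ∀ v, src v = if v ∈ I.A then K * deg I.G v else 0) (hex : ∃ v, c.ex v ≠ 0) :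
    1 ≤ vol I.G (c.level P.h) := by
  obtain ⟨v, hv⟩ := hex
  have h1 : 1 ≤ deg I.G v := hc.deg_pos_of_ex (K := K)
    (fun v => by rw [hsrc]; split_ifs <;> simp) hv
  refine h1.trans (Finset.single_le_sum (f := deg I.G) (fun _ _ => Nat.zero_le _) ?_)
  rw [Cfg.mem_level, hc.ex_lab v hv]

lemma Par.exists_level (hP : ParOK I P) (hc : Good I P.Kp P.h P.U c src none)
    (hsrc : ∀ v, src v = if v ∈ I.A then P.K * deg I.G v else 0) (hK : 1 ≤ P.K) (hb : 1 ≤ P.b)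
    (hlen : P.inc.length = vol I.G I.A) (hex : ∃ v, c.ex v ≠ 0) :
    ∃ i, 1 ≤ i ∧ i ≤ P.h ∧ P.b * cutSize I.G (c.level i) ≤ 3 * vol I.G (c.level i) :=
  Good.exists_level (K := P.K) hc hsrc hK hP.Kp_pos hb (hlen ▸ hP.L_spec)
    (hc.one_le_vol_top hsrc hex)

/-! ## The main program -/

lemma Input.listA_eq_nil_iff : I.listA = [] ↔ vol I.G I.A = 0 := by
  simp only [vol, Finset.sum_eq_zero_iff, List.eq_nil_iff_forall_not_mem, I.mem_listA]
  refine forall_congr' fun v => ?_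
  constructor
  · intro h hv
    by_contra h0
    exact h ⟨hv, by omega⟩
  · rintro h ⟨h1, h2⟩
    have := h h1
    omega

/-- This case must stop at once, since counting up to `1/σ` and `1/α` would exceed the time bound.
Doing nothing is a correct answer: register `0` starts at `0`, and nothing of positive volume
overlaps `A`. -/
lemma mainProgram_wp_of_vol_eq_zero (hI : IsSpecial I) (hZ : (n + 1 : ℤ) ≤ Z)
    (hA : vol I.G I.A = 0) (csize : ℝ) :
    WP Z I mainProgram State.zero fun s t =>
      CorrectAnswer csize (384 / I.σ ^ 2) I s ∧ t ≤ 10 := by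
  have hl := I.listA_eq_nil_iff.2 hA
  have hno : ¬ ∃ S, IsSparse I.G (I.α / (384 / I.σ ^ 2)) S ∧ IsOverlapping I.G I.A I.σ S := by
    rintro ⟨S, hS, ho⟩
    have h1 := ho.mul_vol_le hS.vol_pos
    have h2 := vol_inter_le I.G S I.A
    have h3 : vol I.G (S ∩ I.A) = 0 := by omega
    rw [h3] at h1
    have h4 : (0 : ℝ) < vol I.G S := by exact_mod_cast hS.vol_pos
    have h5 := mul_pos hI.2.1 h4
    simp at h1
    linarith
  refine .ite ?_ (fun h => ?_) (fun _ => .skip ⟨Or.inr ⟨rfl, ?_, hno⟩, by simp [size]⟩)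
  · simp only [FitsInt]; omega
  · simp [val, entry, hl, encode_none] at h
  · exact opt_eq_zero_of_not_exists hno

/-- With `vol A ≥ 1`, the quantities `K`, `b`, `L`, `h` and the number of tokens are all at most `h
* K * vol A`, so this product pays for every phase; sending the tokens and scanning up to `h` levels
dominate. -/
lemma mainProgram_wp (hI : IsSpecial I) (hZ : Large I.par m Z) (hA : 1 ≤ vol I.G I.A) :
    WP Z I mainProgram State.zero fun s t =>
      CorrectAnswer (192 / I.σ ^ 2) (384 / I.σ ^ 2) I s ∧
      t ≤ 5000 * (I.par.h * (I.par.K * vol I.G I.A)) := by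
  have hσ := hI.2.1
  have hα := hI.1
  have hP := I.parOK hσ hα
  have hz := hZ.size
  have hz' := hZ.tokens
  have hlen : I.par.inc.length = vol I.G I.A := I.length_tokens
  have hN1 : 1 ≤ ⌈1 / I.σ⌉₊ := Nat.one_le_ceil_iff.2 (by positivity)
  have hB1 : 1 ≤ ⌈1 / I.α⌉₊ := Nat.one_le_ceil_iff.2 (by positivity)
  have hK : I.par.K = 6 * ⌈1 / I.σ⌉₊ ^ 2 := rfl
  have hb : I.par.b = 4 * ⌈1 / I.α⌉₊ := rfl
  have hK1 : 6 ≤ I.par.K := by rw [hK]; nlinarith [Nat.pow_le_pow_left hN1 2]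
  have hh : I.par.h = I.par.b * I.par.L + 1 := rfl
  have hL1 : 1 ≤ I.par.L := by simp [Input.par]
  have hbh : I.par.b ≤ I.par.h := by rw [hh]; nlinarith
  have hLh : I.par.L ≤ I.par.h := by rw [hh]; nlinarith
  have hKV : 1 ≤ I.par.K * I.par.inc.length := by rw [hlen]; nlinarith
  refine .ite ?_ (fun _ => .seq ?_) (fun h => ?_)
  · simp only [FitsInt]; omega
  swap
  · have hne : I.listA ≠ [] := fun h => by rw [I.listA_eq_nil_iff] at h; omega
    have hpos := List.length_pos_iff.2 hne
    simp [val, entry, List.getElem?_eq_getElem hpos, encode_some] at h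
  refine (scaleProgram_wp hσ hα rfl rfl (by rw [hb] at hz; push_cast at hz; omega)
    (by rw [hK] at hz; push_cast at hz; omega)).mono ?_
  rintro s t ⟨h1, h2, h3, ht⟩
  have hV : (I.tokens.length : ℤ) ≤ I.par.K * I.par.inc.length := by
    have : 1 * I.par.inc.length ≤ I.par.K * I.par.inc.length :=
      Nat.mul_le_mul_right _ (by omega)
    rw [one_mul] at this
    exact_mod_cast this
  refine .seq ((collectProgram_wp (I := I) h1 h2 h3 (by omega) (by omega)).mono ?_)
  rintro s t2 ⟨h1, h2, ht2⟩
  refine .seq ((heightProgram_wp (P := I.par) h1 h2 hZ rfl hKV (by omega)).mono ?_)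
  rintro s t3 ⟨h1, h2, ht3⟩
  refine .seq ((flowProgram_wp hZ hP.Kp_pos (by omega)
    (fun v hv => I.adj_ne_nil_of_mem_tokens hv) h1.rep h2).mono ?_)
  rintro s t4 ⟨c, hc, hr, hs, ht4⟩
  have hsrc : ∀ v, I.par.source (I.par.K * I.par.inc.length) v =
      if v ∈ I.A then I.par.K * deg I.G v else 0 := by
    intro v
    rw [I.par.source_eq (by omega)]
    change _ * I.tokens.count v = _
    rw [I.count_tokens]
    split_ifs <;> simp
  have hsum := I.par.sum_source_le (I.par.K * I.par.inc.length)
  generalize I.par.source (I.par.K * I.par.inc.length) = src at hc hsrc hsum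
  set M := I.par.K * vol I.G I.A with hM
  rw [hlen, ← hM] at ht4 hsum
  have hlen' : I.tokens.length = vol I.G I.A := I.length_tokens
  have hVM : vol I.G I.A ≤ M := Nat.le_mul_of_pos_left _ (by omega)
  have hKM : I.par.K ≤ M := Nat.le_mul_of_pos_right _ (by omega)
  have hM1 : 1 ≤ M := by omega
  have hh1 : 1 ≤ I.par.h := by omega
  have e1 : M ≤ I.par.h * M := Nat.le_mul_of_pos_left _ hh1
  have e2 : I.par.h ≤ I.par.h * M := Nat.le_mul_of_pos_right _ hM1
  have f1 : 1000 * (I.par.h + 1) * M = 1000 * (I.par.h * M) + 1000 * M := by ring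
  have f2 : (200 * M + 60) * (I.par.h + 2) =
      200 * (I.par.h * M) + 400 * M + 60 * I.par.h + 120 := by ring
  rw [f1] at ht4
  refine .ite ?_ (fun h => ?_) (fun h => ?_)
  · rcases hr.dead with h | h <;> simp only [FitsInt, h] <;> omega
  · have hex : ∃ v, c.ex v ≠ 0 := by
      rcases hr.dead with h' | h'
      · exact absurd h'.1 h
      · exact h'.2
    refine .seq (.assign ?_ (.seq (.assign ?_ (.seq ?_))))
    · simp only [FitsInt]; omega
    · simp only [FitsInt]; omega
    refine (levelProgram_wp hZ hP.Kp_pos hc (by rw [hlen]; exact hsum)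
      ((hr.setReg (by decide) (by decide)).setReg (by decide) (by decide)) ?_ ?_ ?_ ?_).mono ?_
    · exact (hs.setReg (by decide)).setReg (by decide)
    · simp [State.setReg_reg, val]
    · simp [State.setReg_reg, val]
    · exact I.par.exists_level hP hc hsrc (by omega) (by omega) hlen hex
    rintro s t5 ⟨i, hi, hih, hcut, hr, hs, h20, h1, ht5⟩
    refine (outputProgram_wp hZ hP.Kp_pos hc (by rw [hlen]; exact hsum) hr h20 h1 hi hih).mono ?_
    rintro s t6 ⟨hout, ht6⟩
    refine ⟨Or.inl ⟨_, hout, hc.isLBSCut hI hP hsrc hex hi hih hcut⟩, ?_⟩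
    rw [hlen, ← hM] at ht5 ht6
    rw [f2] at ht5
    simp only [size]
    omega
  · have hex : ∀ v, c.ex v = 0 := by
      rcases hr.dead with h' | h'
      · exact h'.2
      · have : s.reg 19 = 0 := h
        omega
    have hno := hc.not_exists hI hP hsrc hex
    refine .assign ?_ ⟨Or.inr ⟨?_, opt_eq_zero_of_not_exists hno, hno⟩, ?_⟩
    · simp only [FitsInt]; omega
    · simp [ReportsNone, State.setReg_reg, val]
    · simp only [size]
      omega

end Main
end LBS

namespace LBS

/-! ### Word size and running time in terms of the input -/

section Bounds

variable {n m : ℕ} {I : Input n m}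

variable (I) in
/-- A natural number that bounds the size of the input and the inverses of the parameters. -/
noncomputable def Input.scale : ℕ := ⌊((n : ℝ) + m + 2) / (I.α * I.σ)⌋₊

lemma Input.scale_bounds (hσ : 0 < I.σ) (hα : 0 < I.α) :
    n + m + 2 ≤ I.scale ∧ ⌈1 / I.σ⌉₊ ≤ I.scale ∧ ⌈1 / I.α⌉₊ ≤ I.scale := by
  have hσ1 := I.σ_le_one
  have hα1 := I.α_le_one
  have hX := Nat.lt_floor_add_one (((n : ℝ) + m + 2) / (I.α * I.σ))
  have hn : (0 : ℝ) ≤ n := by positivity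
  have hm : (0 : ℝ) ≤ m := by positivity
  have key : ∀ x : ℝ, 0 < x → x ≤ 1 → I.α * I.σ ≤ x → ⌈1 / x⌉₊ ≤ I.scale := by
    intro x hx hx1 hle
    refine Nat.ceil_le.2 ?_
    have h1 : 1 ≤ 1 / x := (one_le_div hx).2 hx1
    -- The floor in `scale` loses less than `1`, and `2/x - 1 ≥ 1/x`; the summand `2` in the
    -- numerator provides this room.
    have h2 : 2 / x ≤ ((n : ℝ) + m + 2) / (I.α * I.σ) := by gcongr; linarith
    have h3 : 2 / x = 1 / x + 1 / x := by ring
    have h4 : (I.scale : ℝ) = ⌊((n : ℝ) + m + 2) / (I.α * I.σ)⌋₊ := rfl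
    rw [h4]
    linarith
  refine ⟨Nat.le_floor ?_, key _ hσ hσ1 (by nlinarith), key _ hα hα1 (by nlinarith)⟩
  push_cast
  rw [le_div_iff₀ (by positivity)]
  have : I.α * I.σ ≤ 1 := by nlinarith
  nlinarith

lemma Input.large (hσ : 0 < I.σ) (hα : 0 < I.α) (hA : 1 ≤ vol I.G I.A) :
    Large I.par m ((I.scale ^ 16 : ℕ) : ℤ) := by
  obtain ⟨h1, h2, h3⟩ := I.scale_bounds hσ hα
  have hP := I.parOK hσ hα
  have hlen : I.par.inc.length = vol I.G I.A := I.length_tokens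
  have hK : I.par.K = 6 * ⌈1 / I.σ⌉₊ ^ 2 := rfl
  have hb : I.par.b = 4 * ⌈1 / I.α⌉₊ := rfl
  have hL : I.par.L = Nat.log 2 (I.par.K * I.par.inc.length) + 1 := rfl
  have hKp : I.par.Kp ≤ I.par.K := by
    have h4 := hP.Kp_upper
    have h5 : (I.par.K : ℝ) * I.σ ≤ I.par.K := mul_le_of_le_one_right (by positivity) I.σ_le_one
    rify
    linarith
  have hV : vol I.G I.A ≤ n * m := I.vol_le _
  generalize I.par = P at *
  generalize I.scale = Y at *
  generalize ⌈1 / I.σ⌉₊ = N at *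
  generalize ⌈1 / I.α⌉₊ = B at *
  rw [← hlen] at hV hA
  have hY : 2 ≤ Y := by omega
  have hpow : ∀ i j, i ≤ j → Y ^ i ≤ Y ^ j := fun i j h => Nat.pow_le_pow_right (by omega) h
  have hY2 : 4 ≤ Y ^ 2 := by nlinarith
  have hK' : P.K ≤ Y ^ 5 := by
    calc P.K ≤ 8 * Y ^ 2 := by rw [hK]; gcongr; norm_num
      _ ≤ Y ^ 3 * Y ^ 2 := by gcongr; exact Nat.pow_le_pow_left hY 3
      _ = Y ^ 5 := by ring
  have hb' : P.b ≤ Y ^ 3 := by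
    calc P.b ≤ 4 * Y := by rw [hb]; gcongr
      _ ≤ Y ^ 2 * Y := by gcongr
      _ = Y ^ 3 := by ring
  have hV' : P.inc.length ≤ Y ^ 2 := by
    calc P.inc.length ≤ n * m := hV
      _ ≤ Y * Y := by gcongr <;> omega
      _ = Y ^ 2 := by ring
  have hKV : P.K * P.inc.length ≤ Y ^ 7 := by
    calc P.K * P.inc.length ≤ Y ^ 5 * Y ^ 2 := by gcongr
      _ = Y ^ 7 := by ring
  -- For the word size a logarithm may be bounded by its argument; the sharp estimate is needed only
  -- for time.
  have hL' : P.L ≤ Y ^ 7 := by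
    rw [hL]
    by_cases h0 : P.K * P.inc.length = 0
    · rw [h0]; simpa using Nat.one_le_pow _ _ (by omega)
    · exact (Nat.log_lt_self 2 h0).trans_le hKV
  have hU : P.U ≤ Y ^ 8 := by
    calc P.U ≤ Y ^ 5 * Y ^ 3 := by rw [Par.U]; gcongr
      _ = Y ^ 8 := by ring
  have hh : P.h ≤ Y ^ 10 + 1 := by
    calc P.h ≤ Y ^ 3 * Y ^ 7 + 1 := by rw [Par.h]; gcongr
      _ = _ := by ring
  have e1 := hpow 1 10 (by norm_num)
  have e2 := hpow 3 10 (by norm_num)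
  have e3 := hpow 5 10 (by norm_num)
  have e4 := hpow 8 10 (by norm_num)
  have e5 := hpow 7 10 (by norm_num)
  rw [pow_one] at e1
  have e6 : 32 * Y ^ 10 ≤ Y ^ 16 := by
    calc 32 * Y ^ 10 ≤ Y ^ 5 * Y ^ 10 := by gcongr; exact Nat.pow_le_pow_left hY 5
      _ = Y ^ 15 := by ring
      _ ≤ _ := hpow 15 16 (by norm_num)
  have hscan : (P.b + 3) * (P.K * P.inc.length) ≤ 4 * Y ^ 10 := by
    calc (P.b + 3) * (P.K * P.inc.length) ≤ (Y ^ 3 + 3 * Y ^ 3) * Y ^ 7 := by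
          gcongr
          have := Nat.one_le_pow 3 Y (by omega)
          omega
      _ = _ := by ring
  generalize Y ^ 16 = W at *
  refine ⟨?_, ?_, ?_⟩
  · have : 2 * n + m + P.h + P.U + P.Kp + P.K + P.b + 10 ≤ W := by omega
    exact_mod_cast this
  · have : P.K * P.inc.length + 1 ≤ W := by omega
    exact_mod_cast this
  · have : (P.b + 3) * (P.K * P.inc.length) ≤ W := by omega
    exact_mod_cast this

/-- The time bound may contain only logarithms of `n + m`, not of `1/σ`. Condition (ii) helps: `2 *
vol A ≤ σ * n * m` with `vol A ≥ 1` bounds `1/σ`, hence `K`, polynomially. -/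
lemma Input.L_le (hI : IsSpecial I) (hA : 1 ≤ vol I.G I.A) :
    (I.par.L : ℝ) ≤ 20 * Real.log ((n : ℝ) + m + 2) := by
  have hσ := hI.2.1
  have hP := I.parOK hσ hI.1
  have hlen : I.par.inc.length = vol I.G I.A := I.length_tokens
  have hL : I.par.L = Nat.log 2 (I.par.K * I.par.inc.length) + 1 := rfl
  have hK := hP.K_upper
  have hVc : vol I.G I.Aᶜ ≤ n * m := I.vol_le _
  have h2 := hI.two_mul_vol_le
  generalize I.par = P at *
  rw [hlen] at hL
  set y : ℝ := (n : ℝ) + m + 2 with hy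
  have hn : (0 : ℝ) ≤ n := by positivity
  have hm : (0 : ℝ) ≤ m := by positivity
  have hy2 : 2 ≤ y := by linarith
  rify at hVc hA
  set V : ℝ := (vol I.G I.A : ℝ)
  have h3 : (vol I.G I.Aᶜ : ℝ) ≤ y ^ 2 := by nlinarith
  have h4 : 2 * V ≤ I.σ * y ^ 2 := h2.trans (by gcongr)
  have h5 : (2 * V) ^ 2 ≤ (I.σ * y ^ 2) ^ 2 := by gcongr
  have h6 : (P.K : ℝ) * V ≤ 6 * y ^ 4 := by
    have h7 : P.K * (2 * V) ^ 2 ≤ 24 * y ^ 4 := by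
      calc P.K * (2 * V) ^ 2 ≤ P.K * (I.σ * y ^ 2) ^ 2 := by gcongr
        _ = P.K * I.σ ^ 2 * y ^ 4 := by ring
        _ ≤ 24 * y ^ 4 := by gcongr
    have h8 : (P.K : ℝ) * V ≤ P.K * V ^ 2 := by
      gcongr
      nlinarith
    nlinarith
  have h7 : (P.K : ℝ) * V ≤ y ^ 7 := by
    calc (P.K : ℝ) * V ≤ 6 * y ^ 4 := h6
      _ ≤ y ^ 3 * y ^ 4 := by
          gcongr
          calc (6 : ℝ) ≤ 2 ^ 3 := by norm_num
            _ ≤ y ^ 3 := by gcongr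
      _ = y ^ 7 := by ring
  have hlog2 : (0.6931471803 : ℝ) < Real.log 2 := Real.log_two_gt_d9
  have hlogy : Real.log 2 ≤ Real.log y := Real.log_le_log (by norm_num) hy2
  have h8 : (Nat.log 2 (P.K * vol I.G I.A) : ℝ) * Real.log 2 ≤ 7 * Real.log y := by
    by_cases h0 : P.K * vol I.G I.A = 0
    · rw [h0]; simp; linarith
    · have h9 := Nat.pow_log_le_self 2 h0
      rify at h9
      have h10 := Real.log_le_log (by positivity) (h9.trans h7)
      rwa [Real.log_pow, Real.log_pow] at h10
  rw [hL]
  push_cast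
  have h11 : (0 : ℝ) ≤ Nat.log 2 (P.K * vol I.G I.A) := by positivity
  nlinarith

/-- The factor `1/α` comes from `b`, the factor `1/σ²` from `K`, and the logarithm from `L`, through
`h ≤ 2 * b * L`. -/
lemma Input.time_le (hI : IsSpecial I) (hA : 1 ≤ vol I.G I.A) :
    ((5000 * (I.par.h * (I.par.K * vol I.G I.A)) : ℕ) : ℝ) ≤
      10 ^ 8 * (1 + (vol I.G I.A : ℝ) / (I.α * I.σ ^ 2)) * Real.log ((n : ℝ) + m + 2) := by
  have hσ := hI.2.1
  have hα := hI.1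
  have hP := I.parOK hσ hα
  have hL := I.L_le hI hA
  have hL1 : 1 ≤ I.par.L := by simp [Input.par]
  have hb := hP.b_upper
  have hb1 := hP.b_lower
  have hK := hP.K_upper
  have hh : I.par.h = I.par.b * I.par.L + 1 := rfl
  generalize I.par = P at *
  have hb0 : 1 ≤ P.b := by
    by_contra h
    have : P.b = 0 := by omega
    rw [this] at hb1
    norm_num at hb1
  have hh2 : P.h ≤ 2 * (P.b * P.L) := by
    have := Nat.mul_le_mul hb0 hL1
    omega
  rify at hh2
  set V : ℝ := (vol I.G I.A : ℝ)
  set l := Real.log ((n : ℝ) + m + 2)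
  have hl : 0 ≤ l := by
    have : (0 : ℝ) ≤ P.L := by positivity
    linarith
  have hb' : (P.b : ℝ) ≤ 8 / I.α := by rwa [le_div_iff₀ hα]
  have hK' : (P.K : ℝ) ≤ 24 / I.σ ^ 2 := by rwa [le_div_iff₀ (by positivity)]
  have hV : 0 ≤ V := by positivity
  push_cast
  calc (5000 : ℝ) * (P.h * (P.K * V))
      ≤ 5000 * (2 * (8 / I.α * (20 * l)) * (24 / I.σ ^ 2 * V)) := by
        gcongr
        exact hh2.trans (by gcongr)
    _ = 38400000 * (V / (I.α * I.σ ^ 2)) * l := by field_simp; ring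
    _ ≤ 10 ^ 8 * (1 + V / (I.α * I.σ ^ 2)) * l := by
        have : 0 ≤ V / (I.α * I.σ ^ 2) := by positivity
        gcongr
        · norm_num
        · linarith

end Bounds
end LBS

theorem mainTheorem5 :
    ∃ (P : LBS.Program) (csize ccon : ℝ → ℝ) (C : ℝ) (k c : ℕ),
      (∀ σ : ℝ, 0 < σ → σ ≤ 1 →
        (1 ≤ csize σ ∧ csize σ ≤ C / σ ^ 2) ∧ (1 ≤ ccon σ ∧ ccon σ ≤ C / σ ^ 2)) ∧
      LBS.IsApproxLBSCutAlgorithm P csize ccon (fun {_ _} I => LBS.IsSpecial I)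
        (fun {n m} I => (((n : ℝ) + m + 2) / (I.α * I.σ)) ^ c)
        (fun {n m} I => C * (1 + (LBS.vol I.G I.A : ℝ) / (I.α * I.σ ^ 2)) *
          Real.log ((n : ℝ) + m + 2) ^ k) := by
  refine ⟨LBS.mainProgram, fun σ => 192 / σ ^ 2, fun σ => 384 / σ ^ 2, 10 ^ 8, 1, 16, ?_, ?_⟩
  · intro σ h0 h1
    have h2 : 0 < σ ^ 2 := by positivity
    have h3 : σ ^ 2 ≤ 1 := pow_le_one₀ h0.le h1
    refine ⟨⟨?_, ?_⟩, ⟨?_, ?_⟩⟩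
    · rw [le_div_iff₀ h2]; linarith
    · exact div_le_div_of_nonneg_right (by norm_num) h2.le
    · rw [le_div_iff₀ h2]; linarith
    · exact div_le_div_of_nonneg_right (by norm_num) h2.le
  · intro n m I hI
    have hσ := hI.2.1
    have hα := hI.1
    obtain ⟨h1, -, -⟩ := I.scale_bounds hσ hα
    have hword : (((I.scale ^ 16 : ℕ) : ℤ) : ℝ) ≤ (((n : ℝ) + m + 2) / (I.α * I.σ)) ^ 16 := by
      push_cast
      gcongr
      exact Nat.floor_le (by positivity)
    rcases (LBS.vol I.G I.A).eq_zero_or_pos with hA | hA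
    · have hZ : (n + 1 : ℤ) ≤ ((I.scale ^ 16 : ℕ) : ℤ) := by
        have h2 : I.scale ≤ I.scale ^ 16 := Nat.le_self_pow (by norm_num) _
        omega
      obtain ⟨s, t, h2, h3, h4⟩ :=
        LBS.mainProgram_wp_of_vol_eq_zero hI hZ hA (192 / I.σ ^ 2)
      refine ⟨s, t, h2.mono hword, ?_, h3⟩
      have h5 : (t : ℝ) ≤ 10 := by exact_mod_cast h4
      -- The summand `2` inside the logarithm keeps it bounded away from zero, so the bound also
      -- covers constant time.
      have h6 : (0.6931471803 : ℝ) < Real.log 2 := Real.log_two_gt_d9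
      have h7 : Real.log 2 ≤ Real.log ((n : ℝ) + m + 2) :=
        Real.log_le_log (by norm_num) (by
          have : (0 : ℝ) ≤ n + m := by positivity
          linarith)
      simp only [hA, Nat.cast_zero, zero_div, add_zero, mul_one, pow_one]
      linarith
    · obtain ⟨s, t, h2, h3, h4⟩ := LBS.mainProgram_wp hI (I.large hσ hα hA) hA
      refine ⟨s, t, h2.mono hword, ?_, h3⟩
      have h5 := I.time_le hI hA
      have h6 : (t : ℝ) ≤ ((5000 * (I.par.h * (I.par.K * LBS.vol I.G I.A)) : ℕ) : ℝ) := by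
        exact_mod_cast h4
      simpa using h6.trans h5
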